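/- **Theorem 2.7 (strict).** Multicategories are symmetric multicategories: sets $M(x_1,\dots,x_n;y)$ of $n$-morphisms ($n\ge 0$) with identities, an associative and unital multicomposition, and right actions of the symmetric groups for which composition is equivariant. Multifunctors preserve all of this. A permutative category is a symmetric monoidal category whose product is strictly associative and strictly unital (associators and unitors are identities). A strict map is a functor that preserves unit, product and all structure isomorphisms on the nose. A functor is a homotopy equivalence of categories if it induces a homotopy equivalence of classifying spaces. *Notation.* For a symmetric monoidal category $\mathcal C$ and a tuple $\mathbf x=(x_1,\dots,x_n)$ of objects let $\overline\kappa\mathbf x=((x_1\oplus x_2)\oplus\cdots)\oplus x_n$, with $\overline\kappa()=e$ and $\overline\kappa(x_1)=x_1$. The underlying multicategory $U\mathcal C$ has the objects of $\mathcal C$ and $U\mathcal C(\mathbf x;y)=\mathcal C(\overline\kappa\mathbf x,y)$, with composition and permutations defined through the canonical (coherence) isomorphisms of $\mathcal C$. A lax symmetric monoidal functor $F$ gives $UF$, by applying $F$ and precomposing with the iterated structure map $\overline\kappa F\mathbf x\to F\overline\kappa\mathbf x$. The weak left adjoint $L$ sends a multicategory $M$ to $LM$, whose objects are the tuples $(x_1,\dots,x_j)$,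 $j\ge0$, of objects of $M$. A morphism $(x_1,\dots,x_j)\to(y_1,\dots,y_n)$ is a pair $(f,\langle\phi_s\rangle)$ of a function $f:\{1,\dots,j\}\to\{1,\dots,n\}$ and multimorphisms $\phi_s\in M(\langle x_r\rangle_{f(r)=s};y_s)$ for $1\le s\le n$. These are composed by composing the functions and, after rearrangement of the sources, the multimorphisms. The product is concatenation, the unit is the empty tuple, and the symmetry exchanges blocks. For a multifunctor $F$, $LF(x_1,\dots,x_j)=(Fx_1,\dots,Fx_j)$ and $LF(f,\langle\phi_s\rangle)=(f,\langle F\phi_s\rangle)$. The weak counit $\varepsilon:LU\mathcal C\to\mathcal C$ sends $\mathbf x$ to $\overline\kappa\mathbf x$, and $(f,\langle\phi_s\rangle):\mathbf x\to\mathbf y$ to the canonical isomorphism $\overline\kappa\mathbf x\cong\overline\kappa\langle\overline\kappa\langle x_r\rangle_{f(r)=s}\rangle_s$ followed by the product $\overline\kappa\langle\phi_s\rangle$. Write $\eta:\mathcal C\to LU\mathcal C$ for the functor $x\mapsto(x)$, $\phi\mapsto(\mathrm{id},\phi)$. *Statement.* 1. For every multicategory $M$, $LM$ is a permutative category, and for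 every multifunctor $F$, $LF$ is a strict map; moreover $L(\mathrm{id})=\mathrm{id}$ and $L(GF)=LG\circ LF$. 2. For every symmetric monoidal category $\mathcal C$, $U\mathcal C$ is a multicategory, and for every lax symmetric monoidal functor $F$, $UF$ is a multifunctor; $U(\mathrm{id})=\mathrm{id}$ and $U(GF)=UG\circ UF$. Hence the functor $LU$ underlying the comonad of the weak adjunction sends symmetric monoidal categories and lax symmetric monoidal functors to permutative categories and strict maps. 3. For every symmetric monoidal category $\mathcal C$, $\varepsilon:LU\mathcal C\to\mathcal C$ is a functor and a homotopy equivalence of categories. In fact $\eta$ is a functor, $\varepsilon\eta=\mathrm{id}_{\mathcal C}$, and the morphisms $\nu_{\mathbf x}:\mathbf x\to(\overline\kappa\mathbf x)$ given by the unique function to $\{1\}$ and $\mathrm{id}_{\overline\kappa\mathbf x}$ form a natural map $\mathrm{id}\to\eta\varepsilon$. -/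

import Mathlib

open CategoryTheory MonoidalCategory

universe v u

set_option linter.checkUnivs false

/-! ## Tuples, concatenation and fibres -/

/-- The concatenation of tuples `x 0, x 1, …, x (n - 1)`, in lexicographic order. -/
def concat {A : Type*} {n : ℕ} {k : Fin n → ℕ} (x : ∀ s, Fin (k s) → A) :
    Fin (∑ s, k s) → A :=
  fun i => x (finSigmaFinEquiv.symm i).1 (finSigmaFinEquiv.symm i).2

theorem concat_apply {A : Type*} {n : ℕ} {k : Fin n → ℕ} (x : ∀ s, Fin (k s) → A)
    (p : Σ s, Fin (k s)) : concat x (finSigmaFinEquiv p) = x p.1 p.2 :=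
  congrArg (fun q : Σ s, Fin (k s) => x q.1 q.2) (finSigmaFinEquiv.symm_apply_apply p)

/-- A bijection of index pairs, read as a bijection of positions in concatenated tuples. -/
def flat {m n : ℕ} {k : Fin m → ℕ} {l : Fin n → ℕ}
    (E : (Σ s, Fin (k s)) ≃ (Σ s, Fin (l s))) : Fin (∑ s, k s) ≃ Fin (∑ s, l s) :=
  finSigmaFinEquiv.symm.trans (E.trans finSigmaFinEquiv)

theorem concat_flat {A : Type*} {m n : ℕ} {k : Fin m → ℕ} {l : Fin n → ℕ}
    (E : (Σ s, Fin (k s)) ≃ (Σ s, Fin (l s)))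
    (x : ∀ s, Fin (k s) → A) (y : ∀ s, Fin (l s) → A)
    (h : ∀ p, x p.1 p.2 = y (E p).1 (E p).2) : concat x = concat y ∘ flat E := by
  funext i
  exact (h _).trans (concat_apply y (E (finSigmaFinEquiv.symm i))).symm

/-- The permutation of positions induced on a concatenation by a permutation `σ` of its blocks. -/
def blockPerm {m n : ℕ} (σ : Fin m ≃ Fin n) (k : Fin n → ℕ) :
    Fin (∑ s, k (σ s)) ≃ Fin (∑ s, k s) :=
  flat (Equiv.sigmaCongrLeft (β := fun s => Fin (k s)) σ)

/-- The block sum of permutations of the single blocks. -/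
def blockSum {n : ℕ} {k l : Fin n → ℕ} (τ : ∀ s, Fin (k s) ≃ Fin (l s)) :
    Fin (∑ s, k s) ≃ Fin (∑ s, l s) :=
  flat (Equiv.sigmaCongrRight τ)

/-- The order preserving identification of the positions in the two ways to concatenate a family
of tuples that is indexed by `s` and `t`. -/
def assocEquiv {n : ℕ} {j : Fin n → ℕ} (k : ∀ s, Fin (j s) → ℕ) :
    Fin (∑ i, concat k i) ≃ Fin (∑ s, ∑ t, k s t) :=
  flat ((Equiv.sigmaCongrLeft (β := fun p : Σ s, Fin (j s) => Fin (k p.1 p.2))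
      finSigmaFinEquiv.symm).trans
    ((Equiv.sigmaAssoc fun s t => Fin (k s t)).trans
      (Equiv.sigmaCongrRight fun _ => finSigmaFinEquiv)))

/-- The order preserving identification of positions for `n` blocks of length one. -/
def unitsEquiv (n : ℕ) : Fin (∑ _s : Fin n, 1) ≃ Fin n :=
  finSigmaFinEquiv.symm.trans (Equiv.sigmaUnique (Fin n) fun _ => Fin 1)

/-- The order preserving identification of positions for one block of length `n`. -/
def oneBlockEquiv (n : ℕ) : Fin (∑ _s : Fin 1, n) ≃ Fin n :=
  finSigmaFinEquiv.symm.trans (Equiv.uniqueSigma fun _ : Fin 1 => Fin n)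

theorem concat_oneBlock {A : Type*} {n : ℕ} (x : Fin n → A) :
    concat (fun _ : Fin 1 => x) = x ∘ oneBlockEquiv n := by
  funext i
  obtain ⟨⟨s, t⟩, rfl⟩ := finSigmaFinEquiv.surjective i
  obtain rfl : s = 0 := Subsingleton.elim _ _
  rw [concat_apply]
  simp [oneBlockEquiv]
  rfl

theorem concat_concat {A : Type*} {n : ℕ} {j : Fin n → ℕ} {k : ∀ s, Fin (j s) → ℕ}
    (a : ∀ s t, Fin (k s t) → A) :
    concat (k := concat k) (fun _ => a _ _) = (concat fun s => concat (a s)) ∘ assocEquiv k :=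
  concat_flat _ (fun _ => a _ _) (fun s => concat (a s)) fun p =>
    (concat_apply (a _) ⟨_, p.2⟩).symm

/-- The number of elements of the fibre `f⁻¹(s)`. -/
def fibCard {m n : ℕ} (f : Fin m → Fin n) (s : Fin n) : ℕ := Fintype.card {r // f r = s}

/-- The increasing enumeration of the fibre `f⁻¹(s)`. -/
def fibEquiv {m n : ℕ} (f : Fin m → Fin n) (s : Fin n) :
    Fin (fibCard f s) ≃ {r // f r = s} :=
  (monoEquivOfFin {r // f r = s} rfl).toEquiv

/-- The increasing enumeration of `f⁻¹(s)`, as a map; `x ∘ fib f s` is the subtuple of `x` with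
the indices `r` such that `f r = s`, in their given order. -/
def fib {m n : ℕ} (f : Fin m → Fin n) (s : Fin n) : Fin (fibCard f s) → Fin m :=
  fun i => (fibEquiv f s i).1

theorem apply_fib {m n : ℕ} (f : Fin m → Fin n) (s : Fin n) (i : Fin (fibCard f s)) :
    f (fib f s i) = s := (fibEquiv f s i).2

/-- The positions in the concatenation of all fibres, compared with the original positions. -/
def fibSigma {m n : ℕ} (f : Fin m → Fin n) : Fin (∑ s, fibCard f s) ≃ Fin m :=
  finSigmaFinEquiv.symm.trans
    ((Equiv.sigmaCongrRight fun s => fibEquiv f s).trans (Equiv.sigmaFiberEquiv f))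

/-- The elements `r` with `g (f r) = t`, listed by the fibres of `f` over the elements of the
fibre of `g` over `t`. -/
def fibPairs {m n p : ℕ} (f : Fin m → Fin n) (g : Fin n → Fin p) (t : Fin p) :
    (Σ i, Fin (fibCard f (fib g t i))) ≃ {r // (g ∘ f) r = t} :=
  (Equiv.sigmaCongrRight fun i => fibEquiv f (fib g t i)).trans
    ((Equiv.sigmaCongrLeft (β := fun s : {s // g s = t} => {r // f r = s.1})
        (fibEquiv g t)).trans
      (Equiv.sigmaSubtypeFiberEquivSubtype f (p := fun r => (g ∘ f) r = t)
        (q := fun s => g s = t) fun _ => Iff.rfl))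

theorem fibPairs_apply {m n p : ℕ} (f : Fin m → Fin n) (g : Fin n → Fin p) (t : Fin p)
    (c : Σ i, Fin (fibCard f (fib g t i))) :
    (fibPairs f g t c).1 = fib f (fib g t c.1) c.2 := rfl

/-- The fibre of `g ∘ f` over `t`, rearranged into the concatenation of the fibres of `f` over
the elements of the fibre of `g` over `t`. -/
def fibComp {m n p : ℕ} (f : Fin m → Fin n) (g : Fin n → Fin p) (t : Fin p) :
    Fin (fibCard (g ∘ f) t) ≃ Fin (∑ i, fibCard f (fib g t i)) :=
  (fibEquiv (g ∘ f) t).trans ((fibPairs f g t).symm.trans finSigmaFinEquiv)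

theorem fib_fibComp {m n p : ℕ} (f : Fin m → Fin n) (g : Fin n → Fin p) (t : Fin p)
    (a : Fin (fibCard (g ∘ f) t)) :
    fib (g ∘ f) t a = concat (fun i => fib f (fib g t i)) (fibComp f g t a) := by
  refine Eq.trans ?_ (concat_apply (fun i => fib f (fib g t i))
    ((fibPairs f g t).symm (fibEquiv (g ∘ f) t a))).symm
  rw [← fibPairs_apply, Equiv.apply_symm_apply]
  rfl

/-! ## Multicategories -/

/-- The data of a (symmetric) multicategory: objects, sets `M (x₁, …, xₙ; y)` of `n`-morphisms,
identities, multicomposition, and the right action of permutations.  A bijection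
`Fin m ≃ Fin n` exists only for `m = n`, so `perm` is an action of the symmetric groups,
`M (x₁, …, xₙ; y) → M (x_{σ 1}, …, x_{σ n}; y)`; the two letters `m`, `n`, and the source `x'`
that is only provably equal to `x ∘ σ`, merely avoid casts. -/
structure MultiData where
  Ob : Type u
  Hom : {n : ℕ} → (Fin n → Ob) → Ob → Type v
  id : ∀ a : Ob, Hom (fun _ : Fin 1 => a) a
  comp : ∀ {n : ℕ} {k : Fin n → ℕ} {x : ∀ s, Fin (k s) → Ob} {y : Fin n → Ob} {z : Ob},
    Hom y z → (∀ s, Hom (x s) (y s)) → Hom (concat x) z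
  perm : ∀ {m n : ℕ} {x : Fin n → Ob} {x' : Fin m → Ob} {y : Ob} (σ : Fin m ≃ Fin n),
    x' = x ∘ σ → Hom x y → Hom x' y

/-- The axioms of a multicategory: permutations act on the right, composition is associative and
unital, and it is equivariant in both variables.  The order preserving bijections on the right
hand sides only identify index sets of equal tuples. -/
structure MultiData.IsMulticategory (M : MultiData.{v, u}) : Prop where
  perm_refl : ∀ {n : ℕ} {x : Fin n → M.Ob} {y : M.Ob} (f : M.Hom x y),
    M.perm (Equiv.refl (Fin n)) rfl f = f
  perm_perm : ∀ {l m n : ℕ} {x : Fin n → M.Ob} {y : M.Ob} (σ : Fin m ≃ Fin n)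
    (τ : Fin l ≃ Fin m) (f : M.Hom x y),
    M.perm τ rfl (M.perm σ rfl f) = M.perm (x' := (x ∘ σ) ∘ τ) (τ.trans σ) rfl f
  id_comp : ∀ {n : ℕ} {x : Fin n → M.Ob} {y : M.Ob} (f : M.Hom x y),
    M.comp (x := fun _ : Fin 1 => x) (M.id y) (fun _ => f) =
      M.perm (oneBlockEquiv n) (concat_oneBlock x) f
  comp_id : ∀ {n : ℕ} {x : Fin n → M.Ob} {y : M.Ob} (f : M.Hom x y),
    M.comp f (fun s => M.id (x s)) = M.perm (unitsEquiv n) rfl f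
  assoc : ∀ {n : ℕ} {j : Fin n → ℕ} {k : ∀ s, Fin (j s) → ℕ}
    {a : ∀ s t, Fin (k s t) → M.Ob} {b : ∀ s, Fin (j s) → M.Ob} {c : Fin n → M.Ob} {d : M.Ob}
    (f : M.Hom c d) (g : ∀ s, M.Hom (b s) (c s)) (h : ∀ s t, M.Hom (a s t) (b s t)),
    M.comp (k := concat k) (x := fun _ => a _ _) (M.comp f g) (fun _ => h _ _) =
      M.perm (assocEquiv k)
        (concat_concat a)
        (M.comp f fun s => M.comp (g s) (h s))
  perm_comp : ∀ {m n : ℕ} {k : Fin n → ℕ} {x : ∀ s, Fin (k s) → M.Ob} {y : Fin n → M.Ob}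
    {z : M.Ob} (σ : Fin m ≃ Fin n) (f : M.Hom y z) (g : ∀ s, M.Hom (x s) (y s)),
    M.comp (M.perm σ rfl f) (fun s => g (σ s)) =
      M.perm (blockPerm σ k) (concat_flat _ _ _ fun _ => rfl) (M.comp f g)
  comp_perm : ∀ {n : ℕ} {k l : Fin n → ℕ} {x : ∀ s, Fin (l s) → M.Ob} {y : Fin n → M.Ob}
    {z : M.Ob} (τ : ∀ s, Fin (k s) ≃ Fin (l s)) (f : M.Hom y z) (g : ∀ s, M.Hom (x s) (y s)),
    M.comp f (fun s => M.perm (τ s) rfl (g s)) =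
      M.perm (blockSum τ) (concat_flat _ _ _ fun _ => rfl) (M.comp f g)

/-- The data of a multifunctor. -/
@[ext]
structure MultifunctorData (M N : MultiData.{v, u}) where
  obj : M.Ob → N.Ob
  map : ∀ {n : ℕ} {x : Fin n → M.Ob} {y : M.Ob}, M.Hom x y → N.Hom (obj ∘ x) (obj y)

/-- A multifunctor preserves identities, composition and the action of permutations. -/
structure MultifunctorData.IsMultifunctor {M N : MultiData.{v, u}} (F : MultifunctorData M N) :
    Prop where
  map_id : ∀ a : M.Ob, F.map (M.id a) = N.id (F.obj a)
  map_comp : ∀ {n : ℕ} {k : Fin n → ℕ} {x : ∀ s, Fin (k s) → M.Ob} {y : Fin n → M.Ob}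
    {z : M.Ob} (f : M.Hom y z) (g : ∀ s, M.Hom (x s) (y s)),
    F.map (M.comp f g) = N.comp (F.map f) fun s => F.map (g s)
  map_perm : ∀ {m n : ℕ} {x : Fin n → M.Ob} {y : M.Ob} (σ : Fin m ≃ Fin n) (f : M.Hom x y),
    F.map (M.perm σ rfl f) = N.perm (x' := F.obj ∘ (x ∘ σ)) σ rfl (F.map f)

/-- The identity multifunctor. -/
def MultifunctorData.id (M : MultiData.{v, u}) : MultifunctorData M M where
  obj a := a
  map f := f

/-- Composition of multifunctors, `F` first. -/
def MultifunctorData.comp {M N P : MultiData.{v, u}} (F : MultifunctorData M N)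
    (G : MultifunctorData N P) : MultifunctorData M P where
  obj a := G.obj (F.obj a)
  map f := G.map (F.map f)

/-! ## Permutative categories and strict maps -/

/-- The data of a category. -/
structure CatData where
  Ob : Type u
  Hom : Ob → Ob → Type v
  id : ∀ a, Hom a a
  comp : ∀ {a b c}, Hom a b → Hom b c → Hom a c

/-- The axioms of a category. -/
structure CatData.IsCategory (D : CatData.{v, u}) : Prop where
  id_comp : ∀ {a b} (f : D.Hom a b), D.comp (D.id a) f = f
  comp_id : ∀ {a b} (f : D.Hom a b), D.comp f (D.id b) = f
  assoc : ∀ {a b c d} (f : D.Hom a b) (g : D.Hom b c) (h : D.Hom c d),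
    D.comp (D.comp f g) h = D.comp f (D.comp g h)

/-- The category with given data. -/
abbrev CatData.IsCategory.category {D : CatData.{v, u}} (h : D.IsCategory) :
    Category.{v} D.Ob where
  Hom := D.Hom
  id := D.id
  comp f g := D.comp f g
  id_comp := h.id_comp
  comp_id := h.comp_id
  assoc := h.assoc

/-- The data of a functor. -/
@[ext]
structure FunctorData (D E : CatData.{v, u}) where
  obj : D.Ob → E.Ob
  map : ∀ {a b}, D.Hom a b → E.Hom (obj a) (obj b)

/-- The axioms of a functor. -/
structure FunctorData.IsFunctor {D E : CatData.{v, u}} (F : FunctorData D E) : Prop where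
  map_id : ∀ a, F.map (D.id a) = E.id (F.obj a)
  map_comp : ∀ {a b c} (f : D.Hom a b) (g : D.Hom b c),
    F.map (D.comp f g) = E.comp (F.map f) (F.map g)

/-- The functor with given data. -/
abbrev FunctorData.IsFunctor.functor {D E : CatData.{v, u}} {F : FunctorData D E}
    (hF : F.IsFunctor) (hD : D.IsCategory) (hE : E.IsCategory) :
    letI := hD.category
    letI := hE.category
    D.Ob ⥤ E.Ob :=
  letI := hD.category
  letI := hE.category
  { obj := F.obj
    map := fun f => F.map f
    map_id := hF.map_id
    map_comp := hF.map_comp }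

/-- The identity functor. -/
def FunctorData.id (D : CatData.{v, u}) : FunctorData D D where
  obj a := a
  map f := f

/-- Composition of functors, `F` first. -/
def FunctorData.comp {D E G : CatData.{v, u}} (F : FunctorData D E) (F' : FunctorData E G) :
    FunctorData D G where
  obj a := F'.obj (F.obj a)
  map f := F'.map (F.map f)

/-- The data of a symmetric monoidal category.  Inverses of the associator and the unitors are
included; the inverse of a symmetry is again a symmetry. -/
structure SymMonData extends CatData.{v, u} where
  unit : Ob
  tensorObj : Ob → Ob → Ob
  tensorHom : ∀ {a b c d}, Hom a b → Hom c d → Hom (tensorObj a c) (tensorObj b d)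
  associator : ∀ a b c, Hom (tensorObj (tensorObj a b) c) (tensorObj a (tensorObj b c))
  associatorInv : ∀ a b c, Hom (tensorObj a (tensorObj b c)) (tensorObj (tensorObj a b) c)
  leftUnitor : ∀ a, Hom (tensorObj unit a) a
  leftUnitorInv : ∀ a, Hom a (tensorObj unit a)
  rightUnitor : ∀ a, Hom (tensorObj a unit) a
  rightUnitorInv : ∀ a, Hom a (tensorObj a unit)
  braiding : ∀ a b, Hom (tensorObj a b) (tensorObj b a)

/-- The data underlying a category. -/
def CatData.of (C : Type u) [Category.{v} C] : CatData.{v, u} where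
  Ob := C
  Hom a b := a ⟶ b
  id a := 𝟙 a
  comp f g := f ≫ g

theorem CatData.of_isCategory (C : Type u) [Category.{v} C] : (CatData.of C).IsCategory where
  id_comp f := Category.id_comp (obj := C) f
  comp_id f := Category.comp_id (obj := C) f
  assoc f g h := Category.assoc (obj := C) f g h

/-- The data underlying a symmetric monoidal category. -/
def SymMonData.of (C : Type u) [Category.{v} C] [MonoidalCategory C] [SymmetricCategory C] :
    SymMonData.{v, u} where
  Ob := C
  Hom a b := a ⟶ b
  id a := 𝟙 a
  comp f g := f ≫ g
  unit := 𝟙_ C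
  tensorObj a b := a ⊗ b
  tensorHom f g := f ⊗ₘ g
  associator a b c := (α_ a b c).hom
  associatorInv a b c := (α_ a b c).inv
  leftUnitor a := (λ_ a).hom
  leftUnitorInv a := (λ_ a).inv
  rightUnitor a := (ρ_ a).hom
  rightUnitorInv a := (ρ_ a).inv
  braiding a b := (β_ a b).hom

/-- A monoidal category is strict if the tensor product is associative and unital on the nose,
with identities as associators and unitors. -/
structure IsStrictMonoidal (C : Type u) [Category.{v} C] [MonoidalCategory C] : Prop where
  assoc : ∀ a b c : C, ∃ h : (a ⊗ b) ⊗ c = a ⊗ (b ⊗ c), (α_ a b c).hom = eqToHom h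
  left_unit : ∀ a : C, ∃ h : 𝟙_ C ⊗ a = a, (λ_ a).hom = eqToHom h
  right_unit : ∀ a : C, ∃ h : a ⊗ 𝟙_ C = a, (ρ_ a).hom = eqToHom h

/-- A permutative category is a symmetric monoidal category that is strictly associative and
strictly unital. -/
def SymMonData.IsPermutative (D : SymMonData.{v, u}) : Prop :=
  ∃ (_ : Category.{v} D.Ob) (_ : MonoidalCategory D.Ob) (_ : SymmetricCategory D.Ob),
    SymMonData.of D.Ob = D ∧ IsStrictMonoidal D.Ob

/-- A strict map of symmetric monoidal categories: a functor that preserves the unit, the tensor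
product, the associators, unitors and symmetries on the nose. -/
structure IsStrictMap (D E : SymMonData.{v, u}) (F : FunctorData D.toCatData E.toCatData) :
    Prop where
  isFunctor : F.IsFunctor
  obj_unit : F.obj D.unit = E.unit
  obj_tensor : ∀ a b, F.obj (D.tensorObj a b) = E.tensorObj (F.obj a) (F.obj b)
  map_tensor : ∀ {a b c d} (f : D.Hom a b) (g : D.Hom c d),
    F.map (D.tensorHom f g) ≍ E.tensorHom (F.map f) (F.map g)
  map_associator : ∀ a b c,
    F.map (D.associator a b c) ≍ E.associator (F.obj a) (F.obj b) (F.obj c)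
  map_leftUnitor : ∀ a, F.map (D.leftUnitor a) ≍ E.leftUnitor (F.obj a)
  map_rightUnitor : ∀ a, F.map (D.rightUnitor a) ≍ E.rightUnitor (F.obj a)
  map_braiding : ∀ a b, F.map (D.braiding a b) ≍ E.braiding (F.obj a) (F.obj b)

/-! ## The permutative category of a multicategory -/

/-- A morphism `(f, ⟨φ_s⟩)` between tuples of objects of `M`: a function `f` of the indices,
and for each target index `s` a multimorphism `φ_s : ⟨x_r⟩_{f r = s} → y_s`. -/
structure LHom (M : MultiData.{v, u}) (x y : Σ n, Fin n → M.Ob) where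
  f : Fin x.1 → Fin y.1
  φ : ∀ s, M.Hom (x.2 ∘ fib f s) (y.2 s)

namespace LHom

variable {M : MultiData.{v, u}}

/-- The morphism given by a bijection of the indices under which the objects agree, and by
identities. -/
def ofEquiv {x y : Σ n, Fin n → M.Ob} (e : Fin x.1 ≃ Fin y.1) (h : x.2 = y.2 ∘ e) :
    LHom M x y where
  f := e
  φ s := M.perm
    (haveI : Unique {r // e r = s} := ⟨⟨⟨e.symm s, by simp⟩⟩, fun r => by
      exact Subtype.ext ((Equiv.eq_symm_apply e).2 r.2)⟩
    (fibEquiv e s).trans (Equiv.ofUnique _ (Fin 1)))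
    (by funext i; simp [h, apply_fib]) (M.id (y.2 s))

/-- The morphism to a tuple of length one that is given by the unique function to an index set
with one element, and a multimorphism `φ`. -/
def single {x : Σ n, Fin n → M.Ob} {y : M.Ob} (φ : M.Hom x.2 y) :
    LHom M x ⟨1, fun _ => y⟩ where
  f _ := 0
  φ s := M.perm ((fibEquiv _ s).trans (Equiv.subtypeUnivEquiv fun _ => Subsingleton.elim _ _))
    rfl φ

/-- Composition, `F` first. -/
def comp {x y z : Σ n, Fin n → M.Ob} (F : LHom M x y) (G : LHom M y z) : LHom M x z where
  f := G.f ∘ F.f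
  φ t := M.perm (fibComp F.f G.f t)
    (by funext a; exact congrArg x.2 (fib_fibComp F.f G.f t a))
    (M.comp (G.φ t) fun i => F.φ (fib G.f t i))

end LHom

/-- The function on concatenated index sets given by `f` and `g`. -/
def sumMap {a b c d : ℕ} (f : Fin a → Fin c) (g : Fin b → Fin d) : Fin (a + b) → Fin (c + d) :=
  Fin.addCases (fun i => Fin.castAdd d (f i)) (fun i => Fin.natAdd c (g i))

@[simp] theorem sumMap_castAdd {a b c d : ℕ} (f : Fin a → Fin c) (g : Fin b → Fin d)
    (i : Fin a) : sumMap f g (Fin.castAdd b i) = Fin.castAdd d (f i) := by simp [sumMap]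

@[simp] theorem sumMap_natAdd {a b c d : ℕ} (f : Fin a → Fin c) (g : Fin b → Fin d)
    (i : Fin b) : sumMap f g (Fin.natAdd a i) = Fin.natAdd c (g i) := by simp [sumMap]

/-- The fibre of `sumMap f g` over the first copy of `s` is the fibre of `f` over `s`. -/
noncomputable def fibSumLeft {a b c d : ℕ} (f : Fin a → Fin c) (g : Fin b → Fin d)
    (s : Fin c) : Fin (fibCard (sumMap f g) (Fin.castAdd d s)) ≃ Fin (fibCard f s) :=
  (fibEquiv _ _).trans ((Equiv.ofBijective
    (fun r : {r // f r = s} => (⟨Fin.castAdd b r.1, by simp [r.2]⟩ :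
      {r // sumMap f g r = Fin.castAdd d s}))
    (by
      constructor
      · intro r r' h
        exact Subtype.ext (Fin.castAdd_injective _ _ (congrArg Subtype.val h))
      · rintro ⟨r, hr⟩
        induction r using Fin.addCases with
        | left r =>
          have hr' := hr
          rw [sumMap_castAdd] at hr'
          exact ⟨⟨r, Fin.castAdd_injective _ _ hr'⟩, rfl⟩
        | right r =>
          exfalso
          rw [sumMap_natAdd] at hr
          have := congrArg Fin.val hr
          simp at this
          omega)).symm.trans
    (fibEquiv f s).symm)

/-- The fibre of `sumMap f g` over the second copy of `s` is the fibre of `g` over `s`. -/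
noncomputable def fibSumRight {a b c d : ℕ} (f : Fin a → Fin c) (g : Fin b → Fin d)
    (s : Fin d) : Fin (fibCard (sumMap f g) (Fin.natAdd c s)) ≃ Fin (fibCard g s) :=
  (fibEquiv _ _).trans ((Equiv.ofBijective
    (fun r : {r // g r = s} => (⟨Fin.natAdd a r.1, by simp [r.2]⟩ :
      {r // sumMap f g r = Fin.natAdd c s}))
    (by
      constructor
      · intro r r' h
        exact Subtype.ext (Fin.natAdd_injective _ _ (congrArg Subtype.val h))
      · rintro ⟨r, hr⟩
        induction r using Fin.addCases with
        | left r =>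
          exfalso
          rw [sumMap_castAdd] at hr
          have := congrArg Fin.val hr
          simp at this
          omega
        | right r =>
          have hr' := hr
          rw [sumMap_natAdd] at hr'
          exact ⟨⟨r, Fin.natAdd_injective _ _ hr'⟩, rfl⟩)).symm.trans
    (fibEquiv g s).symm)

theorem fib_sumMap_left {a b c d : ℕ} (f : Fin a → Fin c) (g : Fin b → Fin d) (s : Fin c)
    (i : Fin (fibCard (sumMap f g) (Fin.castAdd d s))) :
    fib (sumMap f g) (Fin.castAdd d s) i = Fin.castAdd b (fib f s (fibSumLeft f g s i)) := by
  obtain ⟨j, rfl⟩ := (fibSumLeft f g s).symm.surjective i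
  rw [Equiv.apply_symm_apply]
  simp [fib, fibSumLeft]
  rfl

theorem fib_sumMap_right {a b c d : ℕ} (f : Fin a → Fin c) (g : Fin b → Fin d) (s : Fin d)
    (i : Fin (fibCard (sumMap f g) (Fin.natAdd c s))) :
    fib (sumMap f g) (Fin.natAdd c s) i = Fin.natAdd a (fib g s (fibSumRight f g s i)) := by
  obtain ⟨j, rfl⟩ := (fibSumRight f g s).symm.surjective i
  rw [Equiv.apply_symm_apply]
  simp [fib, fibSumRight]
  rfl

/-- The concatenation of two objects of `L M`. -/
abbrev lTensor {A : Type u} (x y : Σ n, Fin n → A) : Σ n, Fin n → A :=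
  ⟨x.1 + y.1, Fin.append x.2 y.2⟩

/-- The concatenation of two morphisms of `L M`. -/
noncomputable def LHom.tensor {M : MultiData.{v, u}} {x x' y y' : Σ n, Fin n → M.Ob}
    (F : LHom M x y) (G : LHom M x' y') : LHom M (lTensor x x') (lTensor y y') where
  f := sumMap F.f G.f
  φ := Fin.addCases
    (fun s => M.perm (fibSumLeft F.f G.f s)
      (by
        funext i
        exact (congrArg _ (fib_sumMap_left F.f G.f s i)).trans (Fin.append_left x.2 x'.2 _))
      (cast (congrArg (M.Hom _) (Fin.append_left y.2 y'.2 s).symm) (F.φ s)))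
    (fun s => M.perm (fibSumRight F.f G.f s)
      (by
        funext i
        exact (congrArg _ (fib_sumMap_right F.f G.f s i)).trans (Fin.append_right x.2 x'.2 _))
      (cast (congrArg (M.Hom _) (Fin.append_right y.2 y'.2 s).symm) (G.φ s)))

theorem append_comp_finAddFlip {A : Type*} {m n : ℕ} (x : Fin m → A) (y : Fin n → A) :
    Fin.append x y = Fin.append y x ∘ finAddFlip := by
  funext i
  induction i using Fin.addCases <;> simp

/-- The permutative category `L M` of a multicategory `M`.  Its objects are the tuples of objects
of `M`, its unit is the empty tuple, and its product is concatenation; the symmetry permutes the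
two blocks. -/
noncomputable def L (M : MultiData.{v, u}) : SymMonData.{v, u} where
  Ob := Σ n, Fin n → M.Ob
  Hom x y := LHom M x y
  id x := LHom.ofEquiv (Equiv.refl _) rfl
  comp F G := F.comp G
  unit := ⟨0, Fin.elim0⟩
  tensorObj := lTensor
  tensorHom F G := F.tensor G
  associator x y z := LHom.ofEquiv (finCongr (Nat.add_assoc _ _ _)) (Fin.append_assoc _ _ _)
  associatorInv x y z := LHom.ofEquiv (finCongr (Nat.add_assoc _ _ _).symm) (by
    simp only [lTensor, Fin.append_assoc]; rfl)
  leftUnitor x := LHom.ofEquiv (finCongr (Nat.zero_add _)) (Fin.elim0_append _)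
  leftUnitorInv x := LHom.ofEquiv (finCongr (Nat.zero_add _).symm) (by
    simp only [lTensor, Fin.elim0_append]; rfl)
  rightUnitor x := LHom.ofEquiv (finCongr (Nat.add_zero _)) (Fin.append_elim0 _)
  rightUnitorInv x := LHom.ofEquiv (finCongr (Nat.add_zero _).symm) (by
    simp only [lTensor, Fin.append_elim0]; rfl)
  braiding x y := LHom.ofEquiv finAddFlip (append_comp_finAddFlip x.2 y.2)

/-- The map `L F` of a multifunctor `F`, given by `(f, ⟨φ_s⟩) ↦ (f, ⟨F φ_s⟩)`. -/
noncomputable def LMap {M N : MultiData.{v, u}} (F : MultifunctorData M N) :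
    FunctorData (L M).toCatData (L N).toCatData where
  obj x := ⟨x.1, F.obj ∘ x.2⟩
  map {x y} G := (⟨G.f, fun s => F.map (G.φ s)⟩ : LHom N ⟨x.1, F.obj ∘ x.2⟩ ⟨y.1, F.obj ∘ y.2⟩)

/-- The bijection that remains of `e` if the last element and its image are left out. -/
def restrictEquiv {m n : ℕ} (e : Fin (m + 1) ≃ Fin (n + 1)) : Fin m ≃ Fin n :=
  (finSuccAboveEquiv (Fin.last m)).trans
    ((e.subtypeEquiv fun a => by simp).trans (finSuccAboveEquiv (e (Fin.last m))).symm)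

theorem succAbove_restrictEquiv {m n : ℕ} (e : Fin (m + 1) ≃ Fin (n + 1)) (j : Fin m) :
    (e (Fin.last m)).succAbove (restrictEquiv e j) = e j.castSucc := by
  have h := congrArg Subtype.val ((finSuccAboveEquiv (e (Fin.last m))).apply_symm_apply
    ((e.subtypeEquiv (p := fun a => a ≠ Fin.last m) (q := fun b => b ≠ e (Fin.last m))
      fun a => by simp) (finSuccAboveEquiv (Fin.last m) j)))
  refine h.trans (congrArg e ?_)
  exact Fin.succAbove_last_apply j

/-! ## The underlying multicategory of a symmetric monoidal category -/

section Underlying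

variable {C : Type u} [Category.{v} C] [MonoidalCategory C]

/-- The product `((x₁ ⊗ x₂) ⊗ x₃) ⊗ ⋯ ⊗ xₙ`, bracketed to the left; it is the unit object for
`n = 0`, and `x₁` for `n = 1`. -/
def kbar : {n : ℕ} → (Fin n → C) → C
  | 0, _ => 𝟙_ C
  | 1, x => x 0
  | _ + 2, x => kbar (Fin.init x) ⊗ x (Fin.last _)

/-- The effect of `kbar` on a tuple of morphisms. -/
def kmap : {n : ℕ} → {x y : Fin n → C} → (∀ s, x s ⟶ y s) → (kbar x ⟶ kbar y)
  | 0, _, _, _ => 𝟙 (𝟙_ C)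
  | 1, _, _, g => g 0
  | _ + 2, x, y, g =>
    kmap (x := Fin.init x) (y := Fin.init y) (fun s => g s.castSucc) ⊗ₘ g (Fin.last _)

/-- The left unitor for `n = 0`, and an identity for `n > 0`. -/
def snocIso : {n : ℕ} → (x : Fin (n + 1) → C) →
    (kbar (Fin.init x) ⊗ x (Fin.last n) ≅ kbar x)
  | 0, x => λ_ (x 0)
  | _ + 1, _ => Iso.refl _

/-- The canonical isomorphism that splits a product in two. -/
def splitIso (q : ℕ) : (r : ℕ) → (x : Fin (q + r) → C) →
    (kbar x ≅ kbar (fun i => x (Fin.castAdd r i)) ⊗ kbar (fun i => x (Fin.natAdd q i)))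
  | 0, x => (ρ_ (kbar x)).symm
  | r + 1, x =>
    (snocIso (n := q + r) x).symm ≪≫
      (splitIso q r (Fin.init (n := q + r) x) ⊗ᵢ Iso.refl (x (Fin.last (q + r)))) ≪≫
      α_ (kbar fun i => x (Fin.castAdd (r + 1) i))
        (kbar (Fin.init (n := r) fun i => x (Fin.natAdd q i))) (x (Fin.natAdd q (Fin.last r))) ≪≫
      (Iso.refl (kbar fun i => x (Fin.castAdd (r + 1) i)) ⊗ᵢ
        snocIso (n := r) fun i => x (Fin.natAdd q i))

theorem concat_succ {A : Type*} {n : ℕ} {k : Fin (n + 1) → ℕ} (x : ∀ s, Fin (k s) → A) :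
    concat x = (Fin.append (concat fun s : Fin n => x s.castSucc) (x (Fin.last n))) ∘
      Fin.cast (Fin.sum_univ_castSucc k) := by
  funext i
  obtain ⟨⟨s, t⟩, rfl⟩ := finSigmaFinEquiv.surjective i
  rw [concat_apply]
  induction s using Fin.lastCases with
  | last =>
    have h : Fin.cast (Fin.sum_univ_castSucc k) (finSigmaFinEquiv ⟨Fin.last n, t⟩) =
        Fin.natAdd _ t := by
      ext; simp [finSigmaFinEquiv_apply]; rfl
    simp only [Function.comp_apply, h, Fin.append_right]
  | cast s =>
    have h : Fin.cast (Fin.sum_univ_castSucc k) (finSigmaFinEquiv ⟨s.castSucc, t⟩) =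
        Fin.castAdd _ (finSigmaFinEquiv ⟨s, t⟩) := by
      ext; simp [finSigmaFinEquiv_apply]
    simp only [Function.comp_apply, h, Fin.append_left]
    exact (concat_apply (fun s : Fin n => x s.castSucc) ⟨s, t⟩).symm

theorem kbar_cast {m n : ℕ} (h : m = n) (x : Fin n → C) : kbar (x ∘ Fin.cast h) = kbar x := by
  subst h; rfl

/-- The canonical isomorphism between the product of a concatenation of tuples, and the product
of the products of the tuples. -/
def blockIso : {n : ℕ} → {k : Fin n → ℕ} → (x : ∀ s, Fin (k s) → C) →
    (kbar (concat x) ≅ kbar fun s => kbar (x s))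
  | 0, _, _ => Iso.refl _
  | n + 1, k, x =>
    eqToIso (by rw [concat_succ, kbar_cast]) ≪≫
      splitIso (∑ s : Fin n, k s.castSucc) (k (Fin.last n))
        (Fin.append (concat fun s : Fin n => x s.castSucc) (x (Fin.last n))) ≪≫
      eqToIso (by simp only [Fin.append_left, Fin.append_right]) ≪≫
      (blockIso (fun s : Fin n => x s.castSucc) ⊗ᵢ Iso.refl (kbar (x (Fin.last n)))) ≪≫
      snocIso fun s => kbar (x s)

theorem castSucc_succAbove_last' {n : ℕ} (i : Fin (n + 1)) :
    i.castSucc.succAbove (Fin.last n) = Fin.last (n + 1) := by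
  rw [Fin.succAbove_of_le_castSucc _ _ (Fin.castSucc_le_castSucc_iff.2 (Fin.le_last i)),
    Fin.succ_last]

variable [SymmetricCategory C]

/-- The canonical isomorphism that moves the factor `x i` of a product to the end: the identity
if it is the last factor, and else a symmetry that exchanges it with the last factor after it has
been moved to the end of the product of the others. -/
def pullIso : {n : ℕ} → (x : Fin (n + 1) → C) → (i : Fin (n + 1)) →
    (kbar x ≅ kbar (fun j => x (i.succAbove j)) ⊗ x i)
  | 0, x, i => (λ_ (x 0)).symm ≪≫
      eqToIso (by obtain rfl : i = 0 := Fin.fin_one_eq_zero i; rfl)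
  | n + 1, x, i =>
    Fin.lastCases
      (motive := fun i => kbar x ≅ kbar (fun j => x (i.succAbove j)) ⊗ x i)
      (eqToIso (by simp only [Fin.succAbove_last]; rfl))
      (fun i =>
        (pullIso (Fin.init x) i ⊗ᵢ Iso.refl (x (Fin.last (n + 1)))) ≪≫
        α_ (kbar fun j => x (i.succAbove j).castSucc) (x i.castSucc) (x (Fin.last (n + 1))) ≪≫
        (Iso.refl (kbar fun j => x (i.succAbove j).castSucc) ⊗ᵢ
          β_ (x i.castSucc) (x (Fin.last (n + 1)))) ≪≫
        (α_ (kbar fun j => x (i.succAbove j).castSucc) (x (Fin.last (n + 1)))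
          (x i.castSucc)).symm ≪≫
        (eqToIso (by
            simp only [Fin.init_def, Fin.castSucc_succAbove_castSucc,
              castSucc_succAbove_last']) ≪≫
          snocIso (n := n) (fun j => x (i.castSucc.succAbove j)) ⊗ᵢ Iso.refl (x i.castSucc)))
      i

/-- The canonical isomorphism that permutes the factors of a product: the last factor of the
permuted product is moved to the end, and the remaining factors are permuted. -/
def permIso : {m n : ℕ} → (e : Fin m ≃ Fin n) → (x : Fin n → C) → (kbar (x ∘ e) ≅ kbar x)
  | 0, 0, _, _ => Iso.refl _
  | 0, _ + 1, e, _ => (e.symm 0).elim0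
  | _ + 1, 0, e, _ => (e 0).elim0
  | m + 1, _ + 1, e, x =>
    (snocIso (x ∘ e)).symm ≪≫
      (eqToIso (congrArg kbar (funext fun j => congrArg x (succAbove_restrictEquiv e j).symm)) ≪≫
        permIso (restrictEquiv e) (fun j => x ((e (Fin.last m)).succAbove j)) ⊗ᵢ
        Iso.refl (x (e (Fin.last m)))) ≪≫
      (pullIso x (e (Fin.last m))).symm

/-- The canonical isomorphism that sorts the factors of a product by the fibres of `f`. -/
def gatherIso {m n : ℕ} (f : Fin m → Fin n) (x : Fin m → C) :
    kbar x ≅ kbar fun s => kbar (x ∘ fib f s) :=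
  (permIso (fibSigma f) x).symm ≪≫ blockIso fun s => x ∘ fib f s

variable (C)

/-- The underlying multicategory of a symmetric monoidal category: an `n`-morphism from
`(x₁, …, xₙ)` to `y` is a morphism `(x₁ ⊗ x₂) ⊗ ⋯ ⊗ xₙ ⟶ y`. -/
def U : MultiData.{v, u} where
  Ob := C
  Hom x y := kbar x ⟶ y
  id a := 𝟙 a
  comp {_ _ x _ _} f g := (blockIso x).hom ≫ kmap g ≫ f
  perm {_ _ x _ _} σ h f := eqToHom (congrArg kbar h) ≫ (permIso σ x).hom ≫ f

/-- The weak counit `L (U C) → C`.  A tuple is sent to its product.  A morphism `(f, ⟨φ_s⟩)` is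
sent to the canonical isomorphism that sorts the factors by the fibres of `f`, followed by the
product of the `φ_s`. -/
noncomputable def counit : FunctorData (L (U C)).toCatData (CatData.of C) where
  obj := fun x : Σ n, Fin n → C => kbar (C := C) x.2
  map := fun {x y : Σ n, Fin n → C} (F : LHom (U C) x y) =>
    (gatherIso F.f x.2).hom ≫ kmap (x := fun s => kbar (x.2 ∘ fib F.f s)) (y := y.2) F.φ

/-- The map `C → L (U C)` given by the unit of the weak adjunction: it sends an object to the
tuple of length one, and a morphism `φ` to the morphism of tuples of length one with entry `φ`. -/
noncomputable def unitFunctor : FunctorData (CatData.of C) (L (U C)).toCatData where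
  obj := fun a : C => (⟨1, fun _ => a⟩ : Σ n, Fin n → C)
  map := fun {a b : C} (φ : a ⟶ b) =>
    LHom.single (M := U C) (x := ⟨1, fun _ => a⟩) (y := b) φ

/-- The morphism from a tuple `x` to the tuple of length one whose entry is the product of `x`,
given by the identity of the product. -/
noncomputable def nu (x : Σ n, Fin n → C) : LHom (U C) x ⟨1, fun _ => kbar (C := C) x.2⟩ :=
  LHom.single (M := U C) (x := x) (y := kbar (C := C) x.2) (𝟙 (kbar (C := C) x.2))

end Underlying

section LaxFunctor

variable {C D : Type u} [Category.{v} C] [MonoidalCategory C] [SymmetricCategory C]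
  [Category.{v} D] [MonoidalCategory D] [SymmetricCategory D]

/-- The iterated structure map of a lax monoidal functor. -/
def xi (F : C ⥤ D) [F.LaxMonoidal] : {n : ℕ} → (x : Fin n → C) →
    (kbar (fun i => F.obj (x i)) ⟶ F.obj (kbar x))
  | 0, _ => Functor.LaxMonoidal.ε F
  | 1, x => 𝟙 (F.obj (x 0))
  | _ + 2, x =>
    (xi F (Fin.init x) ▷ F.obj (x (Fin.last _))) ≫
      Functor.LaxMonoidal.μ F (kbar (Fin.init x)) (x (Fin.last _))

/-- The underlying multifunctor of a lax symmetric monoidal functor. -/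
def UMap (F : C ⥤ D) [F.LaxMonoidal] : MultifunctorData (U C) (U D) where
  obj a := F.obj a
  map {_ x _} f := xi F x ≫ F.map f

end LaxFunctor

/-- A functor is a homotopy equivalence of categories if it induces a homotopy equivalence of
classifying spaces, the geometric realizations of the nerves. -/
def IsHomotopyEquivalence {C D : Type u} [Category.{v} C] [Category.{v} D] (F : C ⥤ D) : Prop :=
  ∃ e : ContinuousMap.HomotopyEquiv (SSet.toTop.obj (nerve C)) (SSet.toTop.obj (nerve D)),
    e.toFun = (SSet.toTop.map (nerveMap F)).hom

set_option linter.unusedVariables false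

/-! Three coherence problems have to be solved, and each is moved to a place where it becomes a
uniqueness statement.

Permutativity of `L M`. Checking the symmetric monoidal axioms directly would mean tracking the
permutations that rearrange fibres. Instead, an operation is given labels on its inputs and is
considered up to label preserving permutations (`Op`). Labels may be repeated or omitted, so
families of such operations form a category `Tup hM` in which concatenation is a categorical
product. `L M` maps to it faithfully (`LHom.toTup_injective`): the labels on the fibres of `f`
determine `f`, and since they are distinct they leave no permutation to divide out. Composition,
product and structure maps go to those of the cartesian structure, so the axioms are reflected from
`Tup hM`. Strictness holds because the associators and unitors come from bijections that do not
change the value of an index.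

The multicategory `U C` and the counit. All their identities compare composites of structure
isomorphisms of `C`. A composite is canonical (`IsCan`) if it is generated by exchanges of
neighbouring factors in products over lists of labels. For lists without repetition there is at most
one canonical morphism between two given products (`IsCan.unique`): a canonical morphism is
compatible with pulling a chosen factor to the front (`IsCan.exists_comp_pull`, where the
Yang-Baxter equation enters), so factors are removed one at a time. Presentations (`Pres`) carry
this over to the left bracketed products `kbar`. Labels are positions and not objects, so they are
distinct even if objects coincide. For a lax functor `F` the same scheme is run with pairs of
presentations linked by a comparison map (`PresPair.natural`); with `F` the identity it also gives
the naturality of the canonical isomorphisms.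

The homotopy equivalence. On morphisms into a tuple of length one the counit is injective
(`counit_map_injective`), so functoriality of the unit and naturality of `nu` can be checked in `C`.
It remains that a natural transformation induces a homotopy of realizations. A map out of a
realization is a compatible family of maps on simplices (`toTop_hom_ext`, `exists_toTop_hom`), so
the homotopy is built as a map into the space of paths. Over one simplex it is a map on a prism,
which uses that a point in the simplex of a chain depends only on its distribution of mass on the
vertices (`ChainFamily.point_eq`), and that the mass `prismMass t s` always sits on a chain and
depends naturally on `t`. -/

theorem MultiData.IsMulticategory.perm_trans {M : MultiData.{v, u}} (hM : M.IsMulticategory)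
    {l m n : ℕ} {x : Fin n → M.Ob} {x' : Fin m → M.Ob} {x'' : Fin l → M.Ob} {y : M.Ob}
    (σ : Fin m ≃ Fin n) (τ : Fin l ≃ Fin m) (h : x' = x ∘ σ) (h' : x'' = x' ∘ τ)
    (f : M.Hom x y) :
    M.perm τ h' (M.perm σ h f) = M.perm (τ.trans σ) (by subst h h'; rfl) f := by
  subst h h'
  exact hM.perm_perm σ τ f

theorem MultiData.IsMulticategory.perm_perm_refl {M : MultiData.{v, u}} (hM : M.IsMulticategory)
    {m n : ℕ} {x x' : Fin n → M.Ob} {x'' : Fin m → M.Ob} {y : M.Ob}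
    (τ : Fin m ≃ Fin n) (h : x' = x ∘ Equiv.refl _) (h' : x'' = x' ∘ τ) (f : M.Hom x y) :
    M.perm τ h' (M.perm (Equiv.refl _) h f) = M.perm τ (by subst h h'; rfl) f :=
  hM.perm_trans _ _ _ _ f

/-! ### Labelled operations and their substitution -/

/-- An operation with inputs labelled by elements of `ι`; the input with label `i` is `X i`. -/
structure LOp (M : MultiData.{v, u}) {ι : Type} (X : ι → M.Ob) (y : M.Ob) where
  n : ℕ
  l : Fin n → ι
  u : M.Hom (X ∘ l) y

namespace LOp

variable {M : MultiData.{v, u}} {ι κ μ : Type} {X : ι → M.Ob} {Y : κ → M.Ob} {y z : M.Ob}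

/-- Two labelled operations are equivalent if a label preserving permutation relates them. -/
def Rel (a b : LOp M X y) : Prop :=
  ∃ (E : Fin a.n ≃ Fin b.n) (h : a.l = b.l ∘ E), a.u = M.perm E (congrArg (X ∘ ·) h) b.u

theorem Rel.of_perm {m n : ℕ} {l : Fin n → ι} {l' : Fin m → ι} (E : Fin m ≃ Fin n)
    (h : l' = l ∘ E) (h' : X ∘ l' = (X ∘ l) ∘ E) (u : M.Hom (X ∘ l) y) :
    Rel ⟨m, l', M.perm E h' u⟩ ⟨n, l, u⟩ := ⟨E, h, rfl⟩

theorem rel_refl (hM : M.IsMulticategory) (a : LOp M X y) : Rel a a :=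
  ⟨Equiv.refl _, rfl, (hM.perm_refl a.u).symm⟩

theorem Rel.symm (hM : M.IsMulticategory) {a b : LOp M X y} (h : Rel a b) : Rel b a := by
  obtain ⟨E, h, h'⟩ := h
  refine ⟨E.symm, ?_, ?_⟩
  · rw [h]; funext i; simp
  · rw [h', hM.perm_trans]
    have : E.symm.trans E = Equiv.refl _ := by ext; simp
    simp only [this]
    exact (hM.perm_refl b.u).symm

theorem Rel.trans (hM : M.IsMulticategory) {a b c : LOp M X y} (h : Rel a b) (k : Rel b c) :
    Rel a c := by
  obtain ⟨E, h, h'⟩ := h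
  obtain ⟨D, k, k'⟩ := k
  refine ⟨E.trans D, ?_, ?_⟩
  · rw [h, k]; rfl
  · rw [h', k', hM.perm_trans]

/-- Equivalence of labelled operations. -/
abbrev setoid (hM : M.IsMulticategory) (X : ι → M.Ob) (y : M.Ob) : Setoid (LOp M X y) :=
  ⟨Rel, rel_refl hM, Rel.symm hM, Rel.trans hM⟩

/-- Composition of labelled operations, by substitution for the labels. -/
def comp (v : LOp M Y z) (w : ∀ j, LOp M X (Y j)) : LOp M X z :=
  ⟨_, concat fun i => (w (v.l i)).l,
    M.comp (x := fun i => X ∘ (w (v.l i)).l) v.u fun i => (w (v.l i)).u⟩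

/-- The operation given by a single input. -/
def var (i : ι) (h : X i = y) : LOp M X y :=
  ⟨1, fun _ => i, M.perm (x := fun _ => y) (Equiv.refl _) (funext fun _ => h) (M.id y)⟩

/-- Renaming of labels. -/
def rename {X : ι → M.Ob} (e : κ → ι) (h : ∀ j, X (e j) = Y j) (v : LOp M Y y) : LOp M X y :=
  ⟨v.n, e ∘ v.l, M.perm (x := Y ∘ v.l) (Equiv.refl _) (funext fun i => h (v.l i)) v.u⟩

/-- Equivariance in the outer variable: a permutation of the inputs of `v` permutes the blocks of
the composite, and blocks with equal labels receive equal operations. -/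
theorem comp_congr_left (hM : M.IsMulticategory) {v v' : LOp M Y z} (h : Rel v v')
    (w : ∀ j, LOp M X (Y j)) : Rel (v.comp w) (v'.comp w) := by
  obtain ⟨n, l, u⟩ := v
  obtain ⟨n', l', u'⟩ := v'
  obtain ⟨E, h, h'⟩ := h
  change Fin n ≃ Fin n' at E
  change l = l' ∘ E at h
  have k : u = M.perm E (congrArg (Y ∘ ·) h) u' := h'
  clear h'
  subst h k
  exact ⟨blockPerm E fun i => (w (l' i)).n,
    concat_flat _ (fun i => (w (l' (E i))).l) (fun i => (w (l' i)).l) fun _ => rfl,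
    hM.perm_comp E u' fun i => (w (l' i)).u⟩

theorem comp_congr_right (hM : M.IsMulticategory) (v : LOp M Y z)
    {w w' : ∀ j, LOp M X (Y j)} (h : ∀ j, Rel (w j) (w' j)) : Rel (v.comp w) (v.comp w') := by
  choose E h h' using h
  refine ⟨blockSum fun i => E (v.l i), concat_flat _ (fun i => (w (v.l i)).l) (fun i => (w' (v.l i)).l)
    fun p => congrFun (h _) _, ?_⟩
  have := hM.comp_perm (fun i => E (v.l i)) v.u fun i => (w' (v.l i)).u
  -- The labels of `w` equal the permuted labels of `w'` only propositionally; a variable `l` in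
  -- their place can be eliminated.
  have key : ∀ (l : ∀ i, Fin (w (v.l i)).n → ι) (hl : ∀ i, l i = (w' (v.l i)).l ∘ E (v.l i))
      (hh : X ∘ concat l = (X ∘ concat fun i => (w' (v.l i)).l) ∘ blockSum fun i => E (v.l i)),
      M.comp (x := fun i => X ∘ l i) v.u
          (fun i => M.perm (E (v.l i)) (congrArg (X ∘ ·) (hl i)) (w' (v.l i)).u) =
        M.perm (blockSum fun i => E (v.l i)) hh (M.comp v.u fun i => (w' (v.l i)).u) := by
    intro l hl hh
    obtain rfl : l = fun i => (w' (v.l i)).l ∘ E (v.l i) := funext hl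
    exact this
  refine Eq.trans ?_ (key (fun i => (w (v.l i)).l) (fun i => h _) _)
  simp only [comp]
  congr 1
  funext i
  exact h' _

theorem comp_assoc (hM : M.IsMulticategory) {W : μ → M.Ob} (v : LOp M Y z)
    (w : ∀ j, LOp M X (Y j)) (t : ∀ i, LOp M W (X i)) :
    Rel ((v.comp w).comp t) (v.comp fun j => (w j).comp t) :=
  ⟨assocEquiv fun s i => (t ((w (v.l s)).l i)).n,
    concat_concat fun s i => (t ((w (v.l s)).l i)).l,
    hM.assoc v.u (fun s => (w (v.l s)).u) fun s i => (t ((w (v.l s)).l i)).u⟩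

/-- The unit law of `M` in a form with an arbitrary relabelling `e`; it serves for the unit law of
substitution and also for precomposition with the projections of a product. -/
theorem comp_var (hM : M.IsMulticategory) (v : LOp M Y z) (e : κ → ι)
    (h : ∀ j, X (e j) = Y j) : Rel (v.comp fun j => var (e j) (h j)) (v.rename e h) := by
  obtain rfl : (fun j => X (e j)) = Y := funext h
  refine ⟨unitsEquiv v.n, rfl, Eq.trans ?_ ((hM.comp_id v.u).trans
    (congrArg (M.perm (unitsEquiv v.n) _) (hM.perm_refl v.u).symm))⟩
  exact congrArg (M.comp v.u) (funext fun i => hM.perm_refl _)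

theorem var_comp (hM : M.IsMulticategory) (i : κ) (w : ∀ j, LOp M X (Y j)) :
    Rel ((var i rfl : LOp M Y (Y i)).comp w) (w i) := by
  refine ⟨oneBlockEquiv _, concat_oneBlock (w i).l, ?_⟩
  refine Eq.trans ?_ (hM.id_comp (w i).u)
  simp only [comp, var]
  rw [hM.perm_refl]

end LOp

/-- Labelled operations up to permutation. -/
def Op {M : MultiData.{v, u}} (hM : M.IsMulticategory) {ι : Type} (X : ι → M.Ob) (y : M.Ob) :=
  Quotient (LOp.setoid hM X y)

namespace Op

variable {M : MultiData.{v, u}} {hM : M.IsMulticategory} {ι κ μ : Type} {X : ι → M.Ob}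
  {Y : κ → M.Ob} {y z : M.Ob}

/-- The class of a labelled operation. -/
def mk (hM : M.IsMulticategory) (a : LOp M X y) : Op hM X y := Quotient.mk _ a

theorem sound {a b : LOp M X y} (h : a.Rel b) : mk hM a = mk hM b := Quotient.sound h

theorem mk_surjective (v : Op hM X y) : ∃ a, mk hM a = v := Quotient.exists_rep v

theorem exact {a b : LOp M X y} (h : mk hM a = mk hM b) : a.Rel b := Quotient.exact h

/-- Composition by substitution for the labels. -/
noncomputable def comp (v : Op hM Y z) (w : ∀ j, Op hM X (Y j)) : Op hM X z :=
  Quotient.lift (fun v : LOp M Y z => mk hM (v.comp fun j => (w j).out))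
    (fun _ _ h => sound (LOp.comp_congr_left hM h _)) v

/-- The representatives chosen by `out` are equivalent to the given ones, and substitution respects
this. -/
theorem mk_comp (v : LOp M Y z) (w : ∀ j, LOp M X (Y j)) :
    (mk hM v).comp (fun j => mk hM (w j)) = mk hM (v.comp w) :=
  sound (LOp.comp_congr_right hM v fun j => exact (Quotient.out_eq (mk hM (w j))))

/-- The operation given by a single input. -/
def var (hM : M.IsMulticategory) (i : ι) (h : X i = y) : Op hM X y := mk hM (LOp.var i h)

/-- Transport along an equality of targets. -/
def cast (h : y = z) (v : Op hM X y) : Op hM X z := h ▸ v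

theorem comp_assoc {W : μ → M.Ob} (v : Op hM Y z) (w : ∀ j, Op hM X (Y j))
    (t : ∀ i, Op hM W (X i)) : (v.comp w).comp t = v.comp fun j => (w j).comp t := by
  obtain ⟨v, rfl⟩ := mk_surjective v
  choose w' hw using fun j => mk_surjective (w j)
  choose t' ht using fun j => mk_surjective (t j)
  obtain rfl := funext hw
  obtain rfl := funext ht
  simp only [mk_comp]
  exact sound (LOp.comp_assoc hM v w' t')

theorem comp_var (v : LOp M Y z) (e : κ → ι) (h : ∀ j, X (e j) = Y j) :
    ((mk hM v).comp fun j => var hM (e j) (h j)) = mk hM (v.rename e h) :=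
  (mk_comp v _).trans (sound (LOp.comp_var hM v e h))

theorem comp_id (v : Op hM X y) : (v.comp fun j => var hM j rfl) = v := by
  obtain ⟨v, rfl⟩ := mk_surjective v
  refine (comp_var v id fun _ => rfl).trans (congrArg (mk hM) ?_)
  obtain ⟨n, l, u⟩ := v
  exact congrArg (LOp.mk n l) (hM.perm_refl u)

theorem var_comp (i : κ) (h : Y i = z) (w : ∀ j, Op hM X (Y j)) :
    (var hM i h).comp w = cast h (w i) := by
  subst h
  choose w' hw using fun j => mk_surjective (w j)
  obtain rfl := funext hw
  exact (mk_comp _ w').trans (sound (LOp.var_comp hM i w'))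

@[simp] theorem cast_cast {z' : M.Ob} (h : y = z) (h' : z = z') (v : Op hM X y) :
    cast h' (cast h v) = cast (h.trans h') v := by subst h h'; rfl

@[simp] theorem cast_rfl (h : y = y) (v : Op hM X y) : cast h v = v := rfl

theorem cast_var {i : ι} (h : X i = y) (h' : y = z) :
    cast h' (var hM i h) = var hM i (h.trans h') := by subst h'; rfl

end Op

/-! ### The cartesian category of tuples -/

/-- Tuples of objects of a multicategory, as objects of a category with finite products. -/
structure Tup {M : MultiData.{v, u}} (hM : M.IsMulticategory) where
  of : Σ n, Fin n → M.Ob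

namespace Tup

variable {M : MultiData.{v, u}} {hM : M.IsMulticategory}

/-- A morphism has one operation for each target entry, with labels in the source. Inputs may be
shared between entries, repeated or dropped, and this is what makes concatenation a product. -/
noncomputable instance : Category (Tup hM) where
  Hom x y := ∀ j, Op hM x.of.2 (y.of.2 j)
  id x := fun j => Op.var hM j rfl
  comp K K' := fun t => (K' t).comp K
  id_comp K := funext fun t => Op.comp_id _
  comp_id K := funext fun t => Op.var_comp _ rfl K
  assoc K K' K'' := funext fun t => (Op.comp_assoc _ _ _).symm

/-- Concatenation. -/
abbrev prod (x y : Tup hM) : Tup hM := ⟨lTensor x.of y.of⟩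

/-- The first projection. -/
def fstMap (x y : Tup hM) : prod x y ⟶ x :=
  fun s => Op.var hM (Fin.castAdd _ s) (Fin.append_left x.of.2 y.of.2 s)

/-- The second projection. -/
def sndMap (x y : Tup hM) : prod x y ⟶ y :=
  fun s => Op.var hM (Fin.natAdd _ s) (Fin.append_right x.of.2 y.of.2 s)

/-- The map to a concatenation that is given by its components. -/
noncomputable def lift {x y z : Tup hM} (K : z ⟶ x) (K' : z ⟶ y) : z ⟶ prod x y :=
  Fin.addCases (fun s => Op.cast (Fin.append_left x.of.2 y.of.2 s).symm (K s))
    fun s => Op.cast (Fin.append_right x.of.2 y.of.2 s).symm (K' s)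

theorem comp_fstMap {x y z : Tup hM} (K : z ⟶ prod x y) (s) :
    (K ≫ fstMap x y) s = Op.cast (Fin.append_left x.of.2 y.of.2 s) (K (Fin.castAdd _ s)) :=
  Op.var_comp _ _ K

theorem comp_sndMap {x y z : Tup hM} (K : z ⟶ prod x y) (s) :
    (K ≫ sndMap x y) s = Op.cast (Fin.append_right x.of.2 y.of.2 s) (K (Fin.natAdd _ s)) :=
  Op.var_comp _ _ K

theorem lift_fstMap {x y z : Tup hM} (K : z ⟶ x) (K' : z ⟶ y) : lift K K' ≫ fstMap x y = K := by
  funext s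
  rw [comp_fstMap, lift, Fin.addCases_left, Op.cast_cast]
  rfl

theorem lift_sndMap {x y z : Tup hM} (K : z ⟶ x) (K' : z ⟶ y) : lift K K' ≫ sndMap x y = K' := by
  funext s
  rw [comp_sndMap, lift, Fin.addCases_right, Op.cast_cast]
  rfl

theorem prod_hom_ext {x y z : Tup hM} {K K' : z ⟶ prod x y}
    (h : K ≫ fstMap x y = K' ≫ fstMap x y) (h' : K ≫ sndMap x y = K' ≫ sndMap x y) : K = K' := by
  funext s
  induction s using Fin.addCases with
  | left s =>
    have := congrFun h s
    rw [comp_fstMap, comp_fstMap] at this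
    simpa using congrArg (Op.cast (Fin.append_left x.of.2 y.of.2 s).symm) this
  | right s =>
    have := congrFun h' s
    rw [comp_sndMap, comp_sndMap] at this
    simpa using congrArg (Op.cast (Fin.append_right x.of.2 y.of.2 s).symm) this

/-- The empty tuple. -/
abbrev empty (hM : M.IsMulticategory) : Tup hM := ⟨⟨0, Fin.elim0⟩⟩

instance (x : Tup hM) : Unique (x ⟶ empty hM) where
  default := fun s => s.elim0
  uniq _ := funext fun s => s.elim0

-- Concatenation itself is the chosen product, so that the comparison isomorphisms in `LInducing`
-- can be identities.
open Limits in
noncomputable instance : CartesianMonoidalCategory (Tup hM) :=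
  .ofChosenFiniteProducts ⟨asEmptyCone (empty hM), IsTerminal.ofUnique _⟩ fun x y =>
    ⟨BinaryFan.mk (fstMap x y) (sndMap x y), BinaryFan.IsLimit.mk _ lift lift_fstMap lift_sndMap
      fun _ _ _ h h' => prod_hom_ext (h.trans (lift_fstMap _ _).symm)
        (h'.trans (lift_sndMap _ _).symm)⟩

noncomputable instance : BraidedCategory (Tup hM) := .ofCartesianMonoidalCategory

/-- The map of tuples that is given by a function of the indices. -/
def reindex {x y : Tup hM} (e : Fin y.of.1 → Fin x.of.1) (h : y.of.2 = x.of.2 ∘ e) : x ⟶ y :=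
  fun s => Op.var hM (e s) (congrFun h s).symm

theorem reindex_comp_reindex {x y z : Tup hM} (e : Fin y.of.1 → Fin x.of.1)
    (h : y.of.2 = x.of.2 ∘ e) (e' : Fin z.of.1 → Fin y.of.1) (h' : z.of.2 = y.of.2 ∘ e') :
    reindex e h ≫ reindex e' h' = reindex (e ∘ e') (by rw [h', h]; rfl) := by
  funext s
  exact (Op.var_comp _ _ _).trans (Op.cast_var _ _)

end Tup

/-! ## The permutative category of a multicategory -/

section Structure

variable {M : MultiData.{v, u}} (hM : M.IsMulticategory)

/-- The map of tuples given by a morphism of `L M`. -/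
def LHom.toTup {x y : Σ n, Fin n → M.Ob} (F : LHom M x y) : (⟨x⟩ : Tup hM) ⟶ ⟨y⟩ :=
  fun s => Op.mk hM ⟨_, fib F.f s, F.φ s⟩

theorem fib_injective {m n : ℕ} (f : Fin m → Fin n) (s : Fin n) : Function.Injective (fib f s) :=
  Subtype.val_injective.comp (fibEquiv f s).injective

theorem exists_fib {m n : ℕ} (f : Fin m → Fin n) (r : Fin m) : ∃ i, fib f (f r) i = r :=
  ⟨(fibEquiv f (f r)).symm ⟨r, rfl⟩, by simp [fib]⟩

/-- An index `r` occurs as a label exactly in the entry `f r`, which recovers `f`. A permutation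
that preserves the pairwise distinct labels of a fibre is the identity, which recovers the
multimorphisms. -/
theorem LHom.toTup_injective {x y : Σ n, Fin n → M.Ob} :
    Function.Injective (LHom.toTup hM : LHom M x y → _) := by
  rintro ⟨f, φ⟩ ⟨f', φ'⟩ h
  have h : ∀ s, LOp.Rel (X := x.2) ⟨_, fib f s, φ s⟩ ⟨_, fib f' s, φ' s⟩ :=
    fun s => Op.exact (congrFun h s)
  obtain rfl : f = f' := by
    funext r
    obtain ⟨i, hi⟩ := exists_fib f r
    obtain ⟨E, hE, -⟩ := h (f r)
    have hEi : fib f (f r) i = fib f' (f r) (E i) := congrFun hE i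
    rw [← apply_fib f' (f r) (E i), ← hEi, hi]
  congr 1
  funext s
  obtain ⟨E, hE, h'⟩ := h s
  obtain rfl : E = Equiv.refl _ := by
    ext i
    exact congrArg Fin.val (fib_injective f s (congrFun hE i)).symm
  exact h'.trans (hM.perm_refl _)

/-- The two sides differ by the rearrangement `fibComp`, which preserves labels and is therefore
invisible in the quotient. -/
theorem LHom.toTup_comp {x y z : Σ n, Fin n → M.Ob} (F : LHom M x y) (G : LHom M y z) :
    (F.comp G).toTup hM = F.toTup hM ≫ G.toTup hM := by
  funext t
  refine Eq.trans ?_ (Op.mk_comp _ _).symm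
  exact Op.sound (LOp.Rel.of_perm _ (funext fun a => fib_fibComp F.f G.f t a) _ _)

theorem LHom.toTup_ofEquiv {x y : Σ n, Fin n → M.Ob} (e : Fin x.1 ≃ Fin y.1) (h : x.2 = y.2 ∘ e) :
    (LHom.ofEquiv (M := M) e h).toTup hM =
      Tup.reindex (x := ⟨x⟩) (y := ⟨y⟩) e.symm (by rw [h]; funext i; simp) := by
  funext s
  refine Op.sound ?_
  let _ : Unique {r // e r = s} := ⟨⟨⟨e.symm s, by simp⟩⟩, fun r => by
      exact Subtype.ext ((Equiv.eq_symm_apply e).2 r.2)⟩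
  refine ⟨(fibEquiv e s).trans (Equiv.ofUnique _ (Fin 1)), ?_, ?_⟩
  · funext i
    exact (Equiv.eq_symm_apply e).2 (apply_fib e s i)
  · exact (hM.perm_perm_refl (x := fun _ => y.2 s) (x' := fun _ => x.2 (e.symm s))
      (x'' := x.2 ∘ fib e s) ((fibEquiv e s).trans (Equiv.ofUnique _ (Fin 1))) _ _
      (M.id (y.2 s))).symm

theorem Op.cast_mk_perm {ι : Type} {X : ι → M.Ob} {y z : M.Ob} {m n : ℕ} {x : Fin n → M.Ob}
    (h : y = z) (E : Fin m ≃ Fin n) (l : Fin m → ι) (h' : X ∘ l = x ∘ E) (u : M.Hom x z) :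
    Op.cast h (Op.mk hM ⟨m, l, M.perm E h' (_root_.cast (congrArg (M.Hom x) h.symm) u)⟩) =
      Op.mk hM ⟨m, l, M.perm E h' u⟩ := by
  subst h
  rfl

theorem LHom.tensor_φ_castAdd {x x' y y' : Σ n, Fin n → M.Ob} (F : LHom M x y)
    (G : LHom M x' y') (s) : (F.tensor G).φ (Fin.castAdd _ s) =
      M.perm (fibSumLeft F.f G.f s)
      (by
        funext i
        exact (congrArg _ (fib_sumMap_left F.f G.f s i)).trans (Fin.append_left x.2 x'.2 _))
      (cast (congrArg (M.Hom _) (Fin.append_left y.2 y'.2 s).symm) (F.φ s)) := by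
  simp only [LHom.tensor, Fin.addCases_left]

theorem LHom.tensor_φ_natAdd {x x' y y' : Σ n, Fin n → M.Ob} (F : LHom M x y)
    (G : LHom M x' y') (s) : (F.tensor G).φ (Fin.natAdd _ s) =
      M.perm (fibSumRight F.f G.f s)
      (by
        funext i
        exact (congrArg _ (fib_sumMap_right F.f G.f s i)).trans (Fin.append_right x.2 x'.2 _))
      (cast (congrArg (M.Hom _) (Fin.append_right y.2 y'.2 s).symm) (G.φ s)) := by
  simp only [LHom.tensor, Fin.addCases_right]

theorem LHom.toTup_id (x : Σ n, Fin n → M.Ob) : LHom.toTup hM ((L M).id x) = 𝟙 (⟨x⟩ : Tup hM) :=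
  LHom.toTup_ofEquiv hM (Equiv.refl _) rfl

/-- Morphisms into a product are compared on the two projections; there the fibres of `sumMap` match
those of one factor, up to a label preserving permutation. -/
theorem LHom.toTup_tensor {x x' y y' : Σ n, Fin n → M.Ob} (F : LHom M x y) (G : LHom M x' y') :
    (F.tensor G).toTup hM = F.toTup hM ⊗ₘ G.toTup hM := by
  apply Tup.prod_hom_ext
  · refine Eq.trans ?_ (CartesianMonoidalCategory.tensorHom_fst (F.toTup hM) (G.toTup hM)).symm
    funext s
    refine (Tup.comp_fstMap _ s).trans (Eq.trans ?_ (Op.comp_var _ _ _).symm)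
    refine (congrArg (fun φ => Op.cast _ (Op.mk hM ⟨_, fib (sumMap F.f G.f) _, φ⟩))
      (F.tensor_φ_castAdd G s)).trans ((Op.cast_mk_perm hM _ _ _ _ _).trans (Op.sound ?_))
    exact ⟨fibSumLeft F.f G.f s, funext fun i => fib_sumMap_left F.f G.f s i,
      (hM.perm_perm_refl (x := x.2 ∘ fib F.f s) _ _ _ (F.φ s)).symm⟩
  · refine Eq.trans ?_ (CartesianMonoidalCategory.tensorHom_snd (F.toTup hM) (G.toTup hM)).symm
    funext s
    refine (Tup.comp_sndMap _ s).trans (Eq.trans ?_ (Op.comp_var _ _ _).symm)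
    refine (congrArg (fun φ => Op.cast _ (Op.mk hM ⟨_, fib (sumMap F.f G.f) _, φ⟩))
      (F.tensor_φ_natAdd G s)).trans ((Op.cast_mk_perm hM _ _ _ _ _).trans (Op.sound ?_))
    exact ⟨fibSumRight F.f G.f s, funext fun i => fib_sumMap_right F.f G.f s i,
      (hM.perm_perm_refl (x := x'.2 ∘ fib G.f s) _ _ _ (G.φ s)).symm⟩

theorem LHom.ofEquiv_comp_ofEquiv (hM : M.IsMulticategory) {x y z : Σ n, Fin n → M.Ob} (e : Fin x.1 ≃ Fin y.1)
    (h : x.2 = y.2 ∘ e) (e' : Fin y.1 ≃ Fin z.1) (h' : y.2 = z.2 ∘ e') :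
    (LHom.ofEquiv (M := M) e h).comp (LHom.ofEquiv e' h') =
      LHom.ofEquiv (e.trans e') (by rw [h, h']; rfl) := by
  apply LHom.toTup_injective hM
  rw [LHom.toTup_comp, LHom.toTup_ofEquiv, LHom.toTup_ofEquiv, LHom.toTup_ofEquiv,
    Tup.reindex_comp_reindex]
  rfl

theorem L_isCategory (hM : M.IsMulticategory) : (L M).IsCategory where
  id_comp f := LHom.toTup_injective hM <| by
    refine (LHom.toTup_comp hM _ _).trans ?_
    refine (congrArg (· ≫ LHom.toTup hM f) (LHom.toTup_id hM _)).trans ?_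
    exact Category.id_comp _
  comp_id f := LHom.toTup_injective hM <| by
    refine (LHom.toTup_comp hM _ _).trans ?_
    refine (congrArg (LHom.toTup hM f ≫ ·) (LHom.toTup_id hM _)).trans ?_
    exact Category.comp_id _
  assoc f g h := LHom.toTup_injective hM <| by
    refine (LHom.toTup_comp hM _ _).trans ?_
    refine (congrArg (· ≫ LHom.toTup hM h) (LHom.toTup_comp hM _ _)).trans ?_
    refine Eq.trans ?_ (LHom.toTup_comp hM _ _).symm
    refine Eq.trans ?_ (congrArg (LHom.toTup hM f ≫ ·) (LHom.toTup_comp hM _ _)).symm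
    exact Category.assoc _ _ _

/-- `L M` as a category. -/
noncomputable abbrev LCat : Category.{v} (L M).Ob := (L_isCategory hM).category

/-- The isomorphism of `L M` that is given by a bijection of indices. -/
noncomputable def LIso {x y : Σ n, Fin n → M.Ob} (e : Fin x.1 ≃ Fin y.1) (h : x.2 = y.2 ∘ e)
    (h' : y.2 = x.2 ∘ e.symm) :
    letI := LCat hM
    @Iso (L M).Ob _ x y :=
  letI := LCat hM
  { hom := LHom.ofEquiv e h
    inv := LHom.ofEquiv e.symm h'
    hom_inv_id := (LHom.ofEquiv_comp_ofEquiv hM _ _ _ _).trans (by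
      simp only [Equiv.self_trans_symm]; rfl)
    inv_hom_id := (LHom.ofEquiv_comp_ofEquiv hM _ _ _ _).trans (by
      simp only [Equiv.symm_trans_self]; rfl) }

/-- The structure of a monoidal category on `L M`. -/
noncomputable abbrev LMonStruct :
    letI := LCat hM
    MonoidalCategoryStruct (L M).Ob :=
  letI := LCat hM
  { tensorObj := (L M).tensorObj
    tensorUnit := (L M).unit
    tensorHom := (L M).tensorHom
    whiskerLeft := fun x _ _ g => (L M).tensorHom ((L M).id x) g
    whiskerRight := fun f y => (L M).tensorHom f ((L M).id y)
    associator := fun x y z => LIso hM (x := lTensor (lTensor x y) z)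
      (y := lTensor x (lTensor y z)) (finCongr (Nat.add_assoc _ _ _)) (Fin.append_assoc _ _ _) (by
        simp only [lTensor, Fin.append_assoc]; rfl)
    leftUnitor := fun x => LIso hM (x := lTensor ⟨0, Fin.elim0⟩ x) (y := x)
      (finCongr (Nat.zero_add _)) (Fin.elim0_append _) (by
        simp only [lTensor, Fin.elim0_append]; rfl)
    rightUnitor := fun x => LIso hM (x := lTensor x ⟨0, Fin.elim0⟩) (y := x)
      (finCongr (Nat.add_zero _)) (Fin.append_elim0 _) (by
        simp only [lTensor, Fin.append_elim0]; rfl) }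

/-- The faithful functor from `L M` to the category of tuples. -/
noncomputable def LFunctor :
    letI := LCat hM
    (L M).Ob ⥤ Tup hM :=
  letI := LCat hM
  { obj := fun x => ⟨x⟩
    map := fun F => LHom.toTup hM F
    map_id := fun x => LHom.toTup_id hM x
    map_comp := fun F G => LHom.toTup_comp hM F G }

theorem LFunctor_faithful :
    letI := LCat hM
    (LFunctor hM).Faithful :=
  letI := LCat hM
  ⟨fun h => LHom.toTup_injective hM h⟩

theorem Tup.var_congr {x : Tup hM} {i i' : Fin x.of.1} {a : M.Ob} (h : x.of.2 i = a)
    (h' : x.of.2 i' = a) (e : i = i') : Op.var hM i h = Op.var hM i' h' := by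
  subst e
  rfl

open SemiCartesianMonoidalCategory CartesianMonoidalCategory in
theorem Tup.associator_hom (x y z : Tup hM) : (α_ x y z).hom =
    Tup.reindex (x := ⟨lTensor (lTensor x.of y.of) z.of⟩)
      (y := ⟨lTensor x.of (lTensor y.of z.of)⟩) (finCongr (Nat.add_assoc _ _ _)).symm (by
        simp only [lTensor, Fin.append_assoc]; rfl) := by
  apply Tup.prod_hom_ext
  · refine (associator_hom_fst x y z).trans ?_
    funext s
    refine (Tup.comp_fstMap (fstMap _ _) s).trans (Eq.trans ?_ (Tup.comp_fstMap _ s).symm)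
    refine (Op.cast_var _ _).trans (Eq.trans ?_ (Op.cast_var _ _).symm)
    exact var_congr hM (x := (x ⊗ y) ⊗ z) _ _ (by ext; rfl)
  · apply Tup.prod_hom_ext
    · refine ((Category.assoc _ _ _).trans (associator_hom_snd_fst x y z)).trans ?_
      funext s
      refine (Tup.comp_sndMap (fstMap _ _) s).trans (Eq.trans ?_ (Tup.comp_fstMap _ s).symm)
      refine (Op.cast_var _ _).trans (Eq.trans ?_ (congrArg _ (Tup.comp_sndMap _ _)).symm)
      refine Eq.trans ?_ (Op.cast_cast _ _ _).symm
      refine Eq.trans ?_ (Op.cast_var _ _).symm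
      exact var_congr hM (x := (x ⊗ y) ⊗ z) _ _ (by ext; rfl)
    · refine ((Category.assoc _ _ _).trans (associator_hom_snd_snd x y z)).trans ?_
      funext s
      refine Eq.trans ?_ (Tup.comp_sndMap _ s).symm
      refine Eq.trans ?_ (congrArg _ (Tup.comp_sndMap _ _)).symm
      refine Eq.trans ?_ (Op.cast_cast _ _ _).symm
      refine Eq.trans ?_ (Op.cast_var _ _).symm
      exact var_congr hM (x := (x ⊗ y) ⊗ z) _ _ (by ext; simp; exact Nat.add_assoc _ _ _)

open SemiCartesianMonoidalCategory CartesianMonoidalCategory in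
theorem Tup.braiding_hom (x y : Tup hM) : (β_ x y).hom =
    Tup.reindex (x := ⟨lTensor x.of y.of⟩) (y := ⟨lTensor y.of x.of⟩) finAddFlip.symm (by
      simp only [lTensor, append_comp_finAddFlip x.of.2]; funext i; simp) := by
  apply Tup.prod_hom_ext
  · refine (braiding_hom_fst x y).trans ?_
    funext s
    refine Eq.trans ?_ (Tup.comp_fstMap _ s).symm
    refine Eq.trans ?_ (Op.cast_var _ _).symm
    exact var_congr hM (x := x ⊗ y) _ _
      ((Equiv.symm_apply_eq _).2 (finAddFlip_apply_natAdd _ _).symm).symm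
  · refine (braiding_hom_snd x y).trans ?_
    funext s
    refine Eq.trans ?_ (Tup.comp_sndMap _ s).symm
    refine Eq.trans ?_ (Op.cast_var _ _).symm
    exact var_congr hM (x := x ⊗ y) _ _
      ((Equiv.symm_apply_eq _).2 (finAddFlip_apply_castAdd _ _).symm).symm

theorem LHom.toTup_associator (x y z : Σ n, Fin n → M.Ob) :
    LHom.toTup hM ((L M).associator x y z) = (α_ (⟨x⟩ : Tup hM) ⟨y⟩ ⟨z⟩).hom :=
  (LHom.toTup_ofEquiv hM _ (Fin.append_assoc _ _ _)).trans
    (Tup.associator_hom hM ⟨x⟩ ⟨y⟩ ⟨z⟩).symm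

theorem LHom.toTup_braiding (x y : Σ n, Fin n → M.Ob) :
    LHom.toTup hM ((L M).braiding x y) = (β_ (⟨x⟩ : Tup hM) ⟨y⟩).hom :=
  (LHom.toTup_ofEquiv hM (x := lTensor x y) (y := lTensor y x) finAddFlip (append_comp_finAddFlip x.2 y.2)).trans
    (Tup.braiding_hom hM ⟨x⟩ ⟨y⟩).symm

theorem LHom.toTup_leftUnitor (x : Σ n, Fin n → M.Ob) :
    LHom.toTup hM ((L M).leftUnitor x) = (λ_ (⟨x⟩ : Tup hM)).hom := by
  refine (LHom.toTup_ofEquiv hM (finCongr (Nat.zero_add _)) (Fin.elim0_append x.2)).trans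
    (Eq.trans ?_ (CartesianMonoidalCategory.leftUnitor_hom _).symm)
  funext s
  exact Tup.var_congr hM (x := 𝟙_ (Tup hM) ⊗ ⟨x⟩) _ _ (Fin.ext (Nat.zero_add _).symm)

theorem LHom.toTup_rightUnitor (x : Σ n, Fin n → M.Ob) :
    LHom.toTup hM ((L M).rightUnitor x) = (ρ_ (⟨x⟩ : Tup hM)).hom := by
  refine (LHom.toTup_ofEquiv hM (x := lTensor x ⟨0, Fin.elim0⟩) (y := x)
    (finCongr (Nat.add_zero _)) (Fin.append_elim0 x.2)).trans
    (Eq.trans ?_ (CartesianMonoidalCategory.rightUnitor_hom _).symm)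
  funext s
  exact Tup.var_congr hM (x := ⟨x⟩ ⊗ 𝟙_ (Tup hM)) _ _ (Fin.ext rfl)

/-- The comparison of the monoidal structures of `L M` and of the category of tuples. -/
noncomputable def LInducing :
    letI := LCat hM
    letI := LMonStruct hM
    Monoidal.InducingFunctorData (LFunctor hM) :=
  letI := LCat hM
  letI := LMonStruct hM
  { μIso := fun x y => Iso.refl ((⟨x⟩ : Tup hM) ⊗ ⟨y⟩)
    εIso := Iso.refl (𝟙_ (Tup hM))
    whiskerLeft_eq := fun x y z f => by
      refine Eq.trans ?_ ((Category.id_comp _).trans (Category.comp_id _)).symm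
      refine (LHom.toTup_tensor hM _ _).trans ?_
      refine (congrArg (· ⊗ₘ LHom.toTup hM f) ((LFunctor hM).map_id x)).trans ?_
      exact id_tensorHom _ _
    whiskerRight_eq := fun {x y} f z => by
      refine Eq.trans ?_ ((Category.id_comp _).trans (Category.comp_id _)).symm
      refine (LHom.toTup_tensor hM _ _).trans ?_
      refine (congrArg (LHom.toTup hM f ⊗ₘ ·) ((LFunctor hM).map_id z)).trans ?_
      exact tensorHom_id _ _
    tensorHom_eq := fun f g => by
      refine Eq.trans ?_ ((Category.id_comp _).trans (Category.comp_id _)).symm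
      exact LHom.toTup_tensor hM _ _
    associator_eq := fun x y z => by
      refine (LHom.toTup_associator hM _ _ _).trans ?_
      let X : Tup hM := ⟨x⟩
      let Y : Tup hM := ⟨y⟩
      let Z : Tup hM := ⟨z⟩
      change (α_ X Y Z).hom = (𝟙 ((X ⊗ Y) ⊗ Z) ≫ (𝟙 (X ⊗ Y) ⊗ₘ 𝟙 Z)) ≫ (α_ X Y Z).hom ≫
        ((𝟙 X ⊗ₘ 𝟙 (Y ⊗ Z)) ≫ 𝟙 (X ⊗ (Y ⊗ Z)))
      simp
    leftUnitor_eq := fun x => by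
      refine (LHom.toTup_leftUnitor hM _).trans ?_
      let X : Tup hM := ⟨x⟩
      change (λ_ X).hom = (𝟙 (𝟙_ (Tup hM) ⊗ X) ≫ (𝟙 (𝟙_ (Tup hM)) ⊗ₘ 𝟙 X)) ≫ (λ_ X).hom
      simp
    rightUnitor_eq := fun x => by
      refine (LHom.toTup_rightUnitor hM _).trans ?_
      let X : Tup hM := ⟨x⟩
      change (ρ_ X).hom = (𝟙 (X ⊗ 𝟙_ (Tup hM)) ≫ (𝟙 X ⊗ₘ 𝟙 (𝟙_ (Tup hM)))) ≫ (ρ_ X).hom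
      simp }

/-- `L M` as a monoidal category. -/
noncomputable abbrev LMonoidal :
    letI := LCat hM
    MonoidalCategory (L M).Ob :=
  letI := LCat hM
  letI := LMonStruct hM
  letI := LFunctor_faithful hM
  Monoidal.induced (LFunctor hM) (LInducing hM)

/-- `L M` as a symmetric monoidal category. -/
noncomputable abbrev LSymmetric :
    letI := LCat hM
    letI := LMonoidal hM
    SymmetricCategory (L M).Ob :=
  letI := LCat hM
  letI := LMonStruct hM
  letI := LFunctor_faithful hM
  letI := LMonoidal hM
  letI : (LFunctor hM).Monoidal := Monoidal.fromInducedMonoidal (LFunctor hM) (LInducing hM)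
  -- The symmetry of `L M` maps to the exchange of factors in the cartesian structure, so the
  -- hexagons and the symmetry law are reflected by faithfulness.
  letI : BraidedCategory (L M).Ob := BraidedCategory.ofFaithful (LFunctor hM)
    (fun x y => LIso hM (x := lTensor x y) (y := lTensor y x) finAddFlip
      (append_comp_finAddFlip x.2 y.2)
      (by simp only [lTensor, append_comp_finAddFlip x.2]; funext i; simp))
    (fun x y => (Category.id_comp _).trans
      ((LHom.toTup_braiding hM x y).trans (Category.comp_id _).symm))
  letI : (LFunctor hM).Braided := ⟨fun x y => (Category.id_comp _).trans
      ((LHom.toTup_braiding hM x y).trans (Category.comp_id _).symm)⟩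
  SymmetricCategory.ofFaithful (LFunctor hM)

/-- A bijection forces equal lengths, and one that keeps the values of indices is then the identity.
Strictness of `L M` follows, because its associators and unitors are of this kind. -/
theorem LHom.ofEquiv_eq_eqToHom {x y : Σ n, Fin n → M.Ob} (e : Fin x.1 ≃ Fin y.1)
    (h : x.2 = y.2 ∘ e) (he : ∀ i, (e i : ℕ) = i) :
    letI := LCat hM
    ∃ h' : x = y, LHom.ofEquiv (M := M) e h = eqToHom (C := (L M).Ob) h' := by
  obtain ⟨m, x⟩ := x
  obtain ⟨n, y⟩ := y
  obtain rfl : m = n := by simpa using Fintype.card_congr e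
  obtain rfl : e = Equiv.refl _ := Equiv.ext fun i => Fin.ext (he i)
  dsimp at h
  obtain rfl : x = y := h
  exact ⟨rfl, rfl⟩

theorem L_isPermutative (hM : M.IsMulticategory) : (L M).IsPermutative :=
  letI := LCat hM
  letI := LMonoidal hM
  letI := LSymmetric hM
  -- The `rfl` says that the induced structure consists of the data of `L M` itself; only its axioms
  -- were taken from `Tup hM`.
  ⟨LCat hM, LMonoidal hM, LSymmetric hM, rfl,
    { assoc := fun x y z => LHom.ofEquiv_eq_eqToHom hM (x := lTensor (lTensor x y) z)
        (y := lTensor x (lTensor y z)) _ (Fin.append_assoc _ _ _) fun _ => rfl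
      left_unit := fun x => LHom.ofEquiv_eq_eqToHom hM (x := lTensor ⟨0, Fin.elim0⟩ x)
        (y := x) _ (Fin.elim0_append _) fun _ => rfl
      right_unit := fun x => LHom.ofEquiv_eq_eqToHom hM (x := lTensor x ⟨0, Fin.elim0⟩)
        (y := x) _ (Fin.append_elim0 _) fun _ => rfl }⟩

end Structure

/-! ## The strict map of a multifunctor -/

section StrictMap

variable {M N : MultiData.{v, u}} {F : MultifunctorData M N}

theorem MultifunctorData.IsMultifunctor.map_perm_of_eq (hF : F.IsMultifunctor) {m n : ℕ}
    {x : Fin n → M.Ob} {x' : Fin m → M.Ob} {y : M.Ob} (σ : Fin m ≃ Fin n) (h : x' = x ∘ σ)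
    (f : M.Hom x y) : F.map (M.perm σ h f) = N.perm σ (by subst h; rfl) (F.map f) := by
  subst h
  exact hF.map_perm σ f

theorem LMap_ofEquiv (hF : F.IsMultifunctor) {x y : Σ n, Fin n → M.Ob} (e : Fin x.1 ≃ Fin y.1)
    (h : x.2 = y.2 ∘ e) : (LMap F).map (LHom.ofEquiv (M := M) e h) =
      LHom.ofEquiv (M := N) (x := ⟨x.1, F.obj ∘ x.2⟩) (y := ⟨y.1, F.obj ∘ y.2⟩) e
        (by rw [h]; rfl) := by
  refine congrArg (LHom.mk (M := N) (x := ⟨x.1, F.obj ∘ x.2⟩) (y := ⟨y.1, F.obj ∘ y.2⟩) e) ?_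
  funext s
  refine (hF.map_perm_of_eq _ _ _).trans ?_
  rw [hF.map_id]
  rfl

theorem LMap_isFunctor (hF : F.IsMultifunctor) : (LMap F).IsFunctor where
  map_id x := LMap_ofEquiv hF (x := x) (y := x) (Equiv.refl _) rfl
  map_comp {x y z} f g := by
    refine congrArg (LHom.mk (M := N) (x := ⟨x.1, F.obj ∘ x.2⟩) (y := ⟨z.1, F.obj ∘ z.2⟩) _) ?_
    funext s
    refine (hF.map_perm_of_eq _ _ _).trans ?_
    rw [hF.map_comp]
    rfl

theorem comp_append {A B : Type*} (f : A → B) {m n : ℕ} (x : Fin m → A) (y : Fin n → A) :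
    f ∘ Fin.append x y = Fin.append (f ∘ x) (f ∘ y) := by
  funext i
  induction i using Fin.addCases <;> simp

theorem LHom.ofEquiv_heq {m n : ℕ} {x x' : Fin m → N.Ob} {y y' : Fin n → N.Ob}
    (e : Fin m ≃ Fin n) (h : x = y ∘ e) (h' : x' = y' ∘ e) (hx : x = x') (hy : y = y') :
    LHom.ofEquiv (M := N) (x := ⟨m, x⟩) (y := ⟨n, y⟩) e h ≍
      LHom.ofEquiv (M := N) (x := ⟨m, x'⟩) (y := ⟨n, y'⟩) e h' := by
  subst hx hy
  rfl

/-- Applying `F` to a concatenation agrees with concatenating the images only propositionally. Here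
the function of indices is literally the same, so heterogeneous equality can be checked entrywise.
-/
theorem LHom.heq_of_φ {m n : ℕ} {x x' : Fin m → N.Ob} {y y' : Fin n → N.Ob} (hx : x = x')
    (hy : y = y') {f : Fin m → Fin n} {φ : ∀ s, N.Hom (x ∘ fib f s) (y s)}
    {φ' : ∀ s, N.Hom (x' ∘ fib f s) (y' s)} (h : ∀ s, φ s ≍ φ' s) :
    (⟨f, φ⟩ : LHom N ⟨m, x⟩ ⟨n, y⟩) ≍ (⟨f, φ'⟩ : LHom N ⟨m, x'⟩ ⟨n, y'⟩) := by
  subst hx hy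
  obtain rfl : φ = φ' := funext fun s => eq_of_heq (h s)
  rfl

theorem MultifunctorData.IsMultifunctor.map_perm_cast_heq (hF : F.IsMultifunctor) {m n : ℕ}
    {x : Fin n → M.Ob} {x' : Fin m → M.Ob} {x'' : Fin m → N.Ob} {y z : M.Ob} {z' : N.Ob}
    (σ : Fin m ≃ Fin n) (h : x' = x ∘ σ) (h' : x'' = (F.obj ∘ x) ∘ σ) (e : y = z)
    (e' : F.obj y = z') (u : M.Hom x y) :
    F.map (M.perm σ h (cast (congrArg (M.Hom x) e) u)) ≍
      N.perm σ h' (cast (congrArg (N.Hom (F.obj ∘ x)) e') (F.map u)) := by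
  subst h h' e e'
  exact heq_of_eq (hF.map_perm σ u)

theorem LMap_isStrictMap (hF : F.IsMultifunctor) : IsStrictMap (L M) (L N) (LMap F) where
  isFunctor := LMap_isFunctor hF
  obj_unit := congrArg (Sigma.mk 0) (Subsingleton.elim _ _)
  obj_tensor a b := congrArg (Sigma.mk (a.1 + b.1)) (comp_append F.obj a.2 b.2)
  map_tensor {a b c d} f g := by
    refine LHom.heq_of_φ (comp_append F.obj a.2 c.2) (comp_append F.obj b.2 d.2) fun s => ?_
    induction s using Fin.addCases with
    | left s =>
      refine (heq_of_eq (congrArg (fun φ => F.map φ) (LHom.tensor_φ_castAdd f g s))).trans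
        ((hF.map_perm_cast_heq _ _ _ (Fin.append_left b.2 d.2 s).symm
          (Fin.append_left (F.obj ∘ b.2) (F.obj ∘ d.2) s).symm _).trans
        (heq_of_eq (LHom.tensor_φ_castAdd ((LMap F).map f) ((LMap F).map g) s).symm))
    | right s =>
      refine (heq_of_eq (congrArg (fun φ => F.map φ) (LHom.tensor_φ_natAdd f g s))).trans
        ((hF.map_perm_cast_heq _ _ _ (Fin.append_right b.2 d.2 s).symm
          (Fin.append_right (F.obj ∘ b.2) (F.obj ∘ d.2) s).symm _).trans
        (heq_of_eq (LHom.tensor_φ_natAdd ((LMap F).map f) ((LMap F).map g) s).symm))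
  map_associator a b c := (heq_of_eq (LMap_ofEquiv hF
      (x := lTensor (lTensor a b) c) (y := lTensor a (lTensor b c)) _
      (Fin.append_assoc _ _ _))).trans <| LHom.ofEquiv_heq _ _ (Fin.append_assoc _ _ _)
    (by simp only [comp_append]; rfl) (by simp only [comp_append]; rfl)
  map_leftUnitor a := (heq_of_eq (LMap_ofEquiv hF
      (x := lTensor ⟨0, Fin.elim0⟩ a) (y := a) _ (Fin.elim0_append _))).trans <|
    LHom.ofEquiv_heq _ _ (Fin.elim0_append _)
    (by simp only [comp_append]; exact congrArg (Fin.append · _) (Subsingleton.elim _ _)) rfl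
  map_rightUnitor a := (heq_of_eq (LMap_ofEquiv hF
      (x := lTensor a ⟨0, Fin.elim0⟩) (y := a) _ (Fin.append_elim0 _))).trans <|
    LHom.ofEquiv_heq _ _ (Fin.append_elim0 _)
    (by simp only [comp_append]; exact congrArg (Fin.append _ ·) (Subsingleton.elim _ _)) rfl
  map_braiding a b := (heq_of_eq (LMap_ofEquiv hF
      (x := lTensor a b) (y := lTensor b a) _ (append_comp_finAddFlip a.2 b.2))).trans <|
    LHom.ofEquiv_heq _ _ (append_comp_finAddFlip _ _)
    (by simp only [comp_append]; rfl) (by simp only [comp_append]; rfl)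

end StrictMap

/-! ## Coherence for symmetric monoidal categories -/

section Coherence

variable {C : Type u} [Category.{v} C] [MonoidalCategory C] {ι : Type} (y : ι → C)

/-- The product of the objects `y i`, for `i` in a list, bracketed to the right. -/
@[reducible] def word : List ι → C
  | [] => 𝟙_ C
  | i :: l => y i ⊗ word l

/-- The canonical isomorphism that splits the product over a concatenation of lists. -/
def wordAppend : ∀ l m : List ι, word y (l ++ m) ≅ word y l ⊗ word y m
  | [], m => (λ_ (word y m)).symm
  | i :: l, m => whiskerLeftIso (y i) (wordAppend l m) ≪≫ (α_ (y i) (word y l) (word y m)).symm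

variable [SymmetricCategory C]

/-- The exchange of the first two factors of a product bracketed to the right. -/
def exch (a b c : C) : a ⊗ (b ⊗ c) ⟶ b ⊗ (a ⊗ c) :=
  (α_ a b c).inv ≫ (β_ a b).hom ▷ c ≫ (α_ b a c).hom

theorem exch_exch (a b c : C) : exch a b c ≫ exch b a c = 𝟙 _ := by
  simp only [exch, Category.assoc, Iso.hom_inv_id_assoc, ← comp_whiskerRight_assoc,
    SymmetricCategory.symmetry, id_whiskerRight, Category.id_comp, Iso.inv_hom_id]

theorem exch_natural (a b : C) {c c' : C} (f : c ⟶ c') :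
    exch a b c ≫ b ◁ a ◁ f = a ◁ b ◁ f ≫ exch a b c' := by
  simp only [exch, Category.assoc]
  rw [← associator_naturality_right, associator_inv_naturality_right_assoc,
    whisker_exchange_assoc]

/-- The Yang-Baxter equation for `a`, `b`, `c`, tensored with the remaining product `d` and
rebracketed. -/
theorem exch_braid (a b c d : C) :
    exch a b (c ⊗ d) ≫ b ◁ exch a c d ≫ exch b c (a ⊗ d) =
      a ◁ exch b c d ≫ exch a c (b ⊗ d) ≫ c ◁ exch a b d := by
  have h := congrArg (fun f => (α_ a b (c ⊗ d)).inv ≫ (α_ (a ⊗ b) c d).inv ≫ f ▷ d ≫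
    (α_ (c ⊗ b) a d).hom ≫ (α_ c b (a ⊗ d)).hom) (BraidedCategory.yang_baxter' a b c)
  simp only [exch]
  calc _ = _ := by monoidal
    _ = _ := h
    _ = _ := by monoidal

/-- The canonical morphisms between products over lists. -/
inductive IsCan : (w w' : List ι) → (word y w ⟶ word y w') → Prop
  | id (w : List ι) : IsCan w w (𝟙 _)
  | comp {w w' w'' : List ι} {f : word y w ⟶ word y w'} {g : word y w' ⟶ word y w''} :
    IsCan w w' f → IsCan w' w'' g → IsCan w w'' (f ≫ g)
  | cons (i : ι) {w w' : List ι} {f : word y w ⟶ word y w'} :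
    IsCan w w' f → IsCan (i :: w) (i :: w') (y i ◁ f)
  | swap (i j : ι) (w : List ι) : IsCan (i :: j :: w) (j :: i :: w) (exch (y i) (y j) (word y w))

/-- `IsPull i l w p` means that `p` moves the factor `y i` of the product over `w` to the front,
and that `l` lists the other factors. -/
inductive IsPull (i : ι) : (l w : List ι) → (word y w ⟶ y i ⊗ word y l) → Prop
  | here (l : List ι) : IsPull i l (i :: l) (𝟙 (y i ⊗ word y l))
  | there (j : ι) {l w : List ι} {p : word y w ⟶ y i ⊗ word y l} :
    IsPull i l w p → IsPull i (j :: l) (j :: w) (y j ◁ p ≫ exch (y j) (y i) (word y l))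

variable {y}

theorem IsPull.mem {i : ι} {l w : List ι} {p : word y w ⟶ y i ⊗ word y l}
    (h : IsPull y i l w p) : i ∈ w := by
  induction h with
  | here => simp
  | there j _ ih => simp [ih]

theorem exists_isPull {i : ι} {w : List ι} (h : i ∈ w) : ∃ l p, IsPull y i l w p := by
  induction w with
  | nil => simp at h
  | cons j w ih =>
    by_cases hj : i = j
    · subst hj
      exact ⟨_, _, .here _⟩
    · obtain ⟨l, p, h⟩ := ih ((List.mem_cons.1 h).resolve_left hj)
      exact ⟨_, _, .there j h⟩

theorem IsPull.isIso {i : ι} {l w : List ι} {p : word y w ⟶ y i ⊗ word y l}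
    (h : IsPull y i l w p) : IsIso p := by
  induction h with
  | here => exact inferInstanceAs (IsIso (𝟙 _))
  | @there j l w p _ ih =>
    have := ih
    have : IsIso (exch (y j) (y i) (word y l)) := ⟨exch _ _ _, exch_exch _ _ _, exch_exch _ _ _⟩
    exact IsIso.comp_isIso

/-- Without repetitions there is only one occurrence of `i` that can be pulled. -/
theorem IsPull.unique {i : ι} {l l' w : List ι} {p : word y w ⟶ y i ⊗ word y l}
    {p' : word y w ⟶ y i ⊗ word y l'} (hw : w.Nodup) (h : IsPull y i l w p)
    (h' : IsPull y i l' w p') : l = l' ∧ p ≍ p' := by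
  induction h generalizing l' with
  | here =>
    cases h' with
    | here => exact ⟨rfl, HEq.rfl⟩
    | there _ h' => exact ((List.nodup_cons.1 hw).1 h'.mem).elim
  | there j h ih =>
    cases h' with
    | here => exact ((List.nodup_cons.1 hw).1 h.mem).elim
    | there _ h' =>
      obtain ⟨rfl, hp⟩ := ih (List.nodup_cons.1 hw).2 h'
      obtain rfl := eq_of_heq hp
      exact ⟨rfl, HEq.rfl⟩

theorem IsCan.perm {w w' : List ι} {f : word y w ⟶ word y w'} (h : IsCan y w w' f) :
    w.Perm w' := by
  induction h with
  | id => exact .refl _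
  | comp _ _ ih ih' => exact ih.trans ih'
  | cons i _ ih => exact ih.cons i
  | swap i j w => exact .swap _ _ _

theorem IsCan.exists_inv {w w' : List ι} {f : word y w ⟶ word y w'} (h : IsCan y w w' f) :
    ∃ g, IsCan y w' w g ∧ f ≫ g = 𝟙 _ ∧ g ≫ f = 𝟙 _ := by
  induction h with
  | id => exact ⟨_, .id _, by simp, by simp⟩
  | comp _ _ ih ih' =>
    obtain ⟨g, hg, h₁, h₂⟩ := ih
    obtain ⟨g', hg', h₁', h₂'⟩ := ih'
    exact ⟨_, hg'.comp hg, by simp [reassoc_of% h₁', h₁], by simp [reassoc_of% h₂, h₂']⟩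
  | cons i _ ih =>
    obtain ⟨g, hg, h₁, h₂⟩ := ih
    refine ⟨_, hg.cons i, ?_, ?_⟩
    · rw [← whiskerLeft_comp, h₁]; exact whiskerLeft_id _ _
    · rw [← whiskerLeft_comp, h₂]; exact whiskerLeft_id _ _
  | swap i j w => exact ⟨_, .swap j i w, exch_exch _ _ _, exch_exch _ _ _⟩

/-- The inductive step of coherence: once a factor is pulled to the front on both sides, a canonical
morphism acts only on the remaining factors, again canonically. It suffices to treat the generators.
-/
theorem IsCan.exists_comp_pull {w w' : List ι} {f : word y w ⟶ word y w'} (h : IsCan y w w' f)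
    (hw : w.Nodup) {i : ι} {l l' : List ι} {p : word y w ⟶ y i ⊗ word y l}
    {p' : word y w' ⟶ y i ⊗ word y l'} (hp : IsPull y i l w p) (hp' : IsPull y i l' w' p') :
    ∃ g, IsCan y l l' g ∧ f ≫ p' = p ≫ y i ◁ g := by
  induction h generalizing l l' with
  | id w =>
    obtain ⟨rfl, h⟩ := hp.unique hw hp'
    obtain rfl := eq_of_heq h
    exact ⟨_, .id _, by simp⟩
  | comp h h' ih ih' =>
    obtain ⟨m, q, hq⟩ := exists_isPull (y := y) (h.perm.mem_iff.1 hp.mem)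
    obtain ⟨g, hg, e⟩ := ih hw hp hq
    obtain ⟨g', hg', e'⟩ := ih' (h.perm.nodup_iff.1 hw) hq hp'
    exact ⟨_, hg.comp hg', by rw [Category.assoc, e', reassoc_of% e, whiskerLeft_comp]⟩
  | cons j h ih =>
    have hw' := List.nodup_cons.1 hw
    cases hp with
    | here =>
      cases hp' with
      | here => exact ⟨_, h, (Category.comp_id _).trans (Category.id_comp _).symm⟩
      | there _ hp' => exact (hw'.1 (h.perm.mem_iff.2 hp'.mem)).elim
    | there _ hp =>
      cases hp' with
      | here => exact (hw'.1 hp.mem).elim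
      | there _ hp' =>
        obtain ⟨g, hg, e⟩ := ih hw'.2 hp hp'
        refine ⟨_, hg.cons j, ?_⟩
        rw [Category.assoc, exch_natural, ← whiskerLeft_comp_assoc, ← whiskerLeft_comp_assoc, e]
  | swap j k w =>
    have hw' := List.nodup_cons.1 hw
    have hw'' := List.nodup_cons.1 hw'.2
    cases hp with
    | here =>
      cases hp' with
      | here => simp at hw'
      | there _ hp' =>
        cases hp' with
        | here =>
          refine ⟨_, .id _, ?_⟩
          rw [whiskerLeft_id, Category.id_comp, exch_exch, whiskerLeft_id]
          exact (Category.id_comp _).symm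
        | there _ hp' => simp [hp'.mem] at hw'
    | there _ hp =>
      cases hp with
      | here =>
        cases hp' with
        | here =>
          refine ⟨_, .id _, ?_⟩
          rw [whiskerLeft_id, whiskerLeft_id, Category.id_comp, Category.comp_id]
        | there _ hp' =>
          cases hp' with
          | here => simp at hw'
          | there _ hp' => exact (hw''.1 hp'.mem).elim
      | there _ hp =>
        cases hp' with
        | here => exact (hw''.1 hp.mem).elim
        | there _ hp' =>
          cases hp' with
          | here => simp [hp.mem] at hw'
          | there _ hp' =>
            obtain ⟨rfl, h⟩ := hp.unique hw''.2 hp'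
            obtain rfl := eq_of_heq h
            -- The pulled factor lies behind both exchanged factors, and moving it past them
            -- commutes with their exchange by `exch_braid`.
            refine ⟨_, .swap j k _, ?_⟩
            simp only [whiskerLeft_comp, Category.assoc]
            rw [← exch_braid, reassoc_of% exch_natural]

/-- The lists stay variables with equations so that induction on `IsCan` applies; on empty lists
only identities and composites remain. -/
theorem IsCan.eq_eqToHom_of_nil {w w' : List ι} {f : word y w ⟶ word y w'} (h : IsCan y w w' f)
    (hw : w = []) (hw' : w' = []) : f = eqToHom (by rw [hw, hw']) := by
  induction h with
  | id => rfl
  | comp h _ ih ih' =>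
    subst hw hw'
    have := h.perm.nil_eq
    rw [ih rfl this.symm, ih' this.symm rfl, eqToHom_trans]
  | cons => simp at hw
  | swap => simp at hw

/-- The coherence theorem: canonical morphisms between products of distinct factors are unique. -/
theorem IsCan.unique {w w' : List ι} {f g : word y w ⟶ word y w'} (hf : IsCan y w w' f)
    (hg : IsCan y w w' g) (hw : w.Nodup) : f = g := by
  induction w generalizing w' with
  | nil =>
    have h := hf.perm.nil_eq
    rw [hf.eq_eqToHom_of_nil rfl h.symm, hg.eq_eqToHom_of_nil rfl h.symm]
  | cons i w ih =>
    -- In the source, `i` is already in front and its pull is an identity. So `f ≫ p` and `g ≫ p`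
    -- both come from canonical morphisms out of the product over `w`, which agree by induction.
    obtain ⟨l, p, hp⟩ := exists_isPull (y := y) (hf.perm.mem_iff.1 List.mem_cons_self)
    obtain ⟨f', hf', e⟩ := hf.exists_comp_pull hw (.here w) hp
    obtain ⟨g', hg', e'⟩ := hg.exists_comp_pull hw (.here w) hp
    have := hp.isIso
    rw [← cancel_mono p, e, e', ih hf' hg' (List.nodup_cons.1 hw).2]


/-- This and the next lemmas show that canonical morphisms are closed under the tensor product and
contain the associators, unitors and symmetries of whole products, after transport along
`wordAppend`. -/
theorem IsCan.append_left {l l' : List ι} {f : word y l ⟶ word y l'} (hf : IsCan y l l' f)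
    (m : List ι) : IsCan y (l ++ m) (l' ++ m)
      ((wordAppend y l m).hom ≫ f ▷ word y m ≫ (wordAppend y l' m).inv) := by
  induction hf with
  | id => simpa using .id _
  | comp _ _ ih ih' => simpa using ih.comp ih'
  | cons i _ ih => 
    convert! ih.cons i using 1
    simp [wordAppend]
  | swap i j l =>
    convert! IsCan.swap (y := y) i j (l ++ m) using 1
    have h : y i ◁ y j ◁ (wordAppend y l m).hom ≫ exch (y i) (y j) (word y l ⊗ word y m) ≫
        y j ◁ y i ◁ (wordAppend y l m).inv = exch (y i) (y j) (word y (l ++ m)) := by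
      rw [← reassoc_of% exch_natural, ← whiskerLeft_comp, ← whiskerLeft_comp, Iso.hom_inv_id,
        whiskerLeft_id, whiskerLeft_id, Category.comp_id]
    refine Eq.trans ?_ h
    simp [wordAppend, exch]

theorem IsCan.append_right (l : List ι) {m m' : List ι} {f : word y m ⟶ word y m'}
    (hf : IsCan y m m' f) : IsCan y (l ++ m) (l ++ m')
      ((wordAppend y l m).hom ≫ word y l ◁ f ≫ (wordAppend y l m').inv) := by
  induction l with
  | nil => simpa [wordAppend] using hf
  | cons i l ih =>
    convert! ih.cons i using 1
    simp [wordAppend]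

theorem IsCan.append_assoc (l m n : List ι) : IsCan y ((l ++ m) ++ n) (l ++ (m ++ n))
    ((wordAppend y (l ++ m) n).hom ≫ (wordAppend y l m).hom ▷ word y n ≫
      (α_ (word y l) (word y m) (word y n)).hom ≫ word y l ◁ (wordAppend y m n).inv ≫
      (wordAppend y l (m ++ n)).inv) := by
  induction l with
  | nil =>
    convert! IsCan.id (m ++ n) using 1
    simp [wordAppend]
  | cons i l ih =>
    convert! ih.cons i using 1
    simp [wordAppend]

theorem IsCan.append_nil (l : List ι) : IsCan y (l ++ []) l
    ((wordAppend y l []).hom ≫ (ρ_ (word y l)).hom) := by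
  induction l with
  | nil =>
    convert! IsCan.id [] using 1
    change ((λ_ (𝟙_ C)).inv) ≫ (ρ_ (𝟙_ C)).hom = 𝟙 _
    rw [← unitors_equal, Iso.inv_hom_id]
  | cons i l ih =>
    convert! ih.cons i using 1
    simp [wordAppend]

theorem IsCan.cons_append (i : ι) (l m : List ι) : IsCan y (i :: (l ++ m)) (l ++ i :: m)
    (y i ◁ (wordAppend y l m).hom ≫ exch (y i) (word y l) (word y m) ≫
      (wordAppend y l (i :: m)).inv) := by
  induction l with
  | nil =>
    convert! IsCan.id (i :: m) using 1
    simp [wordAppend, exch]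
  | cons j l ih =>
    convert! (IsCan.swap i j (l ++ m)).comp (ih.cons j) using 1
    rw [whiskerLeft_comp, reassoc_of% exch_natural]
    simp [wordAppend, exch]

/-- One factor at a time: the symmetry of `i :: l` with `m` is that of `l` with `m`, followed by
moving `i` through `m`. -/
theorem IsCan.append_comm (l m : List ι) : IsCan y (l ++ m) (m ++ l)
    ((wordAppend y l m).hom ≫ (β_ (word y l) (word y m)).hom ≫ (wordAppend y m l).inv) := by
  induction l with
  | nil =>
    obtain ⟨g, hg, h, h'⟩ := (IsCan.append_nil (y := y) m).exists_inv
    convert! hg using 1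
    rw [← cancel_mono ((wordAppend y m []).hom ≫ (ρ_ (word y m)).hom), h']
    simp [wordAppend]
  | cons i l ih =>
    convert! (ih.cons i).comp (IsCan.cons_append i m l) using 1
    simp [wordAppend, exch]

end Coherence

/-! ### Coherence for products bracketed to the left -/

section Presentations

variable {C : Type u} [Category.{v} C] [MonoidalCategory C] {ι : Type}

/-- An object with an isomorphism to the product of the objects `y i`, for `i` in a list. -/
structure Pres (y : ι → C) where
  X : C
  w : List ι
  a : X ≅ word y w

/-- The list of a product of objects that belong to lists. -/
def kword : {n : ℕ} → (Fin n → List ι) → List ι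
  | 0, _ => []
  | 1, w => w 0
  | _ + 2, w => kword (Fin.init w) ++ w (Fin.last _)

/-- The presentation of a product of presented objects. -/
def kbarIso {y : ι → C} : {n : ℕ} → {x : Fin n → C} → {w : Fin n → List ι} →
    (∀ i, x i ≅ word y (w i)) → (kbar x ≅ word y (kword w))
  | 0, _, _, _ => Iso.refl _
  | 1, _, _, a => a 0
  | _ + 2, x, w, a =>
    (kbarIso (x := Fin.init x) (w := Fin.init w) (fun s => a s.castSucc) ⊗ᵢ a (Fin.last _)) ≪≫
      (wordAppend y (kword (Fin.init w)) (w (Fin.last _))).symm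

variable {y : ι → C}

namespace Pres

/-- The unit object, with the empty list. -/
def unit : Pres y := ⟨𝟙_ C, [], Iso.refl _⟩

/-- The product of two presented objects. -/
def tensor (A B : Pres y) : Pres y :=
  ⟨A.X ⊗ B.X, A.w ++ B.w, (A.a ⊗ᵢ B.a) ≪≫ (wordAppend y A.w B.w).symm⟩

/-- The object `y i`, with the list that consists of `i`. -/
def leaf (y : ι → C) (i : ι) : Pres y := ⟨y i, [i], (ρ_ (y i)).symm⟩

/-- The product of a tuple of presented objects. -/
def kbar {n : ℕ} (A : Fin n → Pres y) : Pres y :=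
  ⟨_root_.kbar fun i => (A i).X, kword fun i => (A i).w, kbarIso fun i => (A i).a⟩

theorem kbar_congr {m n : ℕ} (h : m = n) {A : Fin m → Pres y} {B : Fin n → Pres y}
    (hA : A = B ∘ Fin.cast h) : kbar A = kbar B := by
  subst h hA
  rfl

variable [SymmetricCategory C]

/-- A morphism of presented objects is canonical if it corresponds to a canonical morphism of
products over lists. -/
def Covers (A B : Pres y) (f : A.X ⟶ B.X) : Prop := IsCan y A.w B.w (A.a.inv ≫ f ≫ B.a.hom)

/-- The form in which coherence is applied: an equation between structure isomorphisms needs only a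
presentation of both ends by distinct labels for which both sides are canonical. -/
theorem Covers.unique {A B : Pres y} {f g : A.X ⟶ B.X} (hf : Covers A B f) (hg : Covers A B g)
    (h : A.w.Nodup) : f = g := by
  simpa using IsCan.unique hf hg h

theorem covers_id (A : Pres y) : Covers A A (𝟙 _) := by
  simpa [Covers] using IsCan.id A.w

/-- An equality of objects alone would not suffice, as it could mix up labels of equal factors. -/
theorem covers_eqToHom {A B : Pres y} (h : A = B) (h' : A.X = B.X) : Covers A B (eqToHom h') := by
  subst h
  exact covers_id A

theorem Covers.comp {A B D : Pres y} {f : A.X ⟶ B.X} {g : B.X ⟶ D.X} (hf : Covers A B f)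
    (hg : Covers B D g) : Covers A D (f ≫ g) := by
  simpa [Covers] using IsCan.comp hf hg

theorem Covers.symm {A B : Pres y} {f : A.X ≅ B.X} (hf : Covers A B f.hom) :
    Covers B A f.inv := by
  obtain ⟨g, hg, h, -⟩ := IsCan.exists_inv hf
  have : g = B.a.inv ≫ f.inv ≫ A.a.hom := by
    have h' : A.a.hom ≫ (A.a.inv ≫ f.hom ≫ B.a.hom) ≫ g = A.a.hom := by rw [h, Category.comp_id]
    simpa using congrArg (fun k => B.a.inv ≫ f.inv ≫ k) h'
  rwa [this] at hg

theorem Covers.tensor {A B A' B' : Pres y} {f : A.X ⟶ B.X} {g : A'.X ⟶ B'.X}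
    (hf : Covers A B f) (hg : Covers A' B' g) :
    Covers (A.tensor A') (B.tensor B') (f ⊗ₘ g) := by
  have h : (A.tensor A').a.inv ≫ (f ⊗ₘ g) ≫ (B.tensor B').a.hom = (wordAppend y A.w A'.w).hom ≫
      ((A.a.inv ≫ f ≫ B.a.hom) ⊗ₘ (A'.a.inv ≫ g ≫ B'.a.hom)) ≫ (wordAppend y B.w B'.w).inv := by
    simp only [Pres.tensor, Iso.trans_inv, Iso.trans_hom, Iso.symm_hom, Iso.symm_inv,
      tensorIso_hom, tensorIso_inv, Category.assoc, tensorHom_comp_tensorHom_assoc]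
  have := (hf.append_left A'.w).comp (IsCan.append_right B.w hg)
  refine Eq.mpr (congrArg (IsCan y _ _) (h.trans ?_)) this
  simp [MonoidalCategory.tensorHom_def]
  rfl

theorem covers_associator (A B D : Pres y) :
    Covers ((A.tensor B).tensor D) (A.tensor (B.tensor D)) (α_ A.X B.X D.X).hom := by
  have := IsCan.append_assoc (y := y) A.w B.w D.w
  unfold Covers
  convert! this using 1
  simp only [Pres.tensor, Iso.trans_inv, Iso.trans_hom, Iso.symm_hom, Iso.symm_inv,
    tensorIso_hom, tensorIso_inv, Category.assoc]
  have h : (wordAppend y A.w B.w).hom ≫ (A.a.inv ⊗ₘ B.a.inv) ⊗ₘ D.a.inv =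
      (wordAppend y A.w B.w).hom ▷ _ ≫ ((A.a.inv ⊗ₘ B.a.inv) ⊗ₘ D.a.inv) := by
    rw [← tensorHom_id, tensorHom_comp_tensorHom, Category.id_comp]
  rw [h, Category.assoc, associator_naturality_assoc, tensorHom_comp_tensorHom_assoc,
    Iso.inv_hom_id, tensorHom_comp_tensorHom_assoc, Iso.inv_hom_id]
  simp

theorem covers_braiding (A B : Pres y) :
    Covers (A.tensor B) (B.tensor A) (β_ A.X B.X).hom := by
  have := IsCan.append_comm (y := y) A.w B.w
  simpa [Covers, Pres.tensor, MonoidalCategory.tensorHom_def] using this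

theorem covers_rightUnitor (A : Pres y) : Covers (A.tensor unit) A (ρ_ A.X).hom := by
  have := IsCan.append_nil (y := y) A.w
  simpa [Covers, Pres.tensor, MonoidalCategory.tensorHom_def, unit] using this

theorem covers_leftUnitor (A : Pres y) : Covers (unit.tensor A) A (λ_ A.X).hom := by
  have := IsCan.id (y := y) A.w
  simpa [Covers, Pres.tensor, MonoidalCategory.tensorHom_def, unit, wordAppend] using this

theorem covers_kmap {n : ℕ} {A B : Fin n → Pres y} {g : ∀ s, (A s).X ⟶ (B s).X}
    (h : ∀ s, Covers (A s) (B s) (g s)) : Covers (kbar A) (kbar B) (kmap g) := by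
  induction n with
  | zero => exact covers_id _
  | succ n ih =>
    cases n with
    | zero => exact h 0
    | succ n =>
      exact Covers.tensor (A := kbar (Fin.init A)) (B := kbar (Fin.init B)) (A' := A (Fin.last _))
        (B' := B (Fin.last _)) (ih fun s => h s.castSucc) (h (Fin.last _))

theorem covers_snocIso {n : ℕ} (A : Fin (n + 1) → Pres y) :
    Covers ((kbar (Fin.init A)).tensor (A (Fin.last n))) (kbar A)
      (snocIso fun i => (A i).X).hom := by
  cases n with
  | zero => exact covers_leftUnitor (A 0)
  | succ n => exact covers_id _

theorem covers_splitIso (q r : ℕ) (A : Fin (q + r) → Pres y) :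
    Covers (kbar A) ((kbar fun i => A (Fin.castAdd r i)).tensor (kbar fun i => A (Fin.natAdd q i)))
      (splitIso q r fun i => (A i).X).hom := by
  induction r with
  | zero => exact (covers_rightUnitor (kbar A)).symm
  | succ r ih =>
    refine (covers_snocIso (n := q + r) A).symm.comp ?_
    refine (Covers.tensor (ih (Fin.init (n := q + r) A)) (covers_id (A (Fin.last (q + r))))).comp ?_
    refine (covers_associator (kbar fun i => A (Fin.castAdd (r + 1) i))
      (kbar (Fin.init (n := r) fun i => A (Fin.natAdd q i))) (A (Fin.natAdd q (Fin.last r)))).comp ?_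
    exact (covers_id (kbar fun i => A (Fin.castAdd (r + 1) i))).tensor
      (covers_snocIso (n := r) fun i => A (Fin.natAdd q i))

/-- The transports in the definition of `blockIso` are absorbed by stating every identification as a
hypothesis that can be substituted. -/
theorem covers_splitIso_of_eq {q r : ℕ} {x : Fin (q + r) → C} {A : Fin (q + r) → Pres y}
    (h : x = fun i => (A i).X) {P Q R : Pres y} (hP : P = kbar A)
    (hQ : Q = kbar fun i => A (Fin.castAdd r i)) (hR : R = kbar fun i => A (Fin.natAdd q i))
    (e : P.X = _root_.kbar x)
    (e' : _root_.kbar (fun i => x (Fin.castAdd r i)) ⊗ _root_.kbar (fun i => x (Fin.natAdd q i)) =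
      Q.X ⊗ R.X) :
    Covers P (Q.tensor R) (eqToHom e ≫ (splitIso q r x).hom ≫ eqToHom e') := by
  subst h hP hQ hR
  exact (covers_id _).comp ((covers_splitIso q r A).comp (covers_id _))

theorem covers_blockIso {n : ℕ} {k : Fin n → ℕ} (A : ∀ s, Fin (k s) → Pres y) :
    Covers (kbar (concat A)) (kbar fun s => kbar (A s)) (blockIso fun s i => (A s i).X).hom := by
  induction n with
  | zero => exact covers_id _
  | succ n ih =>
    simp only [blockIso, Iso.trans_hom, eqToIso.hom]
    -- The splitting and the two transports around it are grouped into one factor.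
    rw [← Category.assoc (eqToHom _), ← Category.assoc _ (eqToHom _), Category.assoc (eqToHom _)]
    refine Covers.comp (B := (kbar (concat fun s : Fin n => A s.castSucc)).tensor
      (kbar (A (Fin.last n)))) ?_ (Covers.comp ((ih fun s => A s.castSucc).tensor (covers_id _))
      (covers_snocIso fun s => kbar (A s)))
    refine covers_splitIso_of_eq
      (A := Fin.append (concat fun s : Fin n => A s.castSucc) (A (Fin.last n)))
      (comp_append Pres.X (concat fun s : Fin n => A s.castSucc) (A (Fin.last n))).symm
      (kbar_congr _ (concat_succ A)) ?_ ?_ _ _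
    · simp only [Fin.append_left]
    · simp only [Fin.append_right]

theorem covers_pullIso {n : ℕ} (A : Fin (n + 1) → Pres y) (i : Fin (n + 1)) :
    Covers (kbar A) ((kbar fun j => A (i.succAbove j)).tensor (A i))
      (pullIso (fun i => (A i).X) i).hom := by
  induction n with
  | zero =>
    obtain rfl : i = 0 := Fin.fin_one_eq_zero i
    exact (covers_leftUnitor (A 0)).symm.comp (covers_id _)
  | succ n ih =>
    induction i using Fin.lastCases with
    | last =>
      simp only [pullIso, Fin.lastCases_last]
      have h : kbar A = (kbar fun j => A ((Fin.last (n + 1)).succAbove j)).tensor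
          (A (Fin.last (n + 1))) := by
        simp only [Fin.succAbove_last]
        rfl
      exact covers_eqToHom h (congrArg Pres.X h)
    | cast i =>
      simp only [pullIso, Fin.lastCases_castSucc]
      refine (Covers.tensor (ih (Fin.init A) i) (covers_id (A (Fin.last (n + 1))))).comp ?_
      refine (covers_associator (kbar fun j => A (i.succAbove j).castSucc) (A i.castSucc)
        (A (Fin.last (n + 1)))).comp ?_
      refine ((covers_id (kbar fun j => A (i.succAbove j).castSucc)).tensor
        (covers_braiding (A i.castSucc) (A (Fin.last (n + 1))))).comp ?_
      refine (covers_associator (kbar fun j => A (i.succAbove j).castSucc)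
        (A (Fin.last (n + 1))) (A i.castSucc)).symm.comp ?_
      refine Covers.tensor ?_ (covers_id _)
      have h : (kbar fun j => A (i.succAbove j).castSucc).tensor (A (Fin.last (n + 1))) =
          (kbar (Fin.init fun j => A (i.castSucc.succAbove j))).tensor
            (A (i.castSucc.succAbove (Fin.last n))) := by
        simp only [Fin.init_def, Fin.castSucc_succAbove_castSucc, castSucc_succAbove_last']
      exact Covers.comp (covers_eqToHom h (congrArg Pres.X h))
        (covers_snocIso (n := n) fun j => A (i.castSucc.succAbove j))

theorem covers_permIso {m n : ℕ} (e : Fin m ≃ Fin n) (A : Fin n → Pres y) :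
    Covers (kbar (A ∘ e)) (kbar A) (permIso e fun i => (A i).X).hom := by
  induction m generalizing n with
  | zero =>
    cases n with
    | zero => exact covers_eqToHom (congrArg kbar (Subsingleton.elim _ _)) rfl
    | succ n => exact (e.symm 0).elim0
  | succ m ih =>
    cases n with
    | zero => exact (e 0).elim0
    | succ n =>
      have h : kbar (Fin.init (A ∘ e)) = kbar ((fun j => A ((e (Fin.last m)).succAbove j)) ∘
          restrictEquiv e) :=
        congrArg kbar (funext fun j => congrArg A (succAbove_restrictEquiv e j).symm)
      refine (covers_snocIso (A ∘ e)).symm.comp ?_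
      exact Covers.comp (Covers.tensor (Covers.comp (covers_eqToHom h (congrArg Pres.X h))
        (ih (restrictEquiv e) fun j => A ((e (Fin.last m)).succAbove j))) (covers_id _))
        (covers_pullIso A (e (Fin.last m))).symm

end Pres

end Presentations

/-! ### Coherence for lax symmetric monoidal functors -/

section LaxPairs

open Functor.LaxMonoidal

variable {C D : Type u} [Category.{v} C] [MonoidalCategory C]
  [Category.{v} D] [MonoidalCategory D] {ι : Type}

section

variable (F : C ⥤ D) [F.LaxMonoidal] {y : ι → C} {z : ι → D} (θ : ∀ i, z i ⟶ F.obj (y i))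

/-- The structure map of a lax monoidal functor over a list, after morphisms on the factors. -/
def wordMap : ∀ w : List ι, word z w ⟶ F.obj (word y w)
  | [] => ε F
  | i :: l => (θ i ⊗ₘ wordMap l) ≫ μ F (y i) (word y l)

theorem tensorHom_associator_inv_μ {a b c : C} {a' b' c' : D} (f : a' ⟶ F.obj a)
    (g : b' ⟶ F.obj b) (h : c' ⟶ F.obj c) :
    (f ⊗ₘ ((g ⊗ₘ h) ≫ μ F b c)) ≫ μ F a (b ⊗ c) ≫ F.map (α_ a b c).inv =
      (α_ a' b' c').inv ≫ (((f ⊗ₘ g) ≫ μ F a b) ⊗ₘ h) ≫ μ F (a ⊗ b) c := by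
  have e : f ⊗ₘ ((g ⊗ₘ h) ≫ μ F b c) = (f ⊗ₘ (g ⊗ₘ h)) ≫ F.obj a ◁ μ F b c := by
    rw [← id_tensorHom, tensorHom_comp_tensorHom, Category.comp_id]
  have e' : ((f ⊗ₘ g) ≫ μ F a b) ⊗ₘ h = ((f ⊗ₘ g) ⊗ₘ h) ≫ μ F a b ▷ F.obj c := by
    rw [← tensorHom_id, tensorHom_comp_tensorHom, Category.comp_id]
  rw [e, e', Category.assoc, Category.assoc, ← associator_inv_naturality_assoc,
    associativity_inv]

theorem tensorHom_μ_map {a b a' b' : C} {c d : D} (f : c ⟶ F.obj a) (g : d ⟶ F.obj b)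
    (h : a ⟶ a') (k : b ⟶ b') :
    (f ⊗ₘ g) ≫ μ F a b ≫ F.map (h ⊗ₘ k) = ((f ≫ F.map h) ⊗ₘ (g ≫ F.map k)) ≫ μ F a' b' := by
  rw [← μ_natural, tensorHom_comp_tensorHom_assoc]

/-- Left unitality of `F` is the base case, and associativity of its structure map is the inductive
step. -/
theorem wordMap_append (l m : List ι) :
    (wordAppend z l m).hom ≫ (wordMap F θ l ⊗ₘ wordMap F θ m) ≫ μ F (word y l) (word y m) =
      wordMap F θ (l ++ m) ≫ F.map (wordAppend y l m).hom := by
  induction l with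
  | nil =>
    simp only [wordAppend, wordMap, Iso.symm_hom, List.nil_append]
    rw [← cancel_mono (F.map (λ_ (word y m)).hom), Category.assoc, Category.assoc, Category.assoc,
      ← F.map_comp, Iso.inv_hom_id, F.map_id, Category.comp_id, Iso.inv_comp_eq,
      MonoidalCategory.tensorHom_def', Category.assoc, ← left_unitality, leftUnitor_naturality]
  | cons i l ih =>
    have h : (wordMap F θ (i :: (l ++ m))) ≫ F.map (y i ◁ (wordAppend y l m).hom) =
        (θ i ⊗ₘ (wordMap F θ (l ++ m) ≫ F.map (wordAppend y l m).hom)) ≫ μ F _ _ := by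
      rw [wordMap, Category.assoc, ← μ_natural_right, ← id_tensorHom,
        tensorHom_comp_tensorHom_assoc, Category.comp_id]
    have hh : wordMap F θ (i :: l ++ m) ≫ F.map (wordAppend y (i :: l) m).hom =
      (wordMap F θ (i :: (l ++ m)) ≫ F.map (y i ◁ (wordAppend y l m).hom)) ≫
        F.map (α_ (y i) (word y l) (word y m)).inv := by
      simp [wordAppend]
    have e : θ i ⊗ₘ ((wordAppend z l m).hom ≫ (wordMap F θ l ⊗ₘ wordMap F θ m) ≫
        μ F (word y l) (word y m)) = z i ◁ (wordAppend z l m).hom ≫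
          (θ i ⊗ₘ ((wordMap F θ l ⊗ₘ wordMap F θ m) ≫ μ F (word y l) (word y m))) := by
      rw [← id_tensorHom, tensorHom_comp_tensorHom, Category.id_comp]
    rw [hh, h, ← ih, Category.assoc, e, Category.assoc, tensorHom_associator_inv_μ]
    simp only [wordAppend, wordMap, Iso.trans_hom, whiskerLeftIso_hom, Iso.symm_hom,
      Category.assoc]

end

variable [SymmetricCategory C] [SymmetricCategory D]
variable (F : C ⥤ D) [F.LaxBraided] {y : ι → C} {z : ι → D} (θ : ∀ i, z i ⟶ F.obj (y i))

theorem exch_map (a b c : C) : exch (F.obj a) (F.obj b) (F.obj c) ≫ F.obj b ◁ μ F a c ≫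
      μ F b (a ⊗ c) = F.obj a ◁ μ F b c ≫ μ F a (b ⊗ c) ≫ F.map (exch a b c) := by
  simp only [exch, F.map_comp, Category.assoc]
  rw [← associativity, associativity_inv_assoc, ← μ_natural_left_assoc, ← comp_whiskerRight_assoc,
    ← comp_whiskerRight_assoc, Functor.LaxBraided.braided]

theorem exch_wordMap (i j : ι) (w : List ι) :
    exch (z i) (z j) (word z w) ≫ wordMap F θ (j :: i :: w) =
      wordMap F θ (i :: j :: w) ≫ F.map (exch (y i) (y j) (word y w)) := by
  have e (i j : ι) : wordMap F θ (i :: j :: w) = (θ i ⊗ₘ (θ j ⊗ₘ wordMap F θ w)) ≫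
      F.obj (y i) ◁ μ F (y j) (word y w) ≫ μ F (y i) (y j ⊗ word y w) := by
    simp only [wordMap]
    rw [← id_tensorHom, tensorHom_comp_tensorHom_assoc, Category.comp_id]
  have h : exch (z i) (z j) (word z w) ≫ (θ j ⊗ₘ (θ i ⊗ₘ wordMap F θ w)) =
      (θ i ⊗ₘ (θ j ⊗ₘ wordMap F θ w)) ≫ exch _ _ _ := by
    simp only [exch, Category.assoc]
    rw [associator_inv_naturality_assoc, ← associator_naturality, ← tensorHom_id, ← tensorHom_id,
      tensorHom_comp_tensorHom_assoc, tensorHom_comp_tensorHom_assoc, Category.comp_id,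
      Category.id_comp, BraidedCategory.braiding_naturality]
  rw [e, e, Category.assoc, Category.assoc, ← exch_map, reassoc_of% h]

variable {F θ}

/-- The generators are lifted one by one; only the exchange uses that `F` is compatible with the
symmetries. -/
theorem IsCan.exists_lift {w w' : List ι} {f : word y w ⟶ word y w'} (hf : IsCan y w w' f) :
    ∃ g, IsCan z w w' g ∧ g ≫ wordMap F θ w' = wordMap F θ w ≫ F.map f := by
  induction hf with
  | id w => exact ⟨𝟙 _, .id w, by simp⟩
  | comp _ _ ih ih' =>
    obtain ⟨g, hg, h⟩ := ih
    obtain ⟨g', hg', h'⟩ := ih'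
    exact ⟨g ≫ g', hg.comp hg', by rw [Category.assoc, h', ← Category.assoc, h]; simp⟩
  | cons i hf ih =>
    obtain ⟨g, hg, h⟩ := ih
    refine ⟨z i ◁ g, hg.cons i, ?_⟩
    simp only [wordMap]
    rw [← id_tensorHom, tensorHom_comp_tensorHom_assoc, h, ← id_tensorHom, Category.assoc,
      tensorHom_μ_map]
    simp
  | swap i j w => exact ⟨_, .swap i j w, exch_wordMap F θ i j w⟩

/-- Some canonical lift of `f` makes the square commute, and for distinct labels `g` is equal to
that lift. -/
theorem IsCan.lift {w w' : List ι} {f : word y w ⟶ word y w'} {g : word z w ⟶ word z w'}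
    (hf : IsCan y w w' f) (hg : IsCan z w w' g) (h : w.Nodup) :
    g ≫ wordMap F θ w' = wordMap F θ w ≫ F.map f := by
  obtain ⟨g', hg', e⟩ := hf.exists_lift (F := F) (θ := θ)
  rwa [hg.unique hg' h]

variable (F θ)

/-- A presented object of `C` and a presented object of `D` with the same list, and a morphism
that corresponds to the structure map of the lax monoidal functor `F`. -/
structure PresPair where
  w : List ι
  X : C
  Z : D
  a : X ≅ word y w
  b : Z ≅ word z w
  h : Z ⟶ F.obj X
  comm : h ≫ F.map a.hom = b.hom ≫ wordMap F θ w

namespace PresPair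

variable {F θ}

/-- The presented object of the target category. -/
def src (A : PresPair F θ) : Pres z := ⟨A.Z, A.w, A.b⟩

/-- The presented object of the source category. -/
def tgt (A : PresPair F θ) : Pres y := ⟨A.X, A.w, A.a⟩

theorem natural {A B : PresPair F θ} {g : A.Z ⟶ B.Z} {f : A.X ⟶ B.X}
    (hg : Pres.Covers A.src B.src g) (hf : Pres.Covers A.tgt B.tgt f) (hw : A.w.Nodup) :
    g ≫ B.h = A.h ≫ F.map f := by
  have h := IsCan.lift (F := F) (θ := θ) hf hg hw
  have h' : A.b.hom ≫ (A.b.inv ≫ g ≫ B.b.hom) ≫ wordMap F θ B.w =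
      A.b.hom ≫ wordMap F θ A.w ≫ F.map (A.a.inv ≫ f ≫ B.a.hom) := congrArg (A.b.hom ≫ ·) h
  rw [← cancel_mono (F.map B.a.hom), Category.assoc, B.comm]
  simp only [Category.assoc, Iso.hom_inv_id_assoc] at h'
  rw [h', ← reassoc_of% A.comm]
  simp only [← F.map_comp, Category.assoc, Iso.hom_inv_id_assoc]

variable (F θ) in
/-- The pair of the objects `y i` and `z i`. -/
def leaf (i : ι) : PresPair F θ where
  w := [i]
  X := y i
  Z := z i
  a := (ρ_ (y i)).symm
  b := (ρ_ (z i)).symm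
  h := θ i
  comm := by
    simp only [wordMap, Iso.symm_hom]
    rw [← cancel_mono (F.map (ρ_ (y i)).hom), Category.assoc, Category.assoc, Category.assoc,
      ← F.map_comp, Iso.inv_hom_id, F.map_id, Category.comp_id, MonoidalCategory.tensorHom_def,
      Category.assoc, ← right_unitality, rightUnitor_naturality, Iso.inv_hom_id_assoc]

theorem tensor_comm {w w' : List ι} {X X' : C} {Z Z' : D} {a : X ≅ word y w}
    {a' : X' ≅ word y w'} {b : Z ≅ word z w} {b' : Z' ≅ word z w'} {h : Z ⟶ F.obj X}
    {h' : Z' ⟶ F.obj X'} (e : h ≫ F.map a.hom = b.hom ≫ wordMap F θ w)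
    (e' : h' ≫ F.map a'.hom = b'.hom ≫ wordMap F θ w') :
    ((h ⊗ₘ h') ≫ μ F X X') ≫ F.map ((a ⊗ᵢ a') ≪≫ (wordAppend y w w').symm).hom =
      ((b ⊗ᵢ b') ≪≫ (wordAppend z w w').symm).hom ≫ wordMap F θ (w ++ w') := by
  simp only [Iso.trans_hom, tensorIso_hom, Iso.symm_hom, F.map_comp, Category.assoc]
  have h₁ := (Iso.eq_inv_comp _).2 (wordMap_append F θ w w')
  have h₂ : (wordAppend z w w').inv ≫ wordMap F θ (w ++ w') =
      (wordMap F θ w ⊗ₘ wordMap F θ w') ≫ μ F (word y w) (word y w') ≫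
        F.map (wordAppend y w w').inv := by
    rw [← Category.assoc (wordMap F θ w ⊗ₘ _), h₁, Category.assoc, Category.assoc, ← F.map_comp, Iso.hom_inv_id, F.map_id, Category.comp_id]
  rw [h₂, reassoc_of% tensorHom_μ_map F h h' a.hom a'.hom, e, e', tensorHom_comp_tensorHom_assoc]

/-- The iterated structure map `xi` corresponds to `wordMap`, so products of pairs are again pairs.
-/
theorem kbar_comm {n : ℕ} (A : Fin n → PresPair F θ) :
    (kmap (fun i => (A i).h) ≫ xi F fun i => (A i).X) ≫ F.map (kbarIso fun i => (A i).a).hom =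
      (kbarIso fun i => (A i).b).hom ≫ wordMap F θ (kword fun i => (A i).w) := by
  induction n with
  | zero =>
    refine (congrArg (_ ≫ ·) (F.map_id _)).trans ((Category.comp_id _).trans ?_)
    rfl
  | succ n ih =>
    cases n with
    | zero => exact (congrArg (· ≫ _) (Category.comp_id _)).trans (A 0).comm
    | succ n =>
      refine Eq.trans (congrArg (· ≫ _) ?_) (tensor_comm (ih (Fin.init A)) (A (Fin.last _)).comm)
      refine Eq.trans (b := (kmap (fun i => (Fin.init A i).h) ⊗ₘ (A (Fin.last _)).h) ≫
        (xi F fun i => (Fin.init A i).X) ▷ F.obj (A (Fin.last _)).X ≫ μ F _ _) rfl ?_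
      rw [← tensorHom_id, tensorHom_comp_tensorHom_assoc, Category.comp_id]
      rfl

/-- The product of a tuple of pairs. -/
def kbar {n : ℕ} (A : Fin n → PresPair F θ) : PresPair F θ where
  w := kword fun i => (A i).w
  X := _root_.kbar fun i => (A i).X
  Z := _root_.kbar fun i => (A i).Z
  a := kbarIso fun i => (A i).a
  b := kbarIso fun i => (A i).b
  h := kmap (fun i => (A i).h) ≫ xi F fun i => (A i).X
  comm := kbar_comm A

end PresPair

end LaxPairs

/-! ### Distinctness of labels in iterated products -/

section Nodup

variable {ι : Type}

theorem mem_kword {n : ℕ} {w : Fin n → List ι} {i : ι} : i ∈ kword w ↔ ∃ s, i ∈ w s := by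
  induction n with
  | zero => simp [kword]
  | succ n ih =>
    cases n with
    | zero => simp [kword]
    | succ n => simp [kword, ih, Fin.exists_fin_succ', Fin.init]

theorem nodup_kword {n : ℕ} {w : Fin n → List ι} (h : ∀ s, (w s).Nodup)
    (h' : ∀ s t, ∀ i ∈ w s, i ∈ w t → s = t) : (kword w).Nodup := by
  induction n with
  | zero => simp [kword]
  | succ n ih =>
    cases n with
    | zero => exact h 0
    | succ n =>
      refine List.Nodup.append (ih (fun s => h _) fun s t i hs ht => ?_) (h _) ?_
      · simpa using h' _ _ i hs ht
      · intro i hi hl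
        obtain ⟨s, hs⟩ := mem_kword.1 hi
        exact absurd (h' _ _ i hs hl) (Fin.castSucc_lt_last s).ne

theorem nodup_kword_singleton {n : ℕ} {g : Fin n → ι} (hg : Function.Injective g) :
    (kword fun i => [g i]).Nodup :=
  nodup_kword (fun _ => List.nodup_singleton _) fun s t i hs ht =>
    hg ((List.mem_singleton.1 hs).symm.trans (List.mem_singleton.1 ht))

theorem nodup_kword_kword {n : ℕ} {k : Fin n → ℕ} {g : ∀ s, Fin (k s) → ι}
    (hg : Function.Injective fun p : Σ s, Fin (k s) => g p.1 p.2) :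
    (kword fun s => kword fun i => [g s i]).Nodup :=
  nodup_kword (fun s => nodup_kword_singleton fun i j h =>
      eq_of_heq (Sigma.mk.inj (hg (a₁ := ⟨s, i⟩) (a₂ := ⟨s, j⟩) h)).2) fun s t i hs ht => by
    obtain ⟨a, ha⟩ := mem_kword.1 hs
    obtain ⟨b, hb⟩ := mem_kword.1 ht
    exact congrArg Sigma.fst (hg (a₁ := ⟨s, a⟩) (a₂ := ⟨t, b⟩)
      ((List.mem_singleton.1 ha).symm.trans (List.mem_singleton.1 hb)))

end Nodup

theorem Pres.Covers.unique' {C : Type u} [Category.{v} C] [MonoidalCategory C]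
    [SymmetricCategory C] {ι : Type} {y : ι → C} {A B : Pres y} {f g : A.X ⟶ B.X}
    (hf : Pres.Covers A B f) (hg : Pres.Covers A B g) (h : B.w.Nodup) : f = g :=
  hf.unique hg ((IsCan.perm hf).nodup_iff.2 h)

/-! ### Functoriality of `kmap` and `xi` -/

section

variable {C : Type u} [Category.{v} C] [MonoidalCategory C]

theorem kmap_id {n : ℕ} (x : Fin n → C) : kmap (fun i => 𝟙 (x i)) = 𝟙 (kbar x) := by
  induction n with
  | zero => rfl
  | succ n ih =>
    cases n with
    | zero => rfl
    | succ n =>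
      exact (congrArg (· ⊗ₘ 𝟙 (x (Fin.last _))) (ih (Fin.init x))).trans (id_tensorHom_id _ _)

theorem kmap_comp {n : ℕ} {x y z : Fin n → C} (f : ∀ i, x i ⟶ y i) (g : ∀ i, y i ⟶ z i) :
    kmap (fun i => f i ≫ g i) = kmap f ≫ kmap g := by
  induction n with
  | zero => exact (Category.comp_id _).symm
  | succ n ih =>
    cases n with
    | zero => rfl
    | succ n =>
      exact (congrArg (· ⊗ₘ (f (Fin.last _) ≫ g (Fin.last _)))
        (ih (fun i => f i.castSucc) fun i => g i.castSucc)).trans (tensorHom_comp_tensorHom ..).symm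

theorem xi_id {n : ℕ} (x : Fin n → C) : xi (𝟭 C) x = 𝟙 (kbar x) := by
  induction n with
  | zero => rfl
  | succ n ih =>
    cases n with
    | zero => rfl
    | succ n =>
      refine (congrArg (fun f => f ▷ x (Fin.last _) ≫ _) (ih (Fin.init x))).trans ?_
      exact (Category.comp_id _).trans (id_whiskerRight _ _)

variable {D : Type u} [Category.{v} D] [MonoidalCategory D]

theorem xi_natural (F : C ⥤ D) [F.LaxMonoidal] {n : ℕ} {x y : Fin n → C} (g : ∀ i, x i ⟶ y i) :
    kmap (fun i => F.map (g i)) ≫ xi F y = xi F x ≫ F.map (kmap g) := by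
  induction n with
  | zero =>
    exact (Category.id_comp _).trans
      ((Category.comp_id _).symm.trans (congrArg (_ ≫ ·) (F.map_id _).symm))
  | succ n ih =>
    cases n with
    | zero => exact (Category.comp_id _).trans (Category.id_comp _).symm
    | succ n =>
      have h {a b : D} {c d : C} {c' d' : C} (f : a ⟶ b) (p : b ⟶ F.obj c) (p' : a ⟶ F.obj c')
          (f' : c' ⟶ c) (g : d' ⟶ d) (e : f ≫ p = p' ≫ F.map f') :
          (f ⊗ₘ F.map g) ≫ p ▷ F.obj d ≫ Functor.LaxMonoidal.μ F c d =
            (p' ▷ F.obj d' ≫ Functor.LaxMonoidal.μ F c' d') ≫ F.map (f' ⊗ₘ g) := by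
        rw [Category.assoc, ← Functor.LaxMonoidal.μ_natural, ← tensorHom_id, ← tensorHom_id,
          tensorHom_comp_tensorHom_assoc, tensorHom_comp_tensorHom_assoc, Category.id_comp,
          Category.comp_id, e]
      exact h _ _ _ _ _ (ih fun i : Fin (n + 1) => g i.castSucc)

theorem xi_comp {E : Type u} [Category.{v} E] [MonoidalCategory E] (F : C ⥤ D) [F.LaxMonoidal]
    (G : D ⥤ E) [G.LaxMonoidal] {n : ℕ} (x : Fin n → C) :
    xi (F ⋙ G) x = xi G (fun i => F.obj (x i)) ≫ G.map (xi F x) := by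
  induction n with
  | zero => rfl
  | succ n ih =>
    cases n with
    | zero => exact ((Category.id_comp _).trans (G.map_id _)).symm
    | succ n =>
      have h {a : E} {b : D} {c d : C} (f : a ⟶ G.obj b) (g : b ⟶ F.obj c) :
          (f ≫ G.map g) ▷ G.obj (F.obj d) ≫ Functor.LaxMonoidal.μ G (F.obj c) (F.obj d) ≫
            G.map (Functor.LaxMonoidal.μ F c d) =
          (f ▷ G.obj (F.obj d) ≫ Functor.LaxMonoidal.μ G b (F.obj d)) ≫
            G.map (g ▷ F.obj d ≫ Functor.LaxMonoidal.μ F c d) := by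
        rw [comp_whiskerRight, G.map_comp, Category.assoc, Category.assoc,
          Functor.LaxMonoidal.μ_natural_left_assoc]
      refine (congrArg (fun f => f ▷ G.obj (F.obj (x (Fin.last _))) ≫ _) (ih (Fin.init x))).trans ?_
      exact h _ _

end

/-! ### Naturality of the canonical isomorphisms -/

section

variable {C : Type u} [Category.{v} C] [MonoidalCategory C] [SymmetricCategory C]
variable {D : Type u} [Category.{v} D] [MonoidalCategory D] [SymmetricCategory D]

theorem blockIso_kmap_xi (F : C ⥤ D) [F.LaxBraided] {n : ℕ} {k : Fin n → ℕ}
    {y : ∀ s, Fin (k s) → C} {z : ∀ s, Fin (k s) → D} (θ : ∀ s i, z s i ⟶ F.obj (y s i)) :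
    (blockIso z).hom ≫ kmap (fun s => kmap (θ s) ≫ xi F (y s)) ≫ xi F (fun s => kbar (y s)) =
      (kmap (x := concat z) (y := fun i => F.obj (concat y i)) (fun i => θ _ _) ≫
        xi F (concat y)) ≫ F.map (blockIso y).hom := by
  -- Each factor is labelled by its pair of indices, so the labels are distinct whatever the objects
  -- are.
  let l (s) (i) := PresPair.leaf F (y := fun p : Σ s, Fin (k s) => y p.1 p.2)
    (z := fun p : Σ s, Fin (k s) => z p.1 p.2) (fun p => θ p.1 p.2) ⟨s, i⟩
  have hf := Pres.covers_blockIso fun s i => (l s i).tgt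
  refine PresPair.natural (A := PresPair.kbar (concat l))
    (B := PresPair.kbar fun s => PresPair.kbar (l s))
    (Pres.covers_blockIso fun s i => (l s i).src) hf ?_
  exact (IsCan.perm hf).nodup_iff.2 (nodup_kword_kword (ι := Σ s, Fin (k s))
    (g := fun s i => ⟨s, i⟩) fun _ _ h => h)

theorem permIso_kmap_xi (F : C ⥤ D) [F.LaxBraided] {m n : ℕ} (e : Fin m ≃ Fin n)
    {y : Fin n → C} {z : Fin n → D} (θ : ∀ i, z i ⟶ F.obj (y i)) :
    (permIso e z).hom ≫ kmap θ ≫ xi F y =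
      (kmap (x := z ∘ e) (y := fun i => F.obj ((y ∘ e) i)) (fun i => θ (e i)) ≫ xi F (y ∘ e)) ≫
        F.map (permIso e y).hom := by
  let l (i) := PresPair.leaf F θ i
  have hf := Pres.covers_permIso e fun i => (l i).tgt
  refine PresPair.natural (A := PresPair.kbar (l ∘ e)) (B := PresPair.kbar l)
    (Pres.covers_permIso e fun i => (l i).src) hf ?_
  exact (IsCan.perm hf).nodup_iff.2 (nodup_kword_singleton fun _ _ h => h)

/-- The case of the identity functor of the preceding compatibility: the morphisms `g` take the
place of `θ`, and the structure maps are identities. -/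
theorem blockIso_natural {n : ℕ} {k : Fin n → ℕ} {x y : ∀ s, Fin (k s) → C}
    (g : ∀ s i, x s i ⟶ y s i) :
    (blockIso x).hom ≫ kmap (fun s => kmap (g s)) =
      kmap (x := concat x) (y := concat y) (fun i => g _ _) ≫ (blockIso y).hom := by
  have h := blockIso_kmap_xi (𝟭 C) g
  simp only [xi_id] at h
  refine Eq.trans (congrArg (_ ≫ ·) ?_) (h.trans (congrArg (· ≫ _) (Category.comp_id _)))
  refine Eq.trans ?_ (Category.comp_id _).symm
  exact congrArg kmap (funext fun s => (Category.comp_id _).symm)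

theorem permIso_natural {m n : ℕ} (e : Fin m ≃ Fin n) {x y : Fin n → C} (g : ∀ i, x i ⟶ y i) :
    (permIso e x).hom ≫ kmap g =
      kmap (x := x ∘ e) (y := y ∘ e) (fun i => g (e i)) ≫ (permIso e y).hom := by
  have h := permIso_kmap_xi (𝟭 C) e g
  rw [xi_id, xi_id] at h
  exact (congrArg (_ ≫ ·) (Category.comp_id _).symm).trans
    (h.trans (congrArg (· ≫ _) (Category.comp_id _)))

end

/-! ### Coherence identities behind the multicategory axioms -/

section

variable {C : Type u} [Category.{v} C] [MonoidalCategory C] [SymmetricCategory C]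

open Pres

theorem permIso_refl {n : ℕ} (x : Fin n → C) : (permIso (Equiv.refl (Fin n)) x).hom = 𝟙 _ :=
  Covers.unique (A := kbar (leaf x)) (covers_permIso (Equiv.refl _) (leaf x)) (covers_id _)
    (nodup_kword_singleton fun _ _ h => h)

theorem permIso_trans {l m n : ℕ} (σ : Fin m ≃ Fin n) (τ : Fin l ≃ Fin m) (x : Fin n → C) :
    (permIso (τ.trans σ) x).hom = (permIso τ (x ∘ σ)).hom ≫ (permIso σ x).hom :=
  Covers.unique (A := kbar (leaf x ∘ (τ.trans σ))) (covers_permIso (τ.trans σ) (leaf x))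
    ((covers_permIso τ (leaf x ∘ σ)).comp (covers_permIso σ (leaf x)))
    (nodup_kword_singleton (τ.trans σ).injective)

theorem blockIso_oneBlock {n : ℕ} (x : Fin n → C) :
    (blockIso fun _ : Fin 1 => x).hom =
      eqToHom (congrArg _root_.kbar (concat_oneBlock x)) ≫ (permIso (oneBlockEquiv n) x).hom := by
  have h := congrArg Pres.kbar (concat_oneBlock (leaf x))
  exact Covers.unique' (A := kbar (concat fun _ : Fin 1 => leaf x)) (B := kbar (leaf x))
    (covers_blockIso fun _ : Fin 1 => leaf x)
    ((covers_eqToHom h (congrArg Pres.X h)).comp (covers_permIso (oneBlockEquiv n) (leaf x)))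
    (nodup_kword_singleton fun _ _ h => h)

theorem blockIso_units {n : ℕ} (x : Fin n → C) :
    (blockIso fun s (_ : Fin 1) => x s).hom = (permIso (unitsEquiv n) x).hom :=
  Covers.unique' (A := kbar (concat fun s (_ : Fin 1) => leaf x s)) (B := kbar (leaf x))
    (covers_blockIso fun s (_ : Fin 1) => leaf x s) (covers_permIso (unitsEquiv n) (leaf x))
    (nodup_kword_singleton fun _ _ h => h)

theorem permIso_blockPerm {m n : ℕ} (σ : Fin m ≃ Fin n) {k : Fin n → ℕ} (x : ∀ s, Fin (k s) → C)
    (h : concat (fun s => x (σ s)) = concat x ∘ blockPerm σ k) :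
    (blockIso fun s => x (σ s)).hom ≫ (permIso σ fun s => _root_.kbar (x s)).hom =
      eqToHom (congrArg _root_.kbar h) ≫ (permIso (blockPerm σ k) (concat x)).hom ≫
        (blockIso x).hom := by
  let l (s) (i) := leaf (fun p : Σ s, Fin (k s) => x p.1 p.2) ⟨s, i⟩
  have h : kbar (concat fun s => l (σ s)) = kbar (concat l ∘ blockPerm σ k) :=
    congrArg Pres.kbar (concat_flat _ (fun s => l (σ s)) l fun _ => rfl)
  exact Covers.unique' (A := kbar (concat fun s => l (σ s))) (B := kbar fun s => kbar (l s))
    ((covers_blockIso fun s => l (σ s)).comp (covers_permIso σ fun s => kbar (l s)))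
    ((covers_eqToHom h (congrArg Pres.X h)).comp
      ((covers_permIso (blockPerm σ k) (concat l)).comp (covers_blockIso l)))
    (nodup_kword_kword (ι := Σ s, Fin (k s)) (g := fun s i => ⟨s, i⟩) fun _ _ h => h)

theorem permIso_blockSum {n : ℕ} {k l : Fin n → ℕ} (τ : ∀ s, Fin (k s) ≃ Fin (l s))
    (x : ∀ s, Fin (l s) → C)
    (h : concat (fun s => x s ∘ τ s) = concat x ∘ blockSum τ) :
    (blockIso fun s => x s ∘ τ s).hom ≫ kmap (fun s => (permIso (τ s) (x s)).hom) =
      eqToHom (congrArg _root_.kbar h) ≫ (permIso (blockSum τ) (concat x)).hom ≫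
        (blockIso x).hom := by
  let L (s) (i) := leaf (fun p : Σ s, Fin (l s) => x p.1 p.2) ⟨s, i⟩
  have h : kbar (concat fun s => L s ∘ τ s) = kbar (concat L ∘ blockSum τ) :=
    congrArg Pres.kbar (concat_flat _ (fun s => L s ∘ τ s) L fun _ => rfl)
  exact Covers.unique' (A := kbar (concat fun s => L s ∘ τ s)) (B := kbar fun s => kbar (L s))
    ((covers_blockIso fun s => L s ∘ τ s).comp (covers_kmap fun s => covers_permIso (τ s) (L s)))
    ((covers_eqToHom h (congrArg Pres.X h)).comp
      ((covers_permIso (blockSum τ) (concat L)).comp (covers_blockIso L)))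
    (nodup_kword_kword (ι := Σ s, Fin (l s)) (g := fun s i => ⟨s, i⟩) fun _ _ h => h)

/-- Both ways to bracket a doubly indexed family are canonical for the labelling by index triples;
this carries associativity of composition in `U C`. -/
theorem blockIso_concat {n : ℕ} {j : Fin n → ℕ} {k : ∀ s, Fin (j s) → ℕ}
    (a : ∀ s t, Fin (k s t) → C) :
    (blockIso (k := concat k) fun _ => a _ _).hom ≫
        (blockIso fun s t => _root_.kbar (a s t)).hom =
      eqToHom (congrArg _root_.kbar (concat_concat a)) ≫
        (permIso (assocEquiv k) (concat fun s => concat (a s))).hom ≫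
        (blockIso fun s => concat (a s)).hom ≫ kmap (fun s => (blockIso (a s)).hom) := by
  let l (s t i) := leaf (fun p : Σ s t, Fin (k s t) => a p.1 p.2.1 p.2.2) ⟨s, t, i⟩
  have h := congrArg Pres.kbar (concat_concat l)
  exact Covers.unique' (A := kbar (concat (k := concat k) fun _ => l _ _))
    (B := kbar fun s => kbar fun t => kbar (l s t))
    ((covers_blockIso (k := concat k) fun _ => l _ _).comp
      (covers_blockIso fun s t => kbar (l s t)))
    ((covers_eqToHom h (congrArg Pres.X h)).comp
      ((covers_permIso (assocEquiv k) (concat fun s => concat (l s))).comp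
        ((covers_blockIso fun s => concat (l s)).comp
          (covers_kmap fun s => covers_blockIso (l s)))))
    (nodup_kword (fun s => nodup_kword_kword (g := fun t i => (⟨s, t, i⟩ : Σ s t, Fin (k s t)))
      fun p q e => by
        obtain ⟨_, _⟩ := p
        obtain ⟨_, _⟩ := q
        exact eq_of_heq (Sigma.mk.inj e).2) fun s t i hs ht => by
        obtain ⟨a, ha⟩ := mem_kword.1 hs
        obtain ⟨b, hb⟩ := mem_kword.1 ht
        obtain ⟨a', ha⟩ := mem_kword.1 ha
        obtain ⟨b', hb⟩ := mem_kword.1 hb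
        exact congrArg Sigma.fst
          ((List.mem_singleton.1 ha).symm.trans (List.mem_singleton.1 hb)))

end

/-! ### The multicategory `U C` and the multifunctor `UMap F` -/

section

variable {C : Type u} [Category.{v} C] [MonoidalCategory C] [SymmetricCategory C]

variable (C)

theorem U_isMulticategory : (U C).IsMulticategory where
  perm_refl {n x y} f := by
    -- The morphisms of `U C` are those of `C` only after unfolding; in this form rewriting with the
    -- lemmas on `C` applies.
    have main (x : Fin n → C) (y : C) (f : kbar x ⟶ y) :
        𝟙 _ ≫ (permIso (Equiv.refl (Fin n)) x).hom ≫ f = f := by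
      rw [permIso_refl, Category.id_comp]
      exact Category.id_comp f
    exact main x y f
  perm_perm {l m n x y} σ τ f := by
    have main (x : Fin n → C) (y : C) (f : kbar x ⟶ y) :
        𝟙 _ ≫ (permIso τ (x ∘ σ)).hom ≫ 𝟙 _ ≫ (permIso σ x).hom ≫ f =
          𝟙 _ ≫ (permIso (τ.trans σ) x).hom ≫ f := by
      rw [permIso_trans, Category.id_comp, Category.id_comp]
      exact ((Category.id_comp _).trans (Category.assoc _ _ _)).symm
    exact main x y f
  id_comp {n x y} f := by
    have main (x : Fin n → C) (y : C) (f : kbar x ⟶ y) :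
        (blockIso fun _ : Fin 1 => x).hom ≫ f ≫ 𝟙 y =
          eqToHom (congrArg kbar (concat_oneBlock x)) ≫ (permIso (oneBlockEquiv n) x).hom ≫ f := by
      rw [blockIso_oneBlock]
      exact (congrArg (_ ≫ ·) (Category.comp_id f)).trans (Category.assoc _ _ _)
    exact main x y f
  comp_id {n x y} f := by
    have main (x : Fin n → C) (y : C) (f : kbar x ⟶ y) :
        (blockIso fun s (_ : Fin 1) => x s).hom ≫ kmap (fun i => 𝟙 (x i)) ≫ f =
          𝟙 _ ≫ (permIso (unitsEquiv n) x).hom ≫ f := by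
      rw [blockIso_units]
      exact (congrArg (_ ≫ ·) ((congrArg (· ≫ f) (kmap_id x)).trans (Category.id_comp f))).trans
        (Category.id_comp _).symm
    exact main x y f
  assoc {n j k a b c d} f g h := by
    have main (a : ∀ s t, Fin (k s t) → C) (b : ∀ s, Fin (j s) → C) (c : Fin n → C) (d : C)
        (f : kbar c ⟶ d) (g : ∀ s, kbar (b s) ⟶ c s) (h : ∀ s t, kbar (a s t) ⟶ b s t) :
        (blockIso (k := concat k) fun _ => a _ _).hom ≫
          kmap (x := concat fun s t => kbar (a s t)) (y := concat b) (fun i => h _ _) ≫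
            (blockIso b).hom ≫ kmap g ≫ f =
        eqToHom (congrArg kbar (concat_concat a)) ≫
          (permIso (assocEquiv k) (concat fun s => concat (a s))).hom ≫
          (blockIso fun s => concat (a s)).hom ≫
          kmap (fun s => (blockIso (a s)).hom ≫ kmap (h s) ≫ g s) ≫ f := by
      rw [kmap_comp, kmap_comp]
      -- Naturality moves the innermost morphisms `h` past the block isomorphism of `b`; then only
      -- canonical isomorphisms differ.
      have e₀ := congrArg (· ≫ kmap g ≫ f) (blockIso_natural h)
      have e := congrArg (· ≫ kmap (fun s => kmap (h s)) ≫ kmap g ≫ f) (blockIso_concat a)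
      simp only [Category.assoc] at e₀ e ⊢
      exact (congrArg (_ ≫ ·) e₀.symm).trans ((Category.assoc _ _ _).symm.trans e)
    exact main a b c d f g h
  perm_comp {m n k x y z} σ f g := by
    have main (x : ∀ s, Fin (k s) → C) (y : Fin n → C) (z : C) (f : kbar y ⟶ z)
        (g : ∀ s, kbar (x s) ⟶ y s) :
        (blockIso fun s => x (σ s)).hom ≫ kmap (y := y ∘ σ) (fun s => g (σ s)) ≫ 𝟙 _ ≫
          (permIso σ y).hom ≫ f =
        eqToHom (congrArg kbar (concat_flat _ _ _ fun _ => rfl)) ≫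
          (permIso (blockPerm σ k) (concat x)).hom ≫ (blockIso x).hom ≫ kmap g ≫ f := by
      rw [Category.id_comp]
      have e := congrArg (· ≫ f) (permIso_natural σ g)
      have e' := congrArg (· ≫ kmap g ≫ f)
        (permIso_blockPerm σ x (concat_flat _ _ _ fun _ => rfl))
      simp only [Category.assoc] at e e' ⊢
      exact (congrArg (_ ≫ ·) e.symm).trans e'
    exact main x y z f g
  comp_perm {n k l x y z} τ f g := by
    have main (x : ∀ s, Fin (l s) → C) (y : Fin n → C) (z : C) (f : kbar y ⟶ z)
        (g : ∀ s, kbar (x s) ⟶ y s) :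
        (blockIso fun s => x s ∘ τ s).hom ≫
          kmap (fun s => 𝟙 _ ≫ (permIso (τ s) (x s)).hom ≫ g s) ≫ f =
        eqToHom (congrArg kbar (concat_flat _ _ _ fun _ => rfl)) ≫
          (permIso (blockSum τ) (concat x)).hom ≫ (blockIso x).hom ≫ kmap g ≫ f := by
      simp only [Category.id_comp]
      rw [kmap_comp]
      have e' := congrArg (· ≫ kmap g ≫ f)
        (permIso_blockSum τ x (concat_flat _ _ _ fun _ => rfl))
      simp only [Category.assoc] at e' ⊢
      exact e'
    exact main x y z f g

variable {C} {D : Type u} [Category.{v} D] [MonoidalCategory D] [SymmetricCategory D]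

theorem UMap_isMultifunctor (F : C ⥤ D) [F.LaxBraided] : (UMap F).IsMultifunctor where
  map_id a := (Category.id_comp _).trans (F.map_id _)
  map_comp {n k x y z} f g := by
    have main (x : ∀ s, Fin (k s) → C) (y : Fin n → C) (z : C) (f : kbar y ⟶ z)
        (g : ∀ s, kbar (x s) ⟶ y s) :
        xi F (concat x) ≫ F.map ((blockIso x).hom ≫ kmap g ≫ f) =
          (blockIso fun s i => F.obj (x s i)).hom ≫ kmap (fun s => xi F (x s) ≫ F.map (g s)) ≫
            xi F y ≫ F.map f := by
      -- With identities as the morphisms on the factors, the square involves only `xi` and the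
      -- block isomorphisms.
      have e := blockIso_kmap_xi F (y := x) fun s i => 𝟙 (F.obj (x s i))
      simp only [kmap_id, Category.id_comp] at e
      have e₂ := e.trans (congrArg (· ≫ _) ((congrArg (· ≫ _) (kmap_id _)).trans
        (Category.id_comp _)))
      have e₃ := congrArg (· ≫ F.map (kmap g) ≫ F.map f) e₂
      have e₄ := congrArg (· ≫ F.map f) (xi_natural F g)
      rw [kmap_comp, F.map_comp, F.map_comp]
      simp only [Category.assoc] at e₃ e₄ ⊢
      exact (Category.assoc _ _ _).symm.trans (e₃.symm.trans (congrArg (fun t => _ ≫ _ ≫ t) e₄.symm))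
    exact main x y z f g
  map_perm {m n x y} σ f := by
    have main (x : Fin n → C) (y : C) (f : kbar x ⟶ y) :
        xi F (x ∘ σ) ≫ F.map (𝟙 _ ≫ (permIso σ x).hom ≫ f) =
          𝟙 _ ≫ (permIso σ fun i => F.obj (x i)).hom ≫ xi F x ≫ F.map f := by
      have e := permIso_kmap_xi F σ (y := x) fun i => 𝟙 (F.obj (x i))
      have e₂ := ((congrArg (_ ≫ ·) ((congrArg (· ≫ _) (kmap_id _)).trans
        (Category.id_comp _))).symm.trans e).trans (congrArg (· ≫ _) ((congrArg (· ≫ _)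
          (kmap_id _)).trans (Category.id_comp _)))
      have e₃ := congrArg (· ≫ F.map f) e₂
      simp only [Category.assoc] at e₃
      rw [Category.id_comp, F.map_comp]
      exact e₃.symm.trans (Category.id_comp _).symm
    exact main x y f

theorem UMap_id : UMap (𝟭 C) = MultifunctorData.id (U C) := by
  unfold UMap MultifunctorData.id
  congr
  funext n x y f
  exact (congrArg (· ≫ _) (xi_id (C := C) x)).trans (Category.id_comp _)

theorem UMap_comp {E : Type u} [Category.{v} E] [MonoidalCategory E] [SymmetricCategory E]
    (F : C ⥤ D) [F.LaxBraided] (G : D ⥤ E) [G.LaxBraided] :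
    UMap (F ⋙ G) = (UMap F).comp (UMap G) := by
  unfold UMap MultifunctorData.comp
  congr
  funext n x y f
  refine (congrArg (· ≫ _) (xi_comp (C := C) F G x)).trans ?_
  refine Eq.trans ?_ (congrArg (_ ≫ ·) (G.map_comp _ _).symm)
  exact Category.assoc _ _ _

end

/-! ### Sorting by fibres -/

section

variable {C : Type u} [Category.{v} C] [MonoidalCategory C] [SymmetricCategory C]

namespace Pres

variable {ι : Type} {y : ι → C}

theorem covers_permIso_of_eq {m n : ℕ} (e : Fin m ≃ Fin n) {A' : Fin m → Pres y}
    {A : Fin n → Pres y} (hA : A' = A ∘ e) (h : (fun i => (A' i).X) = (fun i => (A i).X) ∘ e) :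
    Covers (kbar A') (kbar A)
      (eqToHom (congrArg _root_.kbar h) ≫ (permIso e fun i => (A i).X).hom) := by
  subst hA
  exact (covers_id _).comp (covers_permIso e A)

theorem covers_gatherIso {m n : ℕ} (f : Fin m → Fin n) (A : Fin m → Pres y) :
    Covers (kbar A) (kbar fun s => kbar (A ∘ fib f s)) (gatherIso f fun i => (A i).X).hom :=
  (covers_permIso (fibSigma f) A).symm.comp (covers_blockIso fun s => A ∘ fib f s)

end Pres

open Pres

theorem gatherIso_natural {m n : ℕ} (f : Fin m → Fin n) {x y : Fin m → C} (g : ∀ i, x i ⟶ y i) :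
    (gatherIso f x).hom ≫ kmap (fun s => kmap (x := x ∘ fib f s) (y := y ∘ fib f s)
      fun i => g (fib f s i)) = kmap g ≫ (gatherIso f y).hom := by
  have e := permIso_natural (fibSigma f) g
  rw [← Iso.eq_inv_comp, ← Category.assoc, ← Iso.comp_inv_eq] at e
  have e' := blockIso_natural (x := fun s => x ∘ fib f s) (y := fun s => y ∘ fib f s)
    fun s i => g (fib f s i)
  have e₂ := congrArg (· ≫ (blockIso fun s => y ∘ fib f s).hom) e
  refine (Category.assoc _ _ _).trans ((congrArg (_ ≫ ·) e').trans ?_)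
  refine (Category.assoc _ _ _).symm.trans (e₂.symm.trans (Category.assoc _ _ _))

/-- The bijections `e` are arbitrary, so the ones in the definition of `LHom.ofEquiv` fit without
being unfolded. -/
theorem gatherIso_id {n : ℕ} (x : Fin n → C) (e : ∀ s, Fin (fibCard id s) ≃ Fin 1)
    (h : ∀ s, x ∘ fib id s = (fun _ : Fin 1 => x s) ∘ e s) :
    (gatherIso id x).hom ≫ kmap (fun s => eqToHom (congrArg _root_.kbar (h s)) ≫
      (permIso (e s) fun _ : Fin 1 => x s).hom) = 𝟙 _ :=
  Covers.unique (A := kbar (leaf x)) (B := kbar (leaf x))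
    ((covers_gatherIso id (leaf x)).comp
      (covers_kmap fun s => covers_permIso_of_eq (e s) (A := fun _ : Fin 1 => leaf x s)
        (by funext i; exact congrArg (leaf x) (apply_fib id s i)) (h s)))
    (covers_id _) (nodup_kword_singleton fun _ _ h => h)

/-- Sorting by `g ∘ f` and then by `f` within each fibre puts the factors in the same nested product
as sorting by `f` and then the blocks by `g`; each factor keeps its label. -/
theorem gatherIso_comp {m n p : ℕ} (f : Fin m → Fin n) (g : Fin n → Fin p) (x : Fin m → C)
    (h : ∀ t, x ∘ fib (g ∘ f) t = concat (fun i => x ∘ fib f (fib g t i)) ∘ fibComp f g t) :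
    (gatherIso (g ∘ f) x).hom ≫ kmap (fun t => (eqToHom (congrArg _root_.kbar (h t)) ≫
      (permIso (fibComp f g t) (concat fun i => x ∘ fib f (fib g t i))).hom) ≫
        (blockIso fun i => x ∘ fib f (fib g t i)).hom) =
    (gatherIso f x).hom ≫ (gatherIso g fun s => _root_.kbar (x ∘ fib f s)).hom :=
  Covers.unique (A := kbar (leaf x))
    (B := kbar fun t => kbar fun i => kbar (leaf x ∘ fib f (fib g t i)))
    ((covers_gatherIso (g ∘ f) (leaf x)).comp
      (covers_kmap fun t => (covers_permIso_of_eq (fibComp f g t)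
        (A := concat fun i => leaf x ∘ fib f (fib g t i))
        (by funext i; exact congrArg (leaf x) (fib_fibComp f g t i)) (h t)).comp
          (covers_blockIso fun i => leaf x ∘ fib f (fib g t i))))
    ((covers_gatherIso f (leaf x)).comp (covers_gatherIso g fun s => kbar (leaf x ∘ fib f s)))
    (nodup_kword_singleton fun _ _ h => h)

theorem gatherIso_const {n : ℕ} (f : Fin n → Fin 1) (x : Fin n → C)
    (e : ∀ s, Fin (fibCard f s) ≃ Fin n) (h : ∀ s, fib f s = e s) :
    (gatherIso f x).hom ≫ eqToHom (congrArg (fun g => _root_.kbar (x ∘ g)) (h 0)) ≫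
      (permIso (e 0) x).hom = 𝟙 _ := by
  have hh : kbar (leaf x ∘ fib f 0) = kbar (leaf x ∘ e 0) := by rw [h 0]
  exact Covers.unique (A := kbar (leaf x)) (B := kbar (leaf x))
    ((covers_gatherIso f (leaf x)).comp ((covers_eqToHom (A := kbar (leaf x ∘ fib f 0)) hh
      (congrArg Pres.X hh)).comp (covers_permIso (e 0) (leaf x))))
    (covers_id _) (nodup_kword_singleton fun _ _ h => h)

end

/-! ### The counit, the unit and the natural map `nu` -/

section

variable (C : Type u) [Category.{v} C] [MonoidalCategory C] [SymmetricCategory C]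

theorem counit_isFunctor : (counit C).IsFunctor where
  map_id x := by
    have main (x : Σ n, Fin n → C) (e : ∀ s, Fin (fibCard id s) ≃ Fin 1)
        (h : ∀ s, x.2 ∘ fib id s = (fun _ : Fin 1 => x.2 s) ∘ e s) :
        (gatherIso id x.2).hom ≫ kmap (fun s => eqToHom (congrArg kbar (h s)) ≫
          (permIso (e s) fun _ : Fin 1 => x.2 s).hom ≫ 𝟙 (x.2 s)) = 𝟙 _ := by
      refine Eq.trans ?_ (gatherIso_id x.2 e h)
      exact congrArg (_ ≫ ·) (congrArg kmap (funext fun s =>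
        congrArg (_ ≫ ·) (Category.comp_id _)))
    exact main x _ fun s => funext fun i => congrArg x.2 (apply_fib id s i)
  map_comp {x y z} F G := by
    have main (x y z : Σ n, Fin n → C) (f : Fin x.1 → Fin y.1) (g : Fin y.1 → Fin z.1)
        (φ : ∀ s, kbar (x.2 ∘ fib f s) ⟶ y.2 s) (ψ : ∀ s, kbar (y.2 ∘ fib g s) ⟶ z.2 s)
        (h : ∀ t, x.2 ∘ fib (g ∘ f) t =
          concat (fun i => x.2 ∘ fib f (fib g t i)) ∘ fibComp f g t) :
        (gatherIso (g ∘ f) x.2).hom ≫ kmap (fun t => eqToHom (congrArg kbar (h t)) ≫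
          (permIso (fibComp f g t) (concat fun i => x.2 ∘ fib f (fib g t i))).hom ≫
          (blockIso fun i => x.2 ∘ fib f (fib g t i)).hom ≫
          kmap (y := y.2 ∘ fib g t) (fun i => φ (fib g t i)) ≫ ψ t) =
        ((gatherIso f x.2).hom ≫ kmap φ) ≫ (gatherIso g y.2).hom ≫ kmap ψ := by
      have e₁ := congrArg (· ≫ kmap (fun t => kmap (y := y.2 ∘ fib g t)
        (fun i => φ (fib g t i))) ≫ kmap ψ) (gatherIso_comp f g x.2 h)
      -- The first family `φ` is moved past the second sorting, so that `gatherIso_comp` can merge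
      -- the two sortings.
      have e₂ := congrArg (· ≫ kmap ψ) (gatherIso_natural g φ)
      refine Eq.trans ?_ (e₁.trans ?_)
      · rw [← kmap_comp]
        refine Eq.trans ?_ (Category.assoc _ _ _).symm
        rw [← kmap_comp]
        simp only [Category.assoc]
      · simp only [Category.assoc] at e₂ ⊢
        exact congrArg (_ ≫ ·) e₂
    exact main x y z F.f G.f F.φ G.φ fun t => funext fun a => congrArg x.2 (fib_fibComp F.f G.f t a)

variable {C}

theorem counit_map_single {x : Σ n, Fin n → C} {y : C} (φ : kbar x.2 ⟶ y) :
    (counit C).map (LHom.single (M := U C) (x := x) (y := y) φ) = φ := by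
  have main (f : Fin x.1 → Fin 1) (e : ∀ s, Fin (fibCard f s) ≃ Fin x.1)
      (h : ∀ s, fib f s = e s) :
      (gatherIso f x.2).hom ≫ eqToHom (congrArg (fun g => kbar (x.2 ∘ g)) (h 0)) ≫
        (permIso (e 0) x.2).hom ≫ φ = φ := by
    have e := congrArg (· ≫ φ) (gatherIso_const f x.2 e h)
    simp only [Category.assoc, Category.id_comp] at e
    exact e
  exact main (fun _ => 0) (fun s => (fibEquiv _ s).trans
    (Equiv.subtypeUnivEquiv fun _ => Subsingleton.elim _ _)) fun s => rfl

/-- There is only one function into a single index, and the sorting isomorphism cancels, so the one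
remaining multimorphism is determined. -/
theorem counit_map_injective {x : Σ n, Fin n → C} {y : C}
    {F G : LHom (U C) x ⟨1, fun _ => y⟩} (h : (counit C).map F = (counit C).map G) : F = G := by
  obtain ⟨f, φ⟩ := F
  obtain ⟨g, ψ⟩ := G
  obtain rfl : f = g := funext fun _ => Subsingleton.elim _ _
  have h' : φ 0 = ψ 0 := (cancel_epi (gatherIso f x.2).hom).1 h
  congr
  funext s
  obtain rfl : s = 0 := Subsingleton.elim _ _
  exact h'

variable (C)

theorem unitFunctor_isFunctor : (unitFunctor C).IsFunctor where
  map_id a := counit_map_injective (C := C) <| by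
    refine (counit_map_single (C := C) (x := ⟨1, fun _ => a⟩) ((CatData.of C).id a)).trans ?_
    exact ((counit_isFunctor C).map_id ⟨1, fun _ => a⟩).symm
  map_comp {a b c} f g := counit_map_injective (C := C) <| by
    refine (counit_map_single (C := C) (x := ⟨1, fun _ => a⟩) ((CatData.of C).comp f g)).trans ?_
    refine Eq.trans ?_ ((counit_isFunctor C).map_comp _ _).symm
    exact (congrArg₂ (CatData.of C).comp
      (counit_map_single (C := C) (x := ⟨1, fun _ => a⟩) f)
      (counit_map_single (C := C) (x := ⟨1, fun _ => b⟩) g)).symm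

theorem unitFunctor_comp_counit :
    (unitFunctor C).comp (counit C) = FunctorData.id (CatData.of C) := by
  unfold FunctorData.comp FunctorData.id
  congr
  funext a b f
  exact counit_map_single (C := C) (x := ⟨1, fun _ => a⟩) f

/-- Both sides end in a tuple of length one and can be compared under the counit, which turns both
maps `nu` into identities. -/
theorem nu_natural (x y : (L (U C)).Ob) (F : (L (U C)).Hom x y) :
    (L (U C)).comp F (nu C y) = (L (U C)).comp (nu C x) ((unitFunctor C).map ((counit C).map F)) :=
  counit_map_injective (C := C) <| by
    refine ((counit_isFunctor C).map_comp _ _).trans ?_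
    refine Eq.trans ?_ ((counit_isFunctor C).map_comp _ _).symm
    have main {a b : C} {f p : a ⟶ b} {i : b ⟶ b} {j : a ⟶ a} (hi : i = 𝟙 b) (hj : j = 𝟙 a)
        (h : p = f) : f ≫ i = j ≫ p := by
      rw [hi, hj, h, Category.comp_id, Category.id_comp]
    exact main (counit_map_single (C := C) (x := y) _) (counit_map_single (C := C) (x := x) _)
      (counit_map_single (C := C) (x := ⟨1, fun _ => kbar (C := C) x.2⟩) _)

end

/-! ### Points and maps of geometric realizations -/

section Realization

open Opposite Simplicial

universe w

/-- The characteristic map of a simplex in the geometric realization. -/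
noncomputable def charMap (Y : SSet.{w}) {n : ℕ} (σ : Y.obj (op ⦋n⦌)) :
    C(stdSimplex ℝ (Fin (n + 1)), SSet.toTop.obj Y) :=
  TopCat.toSSetObjEquiv _ _ ((sSetTopAdj.unit.app Y).app (op ⦋n⦌) σ)

theorem toTop_map_charMap {X Y : SSet.{w}} (f : X ⟶ Y) {n : ℕ} (σ : X.obj (op ⦋n⦌))
    (t : stdSimplex ℝ (Fin (n + 1))) :
    SSet.toTop.map f (charMap X σ t) = charMap Y (f.app _ σ) t :=
  (congrArg (fun g => TopCat.toSSetObjEquiv _ _ (g.app (op ⦋n⦌) σ) t)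
    (sSetTopAdj.unit.naturality f)).symm

theorem charMap_map {Y : SSet.{w}} {m n : ℕ} (φ : ⦋m⦌ ⟶ ⦋n⦌) (σ : Y.obj (op ⦋n⦌))
    (t : stdSimplex ℝ (Fin (m + 1))) :
    charMap Y (Y.map φ.op σ) t = charMap Y σ (stdSimplex.map φ.toOrderHom t) := by
  have h := congrArg (fun g => TopCat.toSSetObjEquiv _ _ (g σ) t)
    ((sSetTopAdj.unit.app Y).naturality φ.op)
  exact h

/-- Under the adjunction with singular simplicial sets, a map is determined by the singular
simplices it assigns to simplices of `X`. -/
theorem toTop_hom_ext {X : SSet.{w}} {Z : TopCat.{w}} {f g : SSet.toTop.obj X ⟶ Z}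
    (h : ∀ n (σ : X.obj (op ⦋n⦌)) t, f (charMap X σ t) = g (charMap X σ t)) : f = g := by
  apply (sSetTopAdj.homEquiv X Z).injective
  ext ⟨⟨n⟩⟩ σ
  apply (TopCat.toSSetObjEquiv _ _).injective
  ext t
  simp only [Adjunction.homEquiv_unit]
  exact h n σ t

/-- The compatible family is a simplicial map into the singular set of `Z`, and its adjoint is the
required map. -/
theorem exists_toTop_hom {X : SSet.{w}} {Z : TopCat.{w}}
    (g : ∀ n, X.obj (op ⦋n⦌) → C(stdSimplex ℝ (Fin (n + 1)), Z))
    (hg : ∀ m n (φ : ⦋m⦌ ⟶ ⦋n⦌) (σ : X.obj (op ⦋n⦌)) t,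
      g m (X.map φ.op σ) t = g n σ (stdSimplex.map φ.toOrderHom t)) :
    ∃ f : SSet.toTop.obj X ⟶ Z, ∀ n (σ : X.obj (op ⦋n⦌)) t, f (charMap X σ t) = g n σ t := by
  let G : X ⟶ TopCat.toSSet.obj Z :=
    { app := fun n => ↾fun σ => (TopCat.toSSetObjEquiv Z n).symm (g n.unop.len σ)
      naturality := fun n m φ => by
        ext σ
        apply (TopCat.toSSetObjEquiv _ _).injective
        ext t
        exact (congrArg (fun f => f t) ((TopCat.toSSetObjEquiv Z m).apply_symm_apply _)).trans
          (hg _ _ φ.unop σ t) }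
  refine ⟨(sSetTopAdj.homEquiv X Z).symm G, fun n σ t => ?_⟩
  have h := congrArg (fun F => TopCat.toSSetObjEquiv _ _ (F.app (op ⦋n⦌) σ) t)
    ((sSetTopAdj.homEquiv X Z).apply_symm_apply G)
  rw [Adjunction.homEquiv_unit] at h
  exact h

/-- A family of simplices of `Y` that is indexed by the chains of a partially ordered set. -/
structure ChainFamily (P : Type) [PartialOrder P] (Y : SSet.{w}) where
  simplex : ∀ {a : ℕ}, (Fin (a + 1) →o P) → Y.obj (op ⦋a⦌)
  simplex_comp : ∀ {a b : ℕ} (c : Fin (a + 1) →o P) (ψ : Fin (b + 1) →o Fin (a + 1)),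
    simplex (c.comp ψ) = Y.map (SimplexCategory.mkHom ψ).op (simplex c)

namespace ChainFamily

variable {P : Type} [PartialOrder P] {Y : SSet.{w}} (S : ChainFamily P Y)

/-- The point of the realization with given barycentric coordinates in the simplex of a chain. -/
noncomputable def point {a : ℕ} (c : Fin (a + 1) →o P) :
    C(stdSimplex ℝ (Fin (a + 1)), SSet.toTop.obj Y) := charMap Y (S.simplex c)

theorem point_comp {a b : ℕ} (c : Fin (a + 1) →o P) (ψ : Fin (b + 1) →o Fin (a + 1))
    (t : stdSimplex ℝ (Fin (b + 1))) :
    S.point (c.comp ψ) t = S.point c (stdSimplex.map ψ t) := by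
  unfold point
  rw [S.simplex_comp, charMap_map]
  rfl

variable [Fintype P]

theorem exists_map_eq {A B : Type} [Fintype A] [Fintype B] {f : A → B} (hf : Function.Injective f)
    (m : stdSimplex ℝ B) (hm : ∀ b, b ∉ Set.range f → m b = 0) :
    ∃ w : stdSimplex ℝ A, stdSimplex.map f w = m ∧ ∀ k, w k = m (f k) := by
  classical
  have h : ∑ k, m (f k) = 1 := by
    rw [← stdSimplex.sum_eq_one m]
    exact Finset.sum_of_injOn f hf.injOn (by simp) (by simpa using hm) (by simp)
  refine ⟨⟨fun k => m (f k), fun k => m.2.1 _, h⟩, ?_, fun k => rfl⟩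
  ext b
  rw [stdSimplex.map_coe, FunOnFinite.linearMap_apply_apply]
  by_cases hb : b ∈ Set.range f
  · obtain ⟨k, rfl⟩ := hb
    rw [Finset.sum_eq_single k]
    · rfl
    · intro j hj hjk
      exact absurd (hf (Finset.mem_filter.1 hj).2) hjk
    · simp
  · rw [hm b hb]
    refine Finset.sum_eq_zero fun k hk => absurd ⟨k, (Finset.mem_filter.1 hk).2⟩ hb

theorem map_apply_of_injective {A B : Type} [Fintype A] [Fintype B] {f : A → B}
    (hf : Function.Injective f) (w : stdSimplex ℝ A) (k : A) : stdSimplex.map f w (f k) = w k := by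
  classical
  rw [stdSimplex.map_coe, FunOnFinite.linearMap_apply_apply, Finset.sum_eq_single k]
  · intro j hj hjk
    exact absurd (hf (Finset.mem_filter.1 hj).2) hjk
  · simp

theorem map_apply_of_notMem {A B : Type} [Fintype A] [Fintype B] {f : A → B}
    (w : stdSimplex ℝ A) {b : B} (hb : b ∉ Set.range f) : stdSimplex.map f w b = 0 := by
  classical
  rw [stdSimplex.map_coe, FunOnFinite.linearMap_apply_apply]
  exact Finset.sum_eq_zero fun k hk => absurd ⟨k, (Finset.mem_filter.1 hk).2⟩ hb

/-- Vertices of weight zero are dropped and repeated neighbours are merged. Each move is a face or a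
degeneracy, so it changes neither the point nor the mass on `P`, and it shortens the chain. -/
theorem exists_reduced {a : ℕ} (c : Fin (a + 1) →o P) (w : stdSimplex ℝ (Fin (a + 1))) :
    ∃ (b : ℕ) (q : Fin (b + 1) →o P) (v : stdSimplex ℝ (Fin (b + 1))), StrictMono q ∧
      (∀ k, 0 < v k) ∧ S.point c w = S.point q v ∧ stdSimplex.map c w = stdSimplex.map q v := by
  induction a with
  | zero =>
    refine ⟨0, c, w, fun i j hij => absurd hij (by lia), fun k => ?_, rfl, rfl⟩
    have := stdSimplex.sum_eq_one w
    rw [Fin.sum_univ_one] at this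
    rw [Fin.fin_one_eq_zero k, this]
    exact one_pos
  | succ a ih =>
    have key (c' : Fin (a + 1) →o P) (w' : stdSimplex ℝ (Fin (a + 1)))
        (h : S.point c w = S.point c' w') (h' : stdSimplex.map c w = stdSimplex.map c' w') :
        ∃ (b : ℕ) (q : Fin (b + 1) →o P) (v : stdSimplex ℝ (Fin (b + 1))), StrictMono q ∧
          (∀ k, 0 < v k) ∧ S.point c w = S.point q v ∧
            stdSimplex.map c w = stdSimplex.map q v := by
      obtain ⟨b, q, v, hq, hv, e, e'⟩ := ih c' w'
      exact ⟨b, q, v, hq, hv, h.trans e, h'.trans e'⟩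
    by_cases hw : ∀ k, 0 < w k
    · by_cases hc : StrictMono c
      · exact ⟨_, c, w, hc, hw, rfl, rfl⟩
      · rw [Fin.strictMono_iff_lt_succ] at hc
        push Not at hc
        obtain ⟨k, hk⟩ := hc
        have hk' : c k.castSucc = c k.succ :=
          (c.monotone (Fin.castSucc_le_succ k)).eq_of_not_lt hk
        -- The values at `k` and its successor agree, so `c` factors through the degeneracy that
        -- identifies these two positions.
        have e : c = (c.comp (Fin.succAboveOrderEmb k.succ).toOrderHom).comp
            k.predAboveOrderHom := by
          ext x
          by_cases hx : x = k.succ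
          · subst hx
            simp [hk']
          · simp [Fin.succ_succAbove_predAbove hx]
        have e' : S.point c w = S.point (c.comp (Fin.succAboveOrderEmb k.succ).toOrderHom)
            (stdSimplex.map k.predAboveOrderHom w) := by
          rw [← S.point_comp, ← e]
        refine key _ _ e' ?_
        rw [stdSimplex.map_comp_apply]
        exact congrArg (fun f => stdSimplex.map f w) (congrArg (fun g : _ →o P => (g : _ → P)) e)
    · push Not at hw
      obtain ⟨k, hk⟩ := hw
      -- As the weight at `k` vanishes, `w` is pushed forward from the face opposite to `k`.
      obtain ⟨w', hw', -⟩ := exists_map_eq (Fin.succAbove_right_injective (p := k)) w fun b hb => by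
        rw [Fin.range_succAbove, Set.mem_compl_iff, not_not] at hb
        rw [Set.mem_singleton_iff.1 hb]
        exact le_antisymm hk (w.2.1 k)
      refine key (c.comp (Fin.succAboveOrderEmb k).toOrderHom) w' ?_ ?_
      · rw [S.point_comp, ← hw']
        rfl
      · rw [← hw', stdSimplex.map_comp_apply]
        rfl

/-- A reduced form can be read off from its mass: the support is the range of a strictly increasing
chain and determines it, and the values on the support are the weights. -/
theorem point_eq {a b : ℕ} {c : Fin (a + 1) →o P} {w : stdSimplex ℝ (Fin (a + 1))}
    {c' : Fin (b + 1) →o P} {w' : stdSimplex ℝ (Fin (b + 1))}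
    (h : stdSimplex.map c w = stdSimplex.map c' w') : S.point c w = S.point c' w' := by
  obtain ⟨m, q, v, hq, hv, e, e₁⟩ := S.exists_reduced c w
  obtain ⟨n, q', v', hq', hv', e', e₁'⟩ := S.exists_reduced c' w'
  rw [e, e']
  have hh : stdSimplex.map q v = stdSimplex.map q' v' := e₁.symm.trans (h.trans e₁')
  have range_eq {a : ℕ} (q : Fin (a + 1) →o P) (hq : StrictMono q)
      (v : stdSimplex ℝ (Fin (a + 1))) (hv : ∀ k, 0 < v k) :
      Set.range q = {p | stdSimplex.map q v p ≠ 0} := by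
    ext p
    constructor
    · rintro ⟨k, rfl⟩
      rw [Set.mem_ofPred_eq, map_apply_of_injective hq.injective]
      exact (hv k).ne'
    · intro hp
      by_contra hp'
      exact hp (map_apply_of_notMem v hp')
  have hr : Set.range q = Set.range q' := by
    rw [range_eq q hq v hv, range_eq q' hq' v' hv', hh]
  obtain rfl : m = n := by
    have := congrArg Set.ncard hr
    rw [← Set.image_univ, ← Set.image_univ, Set.ncard_image_of_injective _ hq.injective,
      Set.ncard_image_of_injective _ hq'.injective] at this
    simpa using this
  obtain rfl : q = q' := OrderHom.ext _ _ ((StrictMono.range_inj hq hq').1 hr)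
  congr 1
  ext k
  rw [← map_apply_of_injective hq.injective v, hh, map_apply_of_injective hq.injective]

end ChainFamily

end Realization

/-! ### Mass distributions on a prism -/

section Prism

open Finset

/-- The part of the weight `t i` that lies below the level `r` if the weights are stacked. -/
noncomputable def cut {n : ℕ} (t : Fin (n + 1) → ℝ) (r : ℝ) (i : Fin (n + 1)) : ℝ :=
  min (∑ k ∈ Iic i, t k) r - min (∑ k ∈ Iio i, t k) r

theorem sum_Iic_eq {n : ℕ} (t : Fin (n + 1) → ℝ) (i : Fin (n + 1)) :
    ∑ k ∈ Iic i, t k = ∑ k ∈ Iio i, t k + t i := by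
  rw [← Iio_insert, sum_insert (by simp), add_comm]

/-- The sum telescopes, because a lower set is an initial segment; the assumption on `r` covers the
empty segment. -/
theorem sum_cut {n : ℕ} (t : Fin (n + 1) → ℝ) {r : ℝ} (hr : 0 ≤ r) {L : Finset (Fin (n + 1))}
    (hL : IsLowerSet (L : Set (Fin (n + 1)))) : ∑ i ∈ L, cut t r i = min (∑ i ∈ L, t i) r := by
  induction L using Finset.induction_on_max with
  | empty => simp [hr]
  | insert a L ha ih =>
    have hL' : L = Iio a := by
      ext x
      rw [mem_Iio]
      refine ⟨ha x, fun h => ?_⟩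
      have := hL h.le (by simp : a ∈ ((insert a L : Finset _) : Set _))
      simpa [h.ne] using this
    have hL'' : insert a L = Iic a := by rw [hL', Iio_insert]
    have e := ih (by rw [hL', coe_Iio]; exact isLowerSet_Iio a)
    rw [sum_insert (fun h => lt_irrefl a (ha a h)), e, hL'', hL', cut, sub_add_cancel]

theorem cut_nonneg {n : ℕ} {t : Fin (n + 1) → ℝ} (ht : ∀ i, 0 ≤ t i) (r : ℝ) (i : Fin (n + 1)) :
    0 ≤ cut t r i := by
  rw [cut, sum_Iic_eq, sub_nonneg]
  exact min_le_min_right r (le_add_of_nonneg_right (ht i))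

theorem cut_le {n : ℕ} {t : Fin (n + 1) → ℝ} (ht : ∀ i, 0 ≤ t i) (r : ℝ) (i : Fin (n + 1)) :
    cut t r i ≤ t i := by
  rw [cut, sum_Iic_eq, sub_le_iff_le_add, ← min_add_add_left, add_comm (t i)]
  exact min_le_min_left _ (le_add_of_nonneg_left (ht i))

theorem sum_map {m n : ℕ} (φ : Fin (m + 1) → Fin (n + 1)) (t : stdSimplex ℝ (Fin (m + 1)))
    (L : Finset (Fin (n + 1))) :
    ∑ k ∈ L, stdSimplex.map φ t k = ∑ i with φ i ∈ L, t i := by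
  simp only [stdSimplex.map_coe, FunOnFinite.linearMap_apply_apply]
  rw [← sum_fiberwise_of_maps_to (s := univ.filter fun i => φ i ∈ L) (t := L) (g := φ)
    (fun i hi => (mem_filter.1 hi).2)]
  refine sum_congr rfl fun k hk => sum_congr ?_ fun _ _ => rfl
  ext i
  simp only [mem_filter, mem_univ, true_and]
  exact ⟨fun h => ⟨h ▸ hk, h⟩, fun h => h.2⟩

/-- Monotonicity of `φ` makes preimages of initial segments lower sets, so `sum_cut` evaluates both
partial sums. This is what makes the homotopy compatible with faces and degeneracies. -/
theorem cut_map {m n : ℕ} (φ : Fin (m + 1) →o Fin (n + 1)) (t : stdSimplex ℝ (Fin (m + 1)))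
    {r : ℝ} (hr : 0 ≤ r) (k : Fin (n + 1)) :
    cut (stdSimplex.map φ t) r k = ∑ i with φ i = k, cut t r i := by
  rw [cut, sum_map, sum_map, ← sum_cut _ hr, ← sum_cut _ hr, sub_eq_iff_eq_add, ← sum_union]
  · refine sum_congr ?_ fun _ _ => rfl
    ext i
    simp [le_iff_eq_or_lt]
  · rw [disjoint_filter]
    intro i _ h h'
    simp [h] at h'
  · intro i j hij hi
    simp only [coe_filter, mem_univ, true_and, Set.mem_ofPred_eq, mem_Iio] at hi ⊢
    exact (φ.monotone hij).trans_lt hi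
  · intro i j hij hi
    simp only [coe_filter, mem_univ, true_and, Set.mem_ofPred_eq, mem_Iic] at hi ⊢
    exact (φ.monotone hij).trans hi

open unitInterval

/-- The weights on the vertices of a prism that describe the point over `t` at time `s`. -/
noncomputable def prismMass {n : ℕ} (t : stdSimplex ℝ (Fin (n + 1))) (s : I) :
    stdSimplex ℝ (Fin (n + 1) × Fin 2) :=
  ⟨fun p => if p.2 = 0 then cut t (1 - s) p.1 else t p.1 - cut t (1 - s) p.1, fun p => by
    dsimp only
    split_ifs
    · exact cut_nonneg t.2.1 _ _
    · exact sub_nonneg.2 (cut_le t.2.1 _ _), by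
    rw [Fintype.sum_prod_type]
    simp⟩

theorem prismMass_zero {n : ℕ} (t : stdSimplex ℝ (Fin (n + 1))) (s : I) (i : Fin (n + 1)) :
    prismMass t s (i, 0) = cut t (1 - s) i := rfl

theorem prismMass_one {n : ℕ} (t : stdSimplex ℝ (Fin (n + 1))) (s : I) (i : Fin (n + 1)) :
    prismMass t s (i, 1) = t i - cut t (1 - s) i := rfl

theorem map_prismMass {m n : ℕ} (φ : Fin (m + 1) →o Fin (n + 1)) (t : stdSimplex ℝ (Fin (m + 1)))
    (s : I) : stdSimplex.map (Prod.map φ id) (prismMass t s) =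
      prismMass (stdSimplex.map φ t) s := by
  have h (k : Fin (n + 1)) (ε : Fin 2) : stdSimplex.map (Prod.map φ id) (prismMass t s) (k, ε) =
      ∑ i with φ i = k, prismMass t s (i, ε) := by
    rw [stdSimplex.map_coe, FunOnFinite.linearMap_apply_apply]
    refine (sum_bij (fun i _ => (i, ε)) ?_ ?_ ?_ fun _ _ => rfl).symm
    · simp
    · simp
    · rintro ⟨i, δ⟩ hi
      simp only [mem_filter, mem_univ, true_and, Prod.map_apply, id_eq, Prod.mk.injEq] at hi
      exact ⟨i, by simpa using hi.1, by rw [hi.2]⟩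
  have hs : 0 ≤ 1 - (s : ℝ) := sub_nonneg.2 s.2.2
  ext ⟨k, ε⟩
  refine (h k ε).trans ?_
  obtain rfl | rfl : ε = 0 ∨ ε = 1 := by lia
  · simp only [prismMass_zero]
    rw [cut_map φ t hs]
  · simp only [prismMass_one]
    rw [cut_map φ t hs, sum_sub_distrib, stdSimplex.map_coe, FunOnFinite.linearMap_apply_apply]

theorem prismMass_at_zero {n : ℕ} (t : stdSimplex ℝ (Fin (n + 1))) :
    prismMass t 0 = stdSimplex.map (fun i => (i, 0)) t := by
  have h (L : Finset (Fin (n + 1))) : ∑ i ∈ L, t i ≤ 1 - ((0 : I) : ℝ) := by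
    rw [Set.Icc.coe_zero, sub_zero, ← stdSimplex.sum_eq_one t]
    exact sum_le_sum_of_subset_of_nonneg (subset_univ _) fun i _ _ => t.2.1 i
  have hc (i : Fin (n + 1)) : cut t (1 - ((0 : I) : ℝ)) i = t i := by
    rw [cut, min_eq_left (h _), min_eq_left (h _), sum_Iic_eq]
    ring
  ext ⟨i, ε⟩
  obtain rfl | rfl : ε = 0 ∨ ε = 1 := by lia
  · refine Eq.trans (hc i) (ChainFamily.map_apply_of_injective ?_ t i).symm
    exact fun i j h => congrArg Prod.fst h
  · refine Eq.trans (sub_eq_zero.2 (hc i).symm) (ChainFamily.map_apply_of_notMem t ?_).symm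
    simp

theorem prismMass_at_one {n : ℕ} (t : stdSimplex ℝ (Fin (n + 1))) :
    prismMass t 1 = stdSimplex.map (fun i => (i, 1)) t := by
  have h (L : Finset (Fin (n + 1))) : 1 - ((1 : I) : ℝ) ≤ ∑ i ∈ L, t i := by
    rw [Set.Icc.coe_one, sub_self]
    exact sum_nonneg fun i _ => t.2.1 i
  have hc (i : Fin (n + 1)) : cut t (1 - ((1 : I) : ℝ)) i = 0 := by
    rw [cut, min_eq_right (h _), min_eq_right (h _), sub_self]
  ext ⟨i, ε⟩
  obtain rfl | rfl : ε = 0 ∨ ε = 1 := by lia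
  · refine Eq.trans (hc i) (ChainFamily.map_apply_of_notMem t ?_).symm
    simp
  · refine Eq.trans (b := t i) ?_ (ChainFamily.map_apply_of_injective ?_ t i).symm
    · rw [prismMass_one, hc, sub_zero]
    · exact fun i j h => congrArg Prod.fst h

theorem continuous_prismMass (n : ℕ) :
    Continuous fun p : stdSimplex ℝ (Fin (n + 1)) × I => prismMass p.1 p.2 := by
  have hv (i : Fin (n + 1)) :
      Continuous fun p : stdSimplex ℝ (Fin (n + 1)) × I => p.1 i :=
    (continuous_apply i).comp (continuous_subtype_val.comp continuous_fst)
  have hs (L : Finset (Fin (n + 1))) :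
      Continuous fun p : stdSimplex ℝ (Fin (n + 1)) × I => ∑ i ∈ L, p.1 i :=
    continuous_finsetSum L fun i _ => hv i
  have hr : Continuous fun p : stdSimplex ℝ (Fin (n + 1)) × I => 1 - (p.2 : ℝ) :=
    continuous_const.sub (continuous_subtype_val.comp continuous_snd)
  have hc (i : Fin (n + 1)) : Continuous fun p : stdSimplex ℝ (Fin (n + 1)) × I =>
      cut p.1 (1 - p.2) i := ((hs _).min hr).sub ((hs _).min hr)
  refine Continuous.subtype_mk (continuous_pi fun q => ?_) _
  by_cases hq : q.2 = 0
  · simpa only [hq, if_true] using hc q.1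
  · simp only [hq, if_false]
    exact (hv q.1).sub (hc q.1)

/-- The maximal chain of the vertices of a prism that changes its level at `j`. -/
def prismChain {n : ℕ} (j : Fin (n + 1)) : Fin (n + 2) →o Fin (n + 1) × Fin 2 where
  toFun k := (j.predAbove k, if k ≤ j.castSucc then 0 else 1)
  monotone' k l h := by
    refine Prod.mk_le_mk.2 ⟨j.predAbove_right_monotone h, ?_⟩
    split_ifs with h₁ h₂
    · exact le_rfl
    · exact Fin.zero_le _
    · exact absurd (h.trans ‹_›) h₁
    · exact le_rfl

theorem prismChain_castSucc {n : ℕ} {i j : Fin (n + 1)} (h : i ≤ j) :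
    prismChain j i.castSucc = (i, 0) := by
  have h' : i.castSucc ≤ j.castSucc := Fin.castSucc_le_castSucc_iff.2 h
  change (j.predAbove i.castSucc, if i.castSucc ≤ j.castSucc then 0 else 1) = (i, 0)
  rw [Fin.predAbove_of_le_castSucc _ _ h', if_pos h', Fin.castPred_castSucc]

theorem prismChain_succ {n : ℕ} {i j : Fin (n + 1)} (h : j ≤ i) :
    prismChain j i.succ = (i, 1) := by
  have h' : j.castSucc < i.succ := Fin.castSucc_lt_succ_iff.2 h
  change (j.predAbove i.succ, if i.succ ≤ j.castSucc then 0 else 1) = (i, 1)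
  rw [Fin.predAbove_of_castSucc_lt _ _ h', if_neg h'.not_ge, Fin.pred_succ]

theorem prismChain_injective {n : ℕ} (j : Fin (n + 1)) : Function.Injective (prismChain j) := by
  have h (k : Fin (n + 2)) : (∃ i ≤ j, k = i.castSucc) ∨ ∃ i, j ≤ i ∧ k = i.succ := by
    obtain hk | hk := le_or_gt k j.castSucc
    · exact Or.inl ⟨k.castPred (hk.trans_lt (Fin.castSucc_lt_last j)).ne,
        (Fin.castPred_le_iff _).2 hk, by simp⟩
    · exact Or.inr ⟨k.pred (by rintro rfl; simp at hk), (Fin.le_pred_iff _).2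
        (Fin.castSucc_lt_iff_succ_le.1 hk), by simp⟩
  intro k l hkl
  obtain ⟨i, hi, rfl⟩ | ⟨i, hi, rfl⟩ := h k <;> obtain ⟨i', hi', rfl⟩ | ⟨i', hi', rfl⟩ := h l
  · rw [prismChain_castSucc hi, prismChain_castSucc hi'] at hkl
    exact congrArg _ (congrArg Prod.fst hkl)
  · rw [prismChain_castSucc hi, prismChain_succ hi'] at hkl
    simp at hkl
  · rw [prismChain_succ hi, prismChain_castSucc hi'] at hkl
    simp at hkl
  · rw [prismChain_succ hi, prismChain_succ hi'] at hkl
    exact congrArg _ (congrArg Prod.fst hkl)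

/-- The part of a prism that is described by the chain that changes its level at `j`. -/
def prismPiece {n : ℕ} (j : Fin (n + 1)) : Set (stdSimplex ℝ (Fin (n + 1)) × I) :=
  {p | ∑ k ∈ Iio j, p.1 k ≤ 1 - p.2 ∧ 1 - (p.2 : ℝ) ≤ ∑ k ∈ Iic j, p.1 k}

theorem isClosed_prismPiece {n : ℕ} (j : Fin (n + 1)) : IsClosed (prismPiece j) := by
  have hs (L : Finset (Fin (n + 1))) :
      Continuous fun p : stdSimplex ℝ (Fin (n + 1)) × I => ∑ i ∈ L, p.1 i :=
    continuous_finsetSum L fun i _ =>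
      (continuous_apply i).comp (continuous_subtype_val.comp continuous_fst)
  have hr : Continuous fun p : stdSimplex ℝ (Fin (n + 1)) × I => 1 - (p.2 : ℝ) :=
    continuous_const.sub (continuous_subtype_val.comp continuous_snd)
  exact (isClosed_le (hs _) hr).inter (isClosed_le hr (hs _))

/-- The stacked weights reach the total height one, so they cross the level `1 - s` at some index;
otherwise induction would keep every partial sum below that level. -/
theorem exists_mem_prismPiece {n : ℕ} (p : stdSimplex ℝ (Fin (n + 1)) × I) :
    ∃ j, p ∈ prismPiece j := by
  by_contra! h
  have h' (j : Fin (n + 1)) : ∑ k ∈ Iic j, p.1 k < 1 - p.2 := by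
    induction j using Fin.induction with
    | zero =>
      have := h 0
      by_contra! h'
      exact this ⟨by
        rw [show Iio (0 : Fin (n + 1)) = ∅ from by ext; simp]
        simpa using p.2.2.2, h'⟩
    | succ j ih =>
      by_contra! h'
      refine h j.succ ⟨?_, h'⟩
      have : Iio j.succ = Iic j.castSucc := by
        ext k
        simp [Fin.lt_def, Fin.le_def]
      rw [this]
      exact ih.le
  have := h' (Fin.last n)
  rw [show Iic (Fin.last n) = univ from by ext; simp [Fin.le_last], stdSimplex.sum_eq_one] at this
  linarith [p.2.2.1]

/-- On this piece the level passes through the weight of `j`: earlier weights lie entirely below it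
and later ones entirely above it. -/
theorem prismMass_eq_zero {n : ℕ} {j : Fin (n + 1)} {p : stdSimplex ℝ (Fin (n + 1)) × I}
    (hp : p ∈ prismPiece j) (q : Fin (n + 1) × Fin 2) (hq : q ∉ Set.range (prismChain j)) :
    prismMass p.1 p.2 q = 0 := by
  obtain ⟨i, ε⟩ := q
  have hsub {L L' : Finset (Fin (n + 1))} (h : L ⊆ L') : ∑ k ∈ L, p.1 k ≤ ∑ k ∈ L', p.1 k :=
    sum_le_sum_of_subset_of_nonneg h fun i _ _ => p.1.2.1 i
  obtain rfl | rfl : ε = 0 ∨ ε = 1 := by lia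
  · have hij : j < i := by
      by_contra! h
      exact hq ⟨_, prismChain_castSucc h⟩
    have h₁ : 1 - (p.2 : ℝ) ≤ ∑ k ∈ Iio i, p.1 k :=
      hp.2.trans (hsub fun k hk => mem_Iio.2 ((mem_Iic.1 hk).trans_lt hij))
    rw [prismMass_zero, cut, min_eq_right h₁,
      min_eq_right (h₁.trans (hsub fun k hk => mem_Iic.2 (mem_Iio.1 hk).le)), sub_self]
  · have hij : i < j := by
      by_contra! h
      exact hq ⟨_, prismChain_succ h⟩
    have h₁ : ∑ k ∈ Iic i, p.1 k ≤ 1 - (p.2 : ℝ) :=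
      (hsub fun k hk => mem_Iio.2 ((mem_Iic.1 hk).trans_lt hij)).trans hp.1
    rw [prismMass_one, cut, min_eq_left h₁,
      min_eq_left ((hsub fun k hk => mem_Iic.2 (mem_Iio.1 hk).le).trans h₁), sum_Iic_eq]
    ring

end Prism

/-! ### The homotopy of a natural transformation -/

section NerveHomotopy

open Opposite Simplicial unitInterval

universe w

namespace ChainFamily

variable {n : ℕ} {Y : SSet.{w}} (S : ChainFamily (Fin (n + 1) × Fin 2) Y)

theorem exists_prismChain (p : stdSimplex ℝ (Fin (n + 1)) × I) :
    ∃ (j : Fin (n + 1)) (w : stdSimplex ℝ (Fin (n + 2))),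
      stdSimplex.map (prismChain j) w = prismMass p.1 p.2 := by
  obtain ⟨j, hj⟩ := exists_mem_prismPiece p
  obtain ⟨w, hw, -⟩ := exists_map_eq (prismChain_injective j) _ (prismMass_eq_zero hj)
  exact ⟨j, w, hw⟩

/-- The map from a prism to the realization that is given by the chains of vertices. -/
noncomputable def prismFun (p : stdSimplex ℝ (Fin (n + 1)) × I) : SSet.toTop.obj Y :=
  S.point (prismChain (exists_prismChain p).choose) (exists_prismChain p).choose_spec.choose

/-- The choices in `prismFun` do not matter, and any chain that carries the mass may be used,
maximal or not. -/
theorem prismFun_eq {a : ℕ} {c : Fin (a + 1) →o Fin (n + 1) × Fin 2}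
    {w : stdSimplex ℝ (Fin (a + 1))} {p : stdSimplex ℝ (Fin (n + 1)) × I}
    (h : stdSimplex.map c w = prismMass p.1 p.2) : S.prismFun p = S.point c w :=
  S.point_eq ((exists_prismChain p).choose_spec.choose_spec.trans h.symm)

theorem continuous_prismFun : Continuous S.prismFun := by
  refine (locallyFinite_of_finite (prismPiece (n := n))).continuous
    (Set.eq_univ_of_forall fun p => Set.mem_iUnion.2 (exists_mem_prismPiece p))
    isClosed_prismPiece fun j => ?_
  rw [continuousOn_iff_continuous_domRestrict]
  -- On a fixed closed piece the chain is constant and its weights are coordinates of `prismMass`,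
  -- so they vary continuously; finitely many pieces cover the prism.
  choose w hw hw' using fun p : prismPiece j =>
    exists_map_eq (prismChain_injective j) _ (prismMass_eq_zero p.2)
  have hc : Continuous w := by
    refine continuous_induced_rng.2 (continuous_pi fun k => ?_)
    refine Continuous.congr (f := fun p : prismPiece j =>
      prismMass p.1.1 p.1.2 (prismChain j k)) ?_ fun p => (hw' p k).symm
    exact (continuous_apply _).comp (continuous_subtype_val.comp
      ((continuous_prismMass n).comp continuous_subtype_val))
  exact ((S.point (prismChain j)).continuous.comp hc).congr fun p => (S.prismFun_eq (hw p)).symm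

end ChainFamily

variable {C D : Type u} [Category.{v} C] [Category.{v} D] {F G : C ⥤ D}

/-- The simplices of the nerve of `D` that a natural transformation makes of a simplex of the
nerve of `C`. -/
def prismFamily (α : F ⟶ G) {n : ℕ} (τ : ComposableArrows C n) :
    ChainFamily (Fin (n + 1) × Fin 2) (nerve D) where
  simplex c :=
    (Functor.prod' (Monotone.functor (f := fun k => (c k).2) fun k l h => (c.monotone h).2)
      (Monotone.functor (f := fun k => (c k).1) (fun k l h => (c.monotone h).1) ⋙ τ) ⋙
      Functor.uncurry.obj (ComposableArrows.mk₁ α) : ComposableArrows D _)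
  simplex_comp c ψ := rfl

/-- The inclusion of a simplex as the bottom or the top of a prism. -/
def prismEnd (n : ℕ) (ε : Fin 2) : Fin (n + 1) →o Fin (n + 1) × Fin 2 where
  toFun i := (i, ε)
  monotone' i j h := ⟨h, le_rfl⟩

theorem prismFamily_simplex_zero (α : F ⟶ G) {n : ℕ} (τ : ComposableArrows C n) :
    (prismFamily α τ).simplex (prismEnd n 0) = (nerveMap F).app (op ⦋n⦌) τ := by
  refine CategoryTheory.Functor.ext (fun _ => rfl) fun i j f => ?_
  change (𝟙 F : F ⟶ F).app (τ.obj i) ≫ F.map (τ.map f) = 𝟙 _ ≫ F.map (τ.map f) ≫ 𝟙 _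
  rw [NatTrans.id_app, Category.comp_id]

theorem prismFamily_simplex_one (α : F ⟶ G) {n : ℕ} (τ : ComposableArrows C n) :
    (prismFamily α τ).simplex (prismEnd n 1) = (nerveMap G).app (op ⦋n⦌) τ := by
  refine CategoryTheory.Functor.ext (fun _ => rfl) fun i j f => ?_
  change (𝟙 G : G ⟶ G).app (τ.obj i) ≫ G.map (τ.map f) = 𝟙 _ ≫ G.map (τ.map f) ≫ 𝟙 _
  rw [NatTrans.id_app, Category.comp_id]

/-- With paths as values, the universal property of the realization of `nerve C` applies directly,
and no description of its product with the interval is required. -/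
theorem exists_homotopy (α : F ⟶ G) : ∃ H : SSet.toTop.obj (nerve C) ⟶
      TopCat.of C(I, SSet.toTop.obj (nerve D)), ∀ x, H x 0 = SSet.toTop.map (nerveMap F) x ∧
        H x 1 = SSet.toTop.map (nerveMap G) x := by
  obtain ⟨H, hH⟩ := exists_toTop_hom (X := nerve C)
    (Z := TopCat.of C(I, SSet.toTop.obj (nerve D)))
    (fun n τ => ContinuousMap.curry ⟨_, (prismFamily α τ).continuous_prismFun⟩)
    fun m n φ τ t => by
      ext s
      change (prismFamily α ((nerve C).map φ.op τ)).prismFun (t, s) =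
        (prismFamily α τ).prismFun (stdSimplex.map φ.toOrderHom t, s)
      -- A chain that carries the mass over `t` is pushed forward along `φ`; the result may have
      -- repetitions but carries the mass over the image of `t`.
      obtain ⟨j, w, hw⟩ := ChainFamily.exists_prismChain (t, s)
      rw [ChainFamily.prismFun_eq _ hw]
      refine Eq.trans ?_ (ChainFamily.prismFun_eq _ (w := w)
        (c := (φ.toOrderHom.prodMap OrderHom.id).comp (prismChain j)) ?_).symm
      · rfl
      · rw [← map_prismMass, ← hw, stdSimplex.map_comp_apply]
        rfl
  refine ⟨H, fun x => ⟨?_, ?_⟩⟩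
  · refine congrArg (fun f => f x) (toTop_hom_ext (X := nerve C)
      (f := H ≫ TopCat.ofHom ⟨fun g : C(I, SSet.toTop.obj (nerve D)) => g 0, by fun_prop⟩)
      (g := SSet.toTop.map (nerveMap F)) fun n τ t => ?_)
    rw [toTop_map_charMap]
    refine Eq.trans ?_ (congrArg (fun τ' => charMap (nerve D) τ' t)
      (prismFamily_simplex_zero α τ))
    refine (congrArg (fun g : C(I, SSet.toTop.obj (nerve D)) => g 0) (hH n τ t)).trans ?_
    exact ChainFamily.prismFun_eq _ (c := prismEnd n 0) (prismMass_at_zero t).symm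
  · refine congrArg (fun f => f x) (toTop_hom_ext (X := nerve C)
      (f := H ≫ TopCat.ofHom ⟨fun g : C(I, SSet.toTop.obj (nerve D)) => g 1, by fun_prop⟩)
      (g := SSet.toTop.map (nerveMap G)) fun n τ t => ?_)
    rw [toTop_map_charMap]
    refine Eq.trans ?_ (congrArg (fun τ' => charMap (nerve D) τ' t)
      (prismFamily_simplex_one α τ))
    refine (congrArg (fun g : C(I, SSet.toTop.obj (nerve D)) => g 1) (hH n τ t)).trans ?_
    exact ChainFamily.prismFun_eq _ (c := prismEnd n 1) (prismMass_at_one t).symm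

theorem toTop_nerveMap_homotopic (α : F ⟶ G) : (SSet.toTop.map (nerveMap F)).hom.Homotopic
    (SSet.toTop.map (nerveMap G)).hom := by
  obtain ⟨H, hH⟩ := exists_homotopy α
  exact ⟨{  toFun := fun p => H p.2 p.1
            -- Uncurrying is continuous because the interval is locally compact.
            continuous_toFun := (ContinuousMap.continuous_uncurry_of_continuous H.hom).comp
              continuous_swap
            map_zero_left := fun x => (hH x).1
            map_one_left := fun x => (hH x).2 }⟩

theorem isHomotopyEquivalence_of_natTrans {F : C ⥤ D} {G : D ⥤ C} (h : G ⋙ F = 𝟭 D)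
    (α : 𝟭 C ⟶ F ⋙ G) : IsHomotopyEquivalence F := by
  have e : nerveMap G ≫ nerveMap F = 𝟙 (nerve D) :=
    congrArg nerveMap h
  have e' : SSet.toTop.map (nerveMap G) ≫ SSet.toTop.map (nerveMap F) = 𝟙 _ := by
    rw [← SSet.toTop.map_comp, e, SSet.toTop.map_id]
  refine ⟨{ toFun := (SSet.toTop.map (nerveMap F)).hom
            invFun := (SSet.toTop.map (nerveMap G)).hom
            left_inv := ?_
            right_inv := ?_ }, rfl⟩
  · have h₁ := (toTop_nerveMap_homotopic α).symm
    have h₂ : SSet.toTop.map (nerveMap (𝟭 C)) = 𝟙 _ := SSet.toTop.map_id (nerve C)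
    have h₃ : SSet.toTop.map (nerveMap (F ⋙ G)) =
      SSet.toTop.map (nerveMap F) ≫ SSet.toTop.map (nerveMap G) :=
        SSet.toTop.map_comp (nerveMap F) (nerveMap G)
    rw [h₂, h₃] at h₁
    exact h₁
  · have h₁ := congrArg TopCat.Hom.hom e'
    exact (congrArg (ContinuousMap.Homotopic · _) h₁).mpr (ContinuousMap.Homotopic.refl _)

end NerveHomotopy

theorem theorem2p7 :
    -- The weak left adjoint `L` is a functor from multicategories and multifunctors to
    -- permutative categories and strict maps.
    ((∀ M : MultiData.{v, u}, M.IsMulticategory → (L M).IsPermutative) ∧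
      (∀ (M N : MultiData.{v, u}) (F : MultifunctorData M N),
        M.IsMulticategory → N.IsMulticategory → F.IsMultifunctor →
          IsStrictMap (L M) (L N) (LMap F)) ∧
      (∀ M : MultiData.{v, u}, LMap (MultifunctorData.id M) = FunctorData.id (L M).toCatData) ∧
      (∀ (M N P : MultiData.{v, u}) (F : MultifunctorData M N) (G : MultifunctorData N P),
        LMap (F.comp G) = (LMap F).comp (LMap G))) ∧
    -- `U` is a functor from symmetric monoidal categories and lax symmetric monoidal functors to
    -- multicategories, and hence `LU` lands in permutative categories and strict maps.
    ((∀ (C : Type u) [Category.{v} C] [MonoidalCategory C] [SymmetricCategory C],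
        (U C).IsMulticategory ∧ (L (U C)).IsPermutative) ∧
      (∀ (C D : Type u) [Category.{v} C] [MonoidalCategory C] [SymmetricCategory C]
        [Category.{v} D] [MonoidalCategory D] [SymmetricCategory D] (F : C ⥤ D) [F.LaxBraided],
        (UMap F).IsMultifunctor ∧ IsStrictMap (L (U C)) (L (U D)) (LMap (UMap F))) ∧
      (∀ (C : Type u) [Category.{v} C] [MonoidalCategory C] [SymmetricCategory C],
        UMap (𝟭 C) = MultifunctorData.id (U C)) ∧
      (∀ (C D E : Type u) [Category.{v} C] [MonoidalCategory C] [SymmetricCategory C]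
        [Category.{v} D] [MonoidalCategory D] [SymmetricCategory D]
        [Category.{v} E] [MonoidalCategory E] [SymmetricCategory E]
        (F : C ⥤ D) [F.LaxBraided] (G : D ⥤ E) [G.LaxBraided],
        UMap (F ⋙ G) = (UMap F).comp (UMap G))) ∧
    -- The weak counit is a homotopy equivalence of categories.  The unit is a right inverse of
    -- it, and `nu` is a natural map from the identity to the other composite.
    (∀ (C : Type u) [Category.{v} C] [MonoidalCategory C] [SymmetricCategory C],
      ∃ (hL : (L (U C)).IsCategory) (hε : (counit C).IsFunctor),
        @IsHomotopyEquivalence (L (U C)).Ob C hL.category _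
          (hε.functor hL (CatData.of_isCategory C)) ∧
        (unitFunctor C).IsFunctor ∧
        (unitFunctor C).comp (counit C) = FunctorData.id (CatData.of C) ∧
        ∀ (x y : (L (U C)).Ob) (F : (L (U C)).Hom x y),
          (L (U C)).comp F (nu C y) =
            (L (U C)).comp (nu C x) ((unitFunctor C).map ((counit C).map F))) := by
  refine ⟨⟨fun M hM => L_isPermutative hM, fun M N F hM hN hF => LMap_isStrictMap hF,
    fun M => rfl, fun M N P F G => rfl⟩,
    ⟨fun C _ _ _ => ⟨U_isMulticategory C, L_isPermutative (U_isMulticategory C)⟩,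
      fun C D _ _ _ _ _ _ F _ => ⟨UMap_isMultifunctor F,
        LMap_isStrictMap (UMap_isMultifunctor F)⟩,
      fun C _ _ _ => UMap_id, fun C D E _ _ _ _ _ _ _ _ _ F _ G _ => UMap_comp F G⟩,
    fun C _ _ _ => ⟨L_isCategory (U_isMulticategory C), counit_isFunctor C, ?_,
      unitFunctor_isFunctor C, unitFunctor_comp_counit C, nu_natural C⟩⟩
  let := (L_isCategory (U_isMulticategory C)).category
  exact isHomotopyEquivalence_of_natTrans (C := (L (U C)).Ob) (D := C)
    (G := (unitFunctor_isFunctor C).functor (CatData.of_isCategory C)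
      (L_isCategory (U_isMulticategory C)))
    -- The product of a tuple of length one is its entry by definition, so on objects the composite
    -- is the identity.
    (CategoryTheory.Functor.ext (fun _ => rfl) fun a b f => by
      refine Eq.trans ?_ ((Category.id_comp (X := a) (Y := b) _).trans (Category.comp_id _)).symm
      exact counit_map_single (x := ⟨1, fun _ => a⟩) f)
    { app := fun x => nu C x
      naturality := fun x y f => nu_natural C x y f }
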